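/- Let $(X,J)$ be a smooth almost complex manifold of real dimension $2n$. If $u$ is a real distribution on $X$ and $\xi$ a smooth real vector field, the almost complex Hessian is $H_Ju(\xi)=i\partial_J\bar\partial_Ju(\xi,J\xi)$, where $\bar\partial_Ju(V)=V^{0,1}.u$ and, for a current $\alpha$ of degree one, $\partial_J\alpha(V,W)=V^{1,0}.\alpha(W)-W^{1,0}.\alpha(V)-\alpha\big([V^{1,0},W^{1,0}]^{1,0}+[V^{0,1},W^{1,0}]^{0,1}+[V^{1,0},W^{0,1}]^{0,1}\big)$. In smooth complex-valued coordinates $z=(z_1,\dots,z_n)$ centred at $x\in X$ write $\xi=\sum_k(\xi_k\,\partial/\partial z_k+\bar\xi_k\,\partial/\partial\bar z_k)$ and $$J=\sum_{k,l}\Big(A_{k,l}\,dz_l\otimes\tfrac{\partial}{\partial z_k}+B_{k,l}\,dz_l\otimes\tfrac{\partial}{\partial\bar z_k}+\overline{B}_{k,l}\,d\bar z_l\otimes\tfrac{\partial}{\partial z_k}+\overline{A}_{k,l}\,d\bar z_l\otimes\tfrac{\partial}{\partial\bar z_k}\Big).$$ Let $N\ge3$. The coordinates are called almost complex coordinates of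 order $N$ at $x$ if $A(0)=iI_n$ and, for all $k,l$ and $p+q\le N$, the coefficient of $z_{r_1}\cdots z_{r_p}\bar z_{s_1}\cdots\bar z_{s_q}$ in the Taylor expansion of $B_{k,l}$ at $0$ vanishes whenever $r_1,\dots,r_p\le l$ (in particular whenever $p=0$). Thus $$B(z)=\sum_rB^rz_r+\sum_{r,s}(B^{r,s}z_rz_s+B^{r,\bar s}z_r\bar z_s)+\sum_{r,s,t}(B^{r,s,t}z_rz_sz_t+B^{r,s,\bar t}z_rz_s\bar z_t+B^{r,\bar s,\bar t}z_r\bar z_s\bar z_t)+O(|z|^4),$$ with coefficients symmetric in the holomorphic indices and in the antiholomorphic indices. Let $\mathbf{jet}_2B$ be the Taylor polynomial of degree $2$ of $B$ at $0$. Below, $O(|z|^3)(\xi,\bar\xi)$ denotes a real-valued homogeneous polynomial of degree $2$ in the $\xi_k,\bar\xi_k$ whose coefficients are linear combinations of the first and second order derivatives of $u$ with respect to the $z_k,\bar z_k$. The functions multiplying these derivatives are complex smooth functions on a neighbourhood of $0$, lie in the cube of the ideal of smooth functions vanishing at $0$, and depend on neither $u$ nor $\xi$; in particular the coefficients of the polynomial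 lie in $\mathfrak m^3\cdot\mathcal D'_0$, where $\mathfrak m$ is the maximal ideal of the ring of germs at $0$ of smooth complex functions. (1) In almost complex coordinates of order $N\ge3$ at $x$ there is a neighbourhood of $0$ on which, for all $u$ and $\xi$, $$H_Ju(\xi)=2\sum_{k,l}\frac{\partial^2u}{\partial z_k\partial\bar z_l}\xi_k\bar\xi_l+\sum_{k,l}\mathrm{Re}\Big[Q_{k,\bar l}(z,\xi)\frac{\partial^2u}{\partial z_k\partial\bar z_l}+Q_{k,l}(z,\xi)\frac{\partial^2u}{\partial z_k\partial z_l}\Big]+\sum_{k,l,s}\mathrm{Re}\Big[\big(R^s_{k,l}\xi_k\xi_l+R^s_{k,\bar l}\xi_k\bar\xi_l+R^s_{\bar k,\bar l}\bar\xi_k\bar\xi_l\big)\frac{\partial u}{\partial z_s}\Big]+O(|z|^3)(\xi,\bar\xi),$$ where $$Q_{k,\bar l}=2i\sum_t\mathbf{jet}_2B_{l,t}\,\xi_k\xi_t+\sum_{s,t,r,h}\overline B^h_{k,s}\big(B^r_{s,t}\xi_t\bar\xi_l+B^r_{l,t}\xi_t\bar\xi_s\big)z_r\bar z_h,$$ $$Q_{k,l}=i\sum_t\big(\overline{\mathbf{jet}_2B_{k,t}}\,\xi_l\bar\xi_t+\overline{\mathbf{jet}_2B_{l,t}}\,\xi_k\bar\xi_t\big)-\sum_{s,t,r,h}\Big[\tfrac12\big(\overline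 B^h_{k,s}\xi_l\xi_t+\overline B^h_{l,s}\xi_k\xi_t\big)B^r_{s,t}z_r\bar z_h-\overline B^r_{k,s}\overline B^h_{l,t}\bar z_r\bar z_h\bar\xi_s\bar\xi_t\Big],$$ $$R^s_{k,l}=\sum_{r,h}\big(R^{s,r,h}_{k,l}z_rz_h+R^{s,r,\bar h}_{k,l}z_r\bar z_h\big),\qquad R^s_{\bar k,\bar l}=\sum_{r,h}\big(R^{s,r,\bar h}_{\bar k,\bar l}z_r\bar z_h+R^{s,\bar r,\bar h}_{\bar k,\bar l}\bar z_r\bar z_h\big),$$ $$R^s_{k,\bar l}=\sum_r\Big(\sum_tB^r_{t,k}\overline B^t_{s,l}\,z_r+2i\,\overline B^{r,\bar k}_{s,l}\,\bar z_r\Big)+\sum_{r,h}\big(R^{s,r,h}_{k,\bar l}z_rz_h+R^{s,r,\bar h}_{k,\bar l}z_r\bar z_h+R^{s,\bar r,\bar h}_{k,\bar l}\bar z_r\bar z_h\big),$$ with $$R^{s,r,h}_{k,l}=\tfrac i8\sum_{t,j}\overline B^t_{s,j}\big(B^r_{t,k}B^h_{j,l}+B^h_{t,k}B^r_{j,l}+B^r_{t,l}B^h_{j,k}+B^h_{t,l}B^r_{j,k}\big),\qquad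 R^{s,r,\bar h}_{k,l}=-\tfrac12\sum_t\big(\overline B^{h,\bar k}_{s,t}B^r_{t,l}+\overline B^{h,\bar l}_{s,t}B^r_{t,k}\big),$$ $$R^{s,r,h}_{k,\bar l}=\tfrac12\sum_t\big(B^r_{t,k}\overline B^{t,\bar h}_{s,l}+B^h_{t,k}\overline B^{t,\bar r}_{s,l}+2B^{r,h}_{t,k}\overline B^t_{s,l}\big),$$ $$R^{s,r,\bar h}_{k,\bar l}=4i\,\overline B^{h,\bar r,\bar k}_{s,l}+\sum_t\big(2B^r_{t,k}\overline B^{t,h}_{s,l}+B^{r,\bar h}_{t,k}\overline B^t_{s,l}+B^{r,\bar l}_{t,k}\overline B^h_{s,t}\big),$$ $$R^{s,\bar r,\bar h}_{k,\bar l}=2i\,\overline B^{r,h,\bar k}_{s,l}+\tfrac i4\sum_{t,j}\big(\overline B^r_{t,l}\overline B^h_{s,j}+\overline B^h_{t,l}\overline B^r_{s,j}\big)\big(B^t_{j,k}-B^k_{j,t}\big),$$ $$R^{s,r,\bar h}_{\bar k,\bar l}=-\tfrac i4\sum_{t,j}B^r_{t,j}\big(\overline B^h_{j,k}\overline B^t_{s,l}+\overline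 B^h_{j,l}\overline B^t_{s,k}\big),\qquad R^{s,\bar r,\bar h}_{\bar k,\bar l}=\tfrac14\sum_t\big(\overline B^r_{t,k}\overline B^{h,\bar t}_{s,l}+\overline B^h_{t,k}\overline B^{r,\bar t}_{s,l}+\overline B^r_{t,l}\overline B^{h,\bar t}_{s,k}+\overline B^h_{t,l}\overline B^{r,\bar t}_{s,k}\big).$$ (2) If moreover the $1$-jet at $x$ of the torsion $\tau_J(V,W)=[V^{1,0},W^{1,0}]^{0,1}$ vanishes, then near $0$ $$H_Ju(\xi)=2\sum_{k,l}\frac{\partial^2u}{\partial z_k\partial\bar z_l}\xi_k\bar\xi_l-2\sum_{k,l,s,r,h}\mathrm{Im}\Big[\big(2\overline B^{h,\bar r,\bar k}_{s,l}z_r\bar z_h+\overline B^{r,h,\bar k}_{s,l}\bar z_r\bar z_h\big)\frac{\partial u}{\partial z_s}\xi_k\bar\xi_l\Big]+O(|z|^3)(\xi,\bar\xi).$$ (3) In the integrable case, with respect to any complex coordinates centred at $x$ (smooth coordinates in which $J$ is multiplication by $i$), one has exactly, on the whole coordinate domain, $H_Ju(\xi)=2\sum_{k,l}\frac{\partial^2u}{\partial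 z_k\partial\bar z_l}\xi_k\bar\xi_l$. -/

import Mathlib

open scoped Distributions ContDiff Manifold LineDeriv

noncomputable section

namespace AlmostComplex

/-- The coordinate space `ℂⁿ`, always regarded as a real vector space of dimension `2n`. -/
abbrev Cn (n : ℕ) : Type := Fin n → ℂ

/-! ### Operations on distributions on an open subset of `ℂⁿ` -/

section Distributions

variable {n : ℕ} {Ω : TopologicalSpace.Opens (Cn n)}

lemma contDiff_mul_test {g : Cn n → ℝ} (hg : ContDiffOn ℝ ∞ g Ω) (φ : 𝓓(Ω, ℝ)) :
    ContDiff ℝ ∞ (fun z => φ z * g z) := by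
  rw [contDiff_iff_contDiffAt]
  intro z
  by_cases hz : z ∈ tsupport φ
  · exact φ.contDiff.contDiffAt.mul (hg.contDiffAt (Ω.isOpen.mem_nhds (φ.tsupport_subset hz)))
  · have h0 : (fun z => φ z * g z) =ᶠ[nhds z] fun _ => 0 := by
      filter_upwards [(isClosed_tsupport φ).isOpen_compl.mem_nhds hz] with w hw
      simp [image_eq_zero_of_notMem_tsupport hw]
    exact contDiffAt_const.congr_of_eventuallyEq h0

/-- The product of a test function on `Ω` with a function that is smooth on `Ω`. -/
def mulTest {g : Cn n → ℝ} (hg : ContDiffOn ℝ ∞ g Ω) (φ : 𝓓(Ω, ℝ)) : 𝓓(Ω, ℝ) where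
  toFun := fun z => φ z * g z
  contDiff' := contDiff_mul_test hg φ
  hasCompactSupport' := φ.hasCompactSupport.mul_right
  tsupport_subset' := (tsupport_mul_subset_left).trans φ.tsupport_subset

lemma exists_global_extension {g : Cn n → ℝ} (hg : ContDiffOn ℝ ∞ g Ω)
    (K : TopologicalSpace.Compacts (Cn n)) (hK : (K : Set (Cn n)) ⊆ Ω) :
    ∃ G : Cn n → ℝ, ContDiff ℝ ∞ G ∧ ∀ z ∈ K, G z = g z := by
  obtain ⟨L, hL, hKL, hLΩ⟩ := exists_compact_between K.isCompact Ω.isOpen hK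
  obtain ⟨f, hf1, hf0, -⟩ := exists_contMDiffMap_one_nhds_of_subset_interior (n := ⊤)
    𝓘(ℝ, Cn n) K.isCompact.isClosed hKL
  refine ⟨fun z => f z * g z, ?_, ?_⟩
  · rw [contDiff_iff_contDiffAt]
    intro z
    by_cases hz : z ∈ L
    · exact (f.contMDiff.contDiff.contDiffAt).mul (hg.contDiffAt (Ω.isOpen.mem_nhds (hLΩ hz)))
    · have h0 : (fun z => f z * g z) =ᶠ[nhds z] fun _ => 0 := by
        filter_upwards [hL.isClosed.isOpen_compl.mem_nhds hz] with w hw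
        simp [hf0 w hw]
      exact contDiffAt_const.congr_of_eventuallyEq h0
  · intro z hz
    have := hf1.self_of_nhdsSet z hz
    simp [this]

/-- `φ ↦ φ g` is continuous on the space of test functions. -/
def mulTestCLM {g : Cn n → ℝ} (hg : ContDiffOn ℝ ∞ g Ω) : 𝓓(Ω, ℝ) →L[ℝ] 𝓓(Ω, ℝ) :=
  TestFunction.limitCLM ℝ (mulTest hg)
    (fun K hK => (TestFunction.ofSupportedInCLM ℝ hK).comp
      (ContDiffMapSupportedIn.bilinLeftCLM (ContinuousLinearMap.mul ℝ ℝ)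
        (exists_global_extension hg K hK).choose_spec.1))
    (fun K hK φ => by
      ext z
      change φ z * g z = φ z * (exists_global_extension hg K hK).choose z
      by_cases hz : z ∈ K
      · rw [(exists_global_extension hg K hK).choose_spec.2 z hz]
      · have : φ z = 0 := φ.zero_on_compl hz
        simp [this])

@[simp] lemma mulTestCLM_apply {g : Cn n → ℝ} (hg : ContDiffOn ℝ ∞ g Ω) (φ : 𝓓(Ω, ℝ)) (z : Cn n) :
    mulTestCLM hg φ z = φ z * g z := rfl

lemma contDiffOn_re {f : Cn n → ℂ} (hf : ContDiffOn ℝ ∞ f Ω) :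
    ContDiffOn ℝ ∞ (fun z => (f z).re) Ω := Complex.reCLM.contDiff.comp_contDiffOn hf

lemma contDiffOn_im {f : Cn n → ℂ} (hf : ContDiffOn ℝ ∞ f Ω) :
    ContDiffOn ℝ ∞ (fun z => (f z).im) Ω := Complex.imCLM.contDiff.comp_contDiffOn hf

open Classical in
/-- The product `f T` of a complex distribution `T` on `Ω` with a complex function `f`, smooth on
`Ω` (and `0` if `f` is not smooth on `Ω`): `⟨f T, φ⟩ = ⟨T, (Re f) φ⟩ + i ⟨T, (Im f) φ⟩`. -/
def mulDist (f : Cn n → ℂ) (T : 𝓓'(Ω, ℂ)) : 𝓓'(Ω, ℂ) :=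
  if hf : ContDiffOn ℝ ∞ f Ω then
    (mulTestCLM (contDiffOn_re hf)).precompCompactConvergenceCLM ℂ T +
      Complex.I • (mulTestCLM (contDiffOn_im hf)).precompCompactConvergenceCLM ℂ T
  else 0

lemma mulDist_apply {f : Cn n → ℂ} (hf : ContDiffOn ℝ ∞ f Ω) (T : 𝓓'(Ω, ℂ)) (φ : 𝓓(Ω, ℝ)) :
    mulDist f T φ = T (mulTestCLM (contDiffOn_re hf) φ) +
      Complex.I * T (mulTestCLM (contDiffOn_im hf) φ) := by
  simp [mulDist, hf]
  rfl

/-- The complexification of the restriction to `U` of a real distribution on `Ω`, for `U ≤ Ω`. -/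
def restrictComplex {U : TopologicalSpace.Opens (Cn n)} (_hU : U ≤ Ω) (u : 𝓓'(Ω, ℝ)) : 𝓓'(U, ℂ) :=
  (TestFunction.monoCLM ℝ : 𝓓(U, ℝ) →L[ℝ] 𝓓(Ω, ℝ)).precompCompactConvergenceCLM ℂ
    (Distribution.mapCLM Complex.ofRealCLM u)

/-- The real part of a complex distribution, viewed as a complex distribution. -/
def reDist (T : 𝓓'(Ω, ℂ)) : 𝓓'(Ω, ℂ) :=
  Distribution.mapCLM (Complex.ofRealCLM.comp Complex.reCLM) T

/-- The imaginary part of a complex distribution, viewed as a complex distribution. -/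
def imDist (T : 𝓓'(Ω, ℂ)) : 𝓓'(Ω, ℂ) :=
  Distribution.mapCLM (Complex.ofRealCLM.comp Complex.imCLM) T

/-- The complex conjugate of a complex distribution. -/
def conjDist (T : 𝓓'(Ω, ℂ)) : 𝓓'(Ω, ℂ) :=
  Distribution.mapCLM (Complex.conjCLE : ℂ →L[ℝ] ℂ) T

/-- The derivative `∂T/∂x_k` of a distribution, where `z_k = x_k + i y_k`. -/
def dx (k : Fin n) (T : 𝓓'(Ω, ℂ)) : 𝓓'(Ω, ℂ) := ∂_{(Pi.single k 1 : Cn n)} T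

/-- The derivative `∂T/∂y_k` of a distribution, where `z_k = x_k + i y_k`. -/
def dy (k : Fin n) (T : 𝓓'(Ω, ℂ)) : 𝓓'(Ω, ℂ) := ∂_{(Pi.single k Complex.I : Cn n)} T

/-- The derivative `∂T/∂z_k` of a distribution. -/
def dz (k : Fin n) (T : 𝓓'(Ω, ℂ)) : 𝓓'(Ω, ℂ) :=
  (1 / 2 : ℂ) • (dx k T - Complex.I • dy k T)

/-- The derivative `∂T/∂z̄_k` of a distribution. -/
def dzbar (k : Fin n) (T : 𝓓'(Ω, ℂ)) : 𝓓'(Ω, ℂ) :=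
  (1 / 2 : ℂ) • (dx k T + Complex.I • dy k T)

end Distributions

/-! ### Complex vector fields, the operators `∂_J`, `∂̄_J`, and the almost complex Hessian

Everything here takes place in the coordinate space `ℂⁿ`; a real vector field
`∑ (ξ_k ∂/∂z_k + ξ̄_k ∂/∂z̄_k)` is the map `z ↦ (ξ_1(z), …, ξ_n(z))`, and a field of endomorphisms
of the real tangent bundle is a map `J : ℂⁿ → (ℂⁿ →L[ℝ] ℂⁿ)`. -/

/-- A complex vector field `re + i im`, a section of the complexified tangent bundle. -/
structure ComplexField (n : ℕ) where
  re : Cn n → Cn n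
  im : Cn n → Cn n

namespace ComplexField

variable {n : ℕ}

/-- A real vector field as a complex one. -/
def ofReal (X : Cn n → Cn n) : ComplexField n := ⟨X, fun _ => 0⟩

def add (V W : ComplexField n) : ComplexField n :=
  ⟨fun z => V.re z + W.re z, fun z => V.im z + W.im z⟩

/-- The `(1,0)`-part `(V - i J V) / 2`. -/
def part10 (J : Cn n → Cn n →L[ℝ] Cn n) (V : ComplexField n) : ComplexField n :=
  ⟨fun z => (1 / 2 : ℝ) • (V.re z + J z (V.im z)), fun z => (1 / 2 : ℝ) • (V.im z - J z (V.re z))⟩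

/-- The `(0,1)`-part `(V + i J V) / 2`. -/
def part01 (J : Cn n → Cn n →L[ℝ] Cn n) (V : ComplexField n) : ComplexField n :=
  ⟨fun z => (1 / 2 : ℝ) • (V.re z - J z (V.im z)), fun z => (1 / 2 : ℝ) • (V.im z + J z (V.re z))⟩

/-- The complex bilinear extension of the Lie bracket. -/
def bracket (V W : ComplexField n) : ComplexField n :=
  ⟨fun z => VectorField.lieBracket ℝ V.re W.re z - VectorField.lieBracket ℝ V.im W.im z,
   fun z => VectorField.lieBracket ℝ V.re W.im z + VectorField.lieBracket ℝ V.im W.re z⟩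

/-- The derivative `V . T` of a distribution along a complex vector field. -/
def deriv {Ω : TopologicalSpace.Opens (Cn n)} (V : ComplexField n) (T : 𝓓'(Ω, ℂ)) : 𝓓'(Ω, ℂ) :=
  ∑ k, (mulDist (fun z => ((V.re z k).re : ℂ) + Complex.I * ((V.im z k).re : ℂ)) (dx k T) +
    mulDist (fun z => ((V.re z k).im : ℂ) + Complex.I * ((V.im z k).im : ℂ)) (dy k T))

end ComplexField

section Hessian

variable {n : ℕ} {Ω : TopologicalSpace.Opens (Cn n)}

/-- The current `∂̄_J u` of degree one, as a function of vector fields. -/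
def dbarJ (J : Cn n → Cn n →L[ℝ] Cn n) (u : 𝓓'(Ω, ℂ)) (V : ComplexField n) : 𝓓'(Ω, ℂ) :=
  (V.part01 J).deriv u

/-- The current `∂_J α` of degree two, for a current `α` of degree one:
`∂_J α (V, W) = V^{1,0}.α(W) - W^{1,0}.α(V)
  - α([V^{1,0}, W^{1,0}]^{1,0} + [V^{0,1}, W^{1,0}]^{0,1} + [V^{1,0}, W^{0,1}]^{0,1})`. -/
def delJ (J : Cn n → Cn n →L[ℝ] Cn n) (α : ComplexField n → 𝓓'(Ω, ℂ)) (V W : ComplexField n) :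
    𝓓'(Ω, ℂ) :=
  (V.part10 J).deriv (α W) - (W.part10 J).deriv (α V) -
    α (((((V.part10 J).bracket (W.part10 J)).part10 J).add
      (((V.part01 J).bracket (W.part10 J)).part01 J)).add
        (((V.part10 J).bracket (W.part01 J)).part01 J))

/-- The almost complex Hessian `H_J u (ξ) = i ∂_J ∂̄_J u (ξ, J ξ)` of a distribution `u` along a
real vector field `ξ`. -/
def hessian (J : Cn n → Cn n →L[ℝ] Cn n) (u : 𝓓'(Ω, ℂ)) (ξ : Cn n → Cn n) : 𝓓'(Ω, ℂ) :=
  Complex.I • delJ J (dbarJ J u) (.ofReal ξ) (.ofReal fun z => J z (ξ z))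

/-- The torsion `τ_J(V, W) = [V^{1,0}, W^{1,0}]^{0,1}`. -/
def torsion (J : Cn n → Cn n →L[ℝ] Cn n) (V W : ComplexField n) : ComplexField n :=
  ((V.part10 J).bracket (W.part10 J)).part01 J

/-- The `1`-jet at the origin of the torsion form vanishes: all its components `τ_J(v, w)`, for
constant fields `v`, `w`, vanish at `0` together with their first derivatives. -/
def TorsionOneJetVanishes (J : Cn n → Cn n →L[ℝ] Cn n) : Prop :=
  ∀ v w : Cn n,
    (torsion J (.ofReal fun _ => v) (.ofReal fun _ => w)).re 0 = 0 ∧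
    (torsion J (.ofReal fun _ => v) (.ofReal fun _ => w)).im 0 = 0 ∧
    fderiv ℝ (torsion J (.ofReal fun _ => v) (.ofReal fun _ => w)).re 0 = 0 ∧
    fderiv ℝ (torsion J (.ofReal fun _ => v) (.ofReal fun _ => w)).im 0 = 0

end Hessian

/-! ### Almost complex manifolds and distributions on them -/

section Manifold

variable {n : ℕ} {X : Type*} [TopologicalSpace X] [ChartedSpace (Cn n) X]

/-- The expression in the coordinates `e` of a field of endomorphisms of the tangent bundle. -/
def endoInChart (J : ∀ x : X, TangentSpace 𝓘(ℝ, Cn n) x →L[ℝ] TangentSpace 𝓘(ℝ, Cn n) x)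
    (e : OpenPartialHomeomorph X (Cn n)) (z : Cn n) : Cn n →L[ℝ] Cn n :=
  (mfderiv 𝓘(ℝ, Cn n) 𝓘(ℝ, Cn n) e (e.symm z)).comp
    ((J (e.symm z)).comp (mfderiv 𝓘(ℝ, Cn n) 𝓘(ℝ, Cn n) e.symm z))

/-- The image of a chart. -/
def chartImage (e : OpenPartialHomeomorph X (Cn n)) : TopologicalSpace.Opens (Cn n) :=
  ⟨e.target, e.open_target⟩

variable (n X) in
/-- A smooth almost complex structure on the manifold `X` of real dimension `2n`. -/
structure AlmostComplexStructure where
  toFun : ∀ x : X, TangentSpace 𝓘(ℝ, Cn n) x →L[ℝ] TangentSpace 𝓘(ℝ, Cn n) x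
  sq : ∀ (x : X) (v : TangentSpace 𝓘(ℝ, Cn n) x), toFun x (toFun x v) = -v
  smooth : ∀ e ∈ IsManifold.maximalAtlas 𝓘(ℝ, Cn n) ∞ X,
    ContDiffOn ℝ ∞ (endoInChart toFun e) e.target

/-- The almost complex structure in the coordinates `e`. -/
def AlmostComplexStructure.inChart (J : AlmostComplexStructure n X)
    (e : OpenPartialHomeomorph X (Cn n)) : Cn n → Cn n →L[ℝ] Cn n :=
  endoInChart J.toFun e

variable (n X) in
/-- A real distribution on the manifold `X`: a distribution on the image of every smooth chart,
such that the distributions of two charts correspond under the change of coordinates `ψ`,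
i.e. `⟨u_e, |det dψ| (φ' ∘ ψ)⟩ = ⟨u_{e'}, φ'⟩` for test functions `φ'` supported in the overlap. -/
structure RealDistribution where
  inChart : ∀ e : OpenPartialHomeomorph X (Cn n), 𝓓'(chartImage e, ℝ)
  compatible : ∀ e ∈ IsManifold.maximalAtlas 𝓘(ℝ, Cn n) ∞ X,
    ∀ e' ∈ IsManifold.maximalAtlas 𝓘(ℝ, Cn n) ∞ X,
    ∀ (φ : 𝓓(chartImage e, ℝ)) (φ' : 𝓓(chartImage e', ℝ)),
      tsupport φ ⊆ (e.symm.trans e').source → tsupport φ' ⊆ (e'.symm.trans e).source →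
      (∀ z ∈ (e.symm.trans e').source,
        φ z = |(fderiv ℝ (e.symm.trans e') z).det| * φ' (e.symm.trans e' z)) →
      inChart e φ = inChart e' φ'

end Manifold

/-! ### The matrices of the structure and almost complex coordinates -/

section Coordinates

variable {n : ℕ}

/-- The matrix `A` of a real endomorphism
`∑ (A_{k,l} dz_l ⊗ ∂/∂z_k + B_{k,l} dz_l ⊗ ∂/∂z̄_k + B̄_{k,l} dz̄_l ⊗ ∂/∂z_k + Ā_{k,l} dz̄_l ⊗ ∂/∂z̄_k)`
of `ℂⁿ`. -/
def matA (T : Cn n →L[ℝ] Cn n) : Matrix (Fin n) (Fin n) ℂ := fun k l =>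
  (1 / 2 : ℂ) * (T (Pi.single l 1) k - Complex.I * T (Pi.single l Complex.I) k)

/-- The matrix `B` of a real endomorphism of `ℂⁿ`, see `matA`. -/
def matB (T : Cn n →L[ℝ] Cn n) : Matrix (Fin n) (Fin n) ℂ := fun k l =>
  starRingEnd ℂ ((1 / 2 : ℂ) * (T (Pi.single l 1) k + Complex.I * T (Pi.single l Complex.I) k))

/-- `T v = A v + B̄ v̄`, which is what `matA` and `matB` are meant to satisfy. -/
lemma apply_eq_matA_matB (T : Cn n →L[ℝ] Cn n) (v : Cn n) (k : Fin n) :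
    T v k = ∑ l, (matA T k l * v l + starRingEnd ℂ (matB T k l) * starRingEnd ℂ (v l)) := by
  have hv : v = ∑ l, ((v l).re • (Pi.single l 1 : Cn n) +
      (v l).im • (Pi.single l Complex.I : Cn n)) := by
    ext j
    simp only [Finset.sum_apply, Pi.add_apply, Pi.smul_apply, Pi.single_apply]
    simp [Finset.sum_add_distrib]
  conv_lhs => rw [hv]
  simp only [map_sum, map_add, map_smul, Finset.sum_apply, Pi.add_apply, Pi.smul_apply,
    Complex.real_smul]
  refine Finset.sum_congr rfl fun l _ => ?_
  obtain ⟨a, b⟩ := v l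
  simp only [matA, matB, Complex.conj_conj]
  rw [show (⟨a, b⟩ : ℂ) = (a : ℂ) + b * Complex.I from Complex.mk_eq_add_mul_I a b]
  simp only [map_add, map_mul, Complex.conj_ofReal, Complex.conj_I]
  linear_combination ((T (Pi.single l Complex.I) k) * b) * Complex.I_sq

/-- `∂f/∂z_r` for a complex function `f`. -/
def wirt (r : Fin n) (f : Cn n → ℂ) (z : Cn n) : ℂ :=
  (1 / 2 : ℂ) * (fderiv ℝ f z (Pi.single r 1) - Complex.I * fderiv ℝ f z (Pi.single r Complex.I))

/-- `∂f/∂z̄_r` for a complex function `f`. -/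
def wirtBar (r : Fin n) (f : Cn n → ℂ) (z : Cn n) : ℂ :=
  (1 / 2 : ℂ) * (fderiv ℝ f z (Pi.single r 1) + Complex.I * fderiv ℝ f z (Pi.single r Complex.I))

/-- The iterated derivative `∂/∂z_{r_1} … ∂/∂z_{r_p} ∂/∂z̄_{s_1} … ∂/∂z̄_{s_q} f`. -/
def iterWirt (rs ss : List (Fin n)) (f : Cn n → ℂ) : Cn n → ℂ :=
  rs.foldr wirt (ss.foldr wirtBar f)

/-- `e` is a system of almost complex coordinates of order `N` at `x`: smooth coordinates centred at
`x` in which `A(0) = i I` and, in the Taylor expansion of the entries `B_{k,l}` up to order `N`, the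
coefficient of `z_{r_1} ⋯ z_{r_p} z̄_{s_1} ⋯ z̄_{s_q}` vanishes if `r_1, …, r_p ≤ l`
(in particular if `p = 0`). -/
structure IsAlmostComplexCoordinates {X : Type*} [TopologicalSpace X] [ChartedSpace (Cn n) X]
    (J : AlmostComplexStructure n X) (x : X) (N : ℕ) (e : OpenPartialHomeomorph X (Cn n)) :
    Prop where
  mem_atlas : e ∈ IsManifold.maximalAtlas 𝓘(ℝ, Cn n) ∞ X
  mem_source : x ∈ e.source
  centred : e x = 0
  matA_zero : matA (J.inChart e 0) = Complex.I • (1 : Matrix (Fin n) (Fin n) ℂ)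
  taylor_matB : ∀ rs ss : List (Fin n), rs.length + ss.length ≤ N → ∀ k l : Fin n,
    (∀ r ∈ rs, r ≤ l) → iterWirt rs ss (fun z => matB (J.inChart e z) k l) 0 = 0

/-- `e` is a system of complex (holomorphic) coordinates centred at `x`: smooth coordinates in which
the almost complex structure is multiplication by `i`. -/
structure IsComplexCoordinates {X : Type*} [TopologicalSpace X] [ChartedSpace (Cn n) X]
    (J : AlmostComplexStructure n X) (x : X) (e : OpenPartialHomeomorph X (Cn n)) : Prop where
  mem_atlas : e ∈ IsManifold.maximalAtlas 𝓘(ℝ, Cn n) ∞ X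
  mem_source : x ∈ e.source
  centred : e x = 0
  standard : ∀ z ∈ e.target, ∀ v : Cn n, J.inChart e z v = Complex.I • v

end Coordinates

/-! ### The coefficients of the expansion

Here `B` is the matrix function `z ↦ B(z)` of the structure. -/

section Coefficients

variable {n : ℕ}

local notation "conj" => starRingEnd ℂ

/-- `B^r`, the coefficient of `z_r` in the Taylor expansion of `B`. -/
def B₁ (B : Cn n → Matrix (Fin n) (Fin n) ℂ) (r k l : Fin n) : ℂ :=
  iterWirt [r] [] (fun z => B z k l) 0

/-- `B^{r,s}`, the coefficient of `z_r z_s`. -/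
def B₂ (B : Cn n → Matrix (Fin n) (Fin n) ℂ) (r s k l : Fin n) : ℂ :=
  (1 / 2 : ℂ) * iterWirt [r, s] [] (fun z => B z k l) 0

/-- `B^{r,s̄}`, the coefficient of `z_r z̄_s`. -/
def B₁₁ (B : Cn n → Matrix (Fin n) (Fin n) ℂ) (r s k l : Fin n) : ℂ :=
  iterWirt [r] [s] (fun z => B z k l) 0

/-- `B^{r,s,t̄}`, the coefficient of `z_r z_s z̄_t`. -/
def B₂₁ (B : Cn n → Matrix (Fin n) (Fin n) ℂ) (r s t k l : Fin n) : ℂ :=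
  (1 / 2 : ℂ) * iterWirt [r, s] [t] (fun z => B z k l) 0

/-- `B^{r,s̄,t̄}`, the coefficient of `z_r z̄_s z̄_t`. -/
def B₁₂ (B : Cn n → Matrix (Fin n) (Fin n) ℂ) (r s t k l : Fin n) : ℂ :=
  (1 / 2 : ℂ) * iterWirt [r] [s, t] (fun z => B z k l) 0

/-- The second-order jet (Taylor polynomial of degree two) at the origin of a function. -/
def jet₂ (f : Cn n → ℂ) (z : Cn n) : ℂ :=
  f 0 + fderiv ℝ f 0 z + (1 / 2 : ℂ) * fderiv ℝ (fderiv ℝ f) 0 z z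

/-- `Q_{k,l̄}(z, ξ)`. -/
def Qmixed (B : Cn n → Matrix (Fin n) (Fin n) ℂ) (k l : Fin n) (z ξ : Cn n) : ℂ :=
  2 * Complex.I * ∑ t, jet₂ (fun w => B w l t) z * ξ k * ξ t +
    ∑ s, ∑ t, ∑ r, ∑ h, conj (B₁ B h k s) *
      (B₁ B r s t * ξ t * conj (ξ l) + B₁ B r l t * ξ t * conj (ξ s)) * z r * conj (z h)

/-- `Q_{k,l}(z, ξ)`. -/
def Qholo (B : Cn n → Matrix (Fin n) (Fin n) ℂ) (k l : Fin n) (z ξ : Cn n) : ℂ :=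
  Complex.I * ∑ t, (conj (jet₂ (fun w => B w k t) z) * ξ l * conj (ξ t) +
      conj (jet₂ (fun w => B w l t) z) * ξ k * conj (ξ t)) -
    ∑ s, ∑ t, ∑ r, ∑ h,
      ((1 / 2 : ℂ) * (conj (B₁ B h k s) * ξ l * ξ t + conj (B₁ B h l s) * ξ k * ξ t) *
          B₁ B r s t * z r * conj (z h) -
        conj (B₁ B r k s) * conj (B₁ B h l t) * conj (z r) * conj (z h) *
          conj (ξ s) * conj (ξ t))

/-- `R^{s,r,h}_{k,l}`. -/
def Rkl_rh (B : Cn n → Matrix (Fin n) (Fin n) ℂ) (k l s r h : Fin n) : ℂ :=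
  Complex.I / 8 * ∑ t, ∑ j, conj (B₁ B t s j) *
    (B₁ B r t k * B₁ B h j l + B₁ B h t k * B₁ B r j l +
      B₁ B r t l * B₁ B h j k + B₁ B h t l * B₁ B r j k)

/-- `R^{s,r,h̄}_{k,l}`. -/
def Rkl_rhbar (B : Cn n → Matrix (Fin n) (Fin n) ℂ) (k l s r h : Fin n) : ℂ :=
  -(1 / 2 : ℂ) * ∑ t, (conj (B₁₁ B h k s t) * B₁ B r t l + conj (B₁₁ B h l s t) * B₁ B r t k)

/-- `R^{s,r,h}_{k,l̄}`. -/
def Rklbar_rh (B : Cn n → Matrix (Fin n) (Fin n) ℂ) (k l s r h : Fin n) : ℂ :=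
  (1 / 2 : ℂ) * ∑ t, (B₁ B r t k * conj (B₁₁ B t h s l) + B₁ B h t k * conj (B₁₁ B t r s l) +
    2 * B₂ B r h t k * conj (B₁ B t s l))

/-- `R^{s,r,h̄}_{k,l̄}`. -/
def Rklbar_rhbar (B : Cn n → Matrix (Fin n) (Fin n) ℂ) (k l s r h : Fin n) : ℂ :=
  4 * Complex.I * conj (B₁₂ B h r k s l) +
    ∑ t, (2 * B₁ B r t k * conj (B₂ B t h s l) + B₁₁ B r h t k * conj (B₁ B t s l) +
      B₁₁ B r l t k * conj (B₁ B h s t))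

/-- `R^{s,r̄,h̄}_{k,l̄}`. -/
def Rklbar_rbarhbar (B : Cn n → Matrix (Fin n) (Fin n) ℂ) (k l s r h : Fin n) : ℂ :=
  2 * Complex.I * conj (B₂₁ B r h k s l) +
    Complex.I / 4 * ∑ t, ∑ j, (conj (B₁ B r t l) * conj (B₁ B h s j) +
      conj (B₁ B h t l) * conj (B₁ B r s j)) * (B₁ B t j k - B₁ B k j t)

/-- `R^{s,r,h̄}_{k̄,l̄}`. -/
def Rkbarlbar_rhbar (B : Cn n → Matrix (Fin n) (Fin n) ℂ) (k l s r h : Fin n) : ℂ :=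
  -(Complex.I / 4) * ∑ t, ∑ j, B₁ B r t j *
    (conj (B₁ B h j k) * conj (B₁ B t s l) + conj (B₁ B h j l) * conj (B₁ B t s k))

/-- `R^{s,r̄,h̄}_{k̄,l̄}`. -/
def Rkbarlbar_rbarhbar (B : Cn n → Matrix (Fin n) (Fin n) ℂ) (k l s r h : Fin n) : ℂ :=
  (1 / 4 : ℂ) * ∑ t, (conj (B₁ B r t k) * conj (B₁₁ B h t s l) +
    conj (B₁ B h t k) * conj (B₁₁ B r t s l) + conj (B₁ B r t l) * conj (B₁₁ B h t s k) +
    conj (B₁ B h t l) * conj (B₁₁ B r t s k))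

/-- `R^s_{k,l}(z)`. -/
def Rkl (B : Cn n → Matrix (Fin n) (Fin n) ℂ) (k l s : Fin n) (z : Cn n) : ℂ :=
  ∑ r, ∑ h, (Rkl_rh B k l s r h * z r * z h + Rkl_rhbar B k l s r h * z r * conj (z h))

/-- `R^s_{k,l̄}(z)`. -/
def Rklbar (B : Cn n → Matrix (Fin n) (Fin n) ℂ) (k l s : Fin n) (z : Cn n) : ℂ :=
  ∑ r, (∑ t, B₁ B r t k * conj (B₁ B t s l) * z r +
      2 * Complex.I * conj (B₁₁ B r k s l) * conj (z r)) +
    ∑ r, ∑ h, (Rklbar_rh B k l s r h * z r * z h + Rklbar_rhbar B k l s r h * z r * conj (z h) +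
      Rklbar_rbarhbar B k l s r h * conj (z r) * conj (z h))

/-- `R^s_{k̄,l̄}(z)`. -/
def Rkbarlbar (B : Cn n → Matrix (Fin n) (Fin n) ℂ) (k l s : Fin n) (z : Cn n) : ℂ :=
  ∑ r, ∑ h, (Rkbarlbar_rhbar B k l s r h * z r * conj (z h) +
    Rkbarlbar_rbarhbar B k l s r h * conj (z r) * conj (z h))

end Coefficients

/-! ### The parts of the expansion -/

section Expansion

variable {n : ℕ} {U : TopologicalSpace.Opens (Cn n)}

local notation "conj" => starRingEnd ℂ

/-- `2 ∑ ∂²u/∂z_k∂z̄_l ξ_k ξ̄_l`. -/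
def leviPart (u : 𝓓'(U, ℂ)) (ξ : Cn n → Cn n) : 𝓓'(U, ℂ) :=
  (2 : ℂ) • ∑ k, ∑ l, mulDist (fun z => ξ z k * conj (ξ z l)) (dz k (dzbar l u))

/-- `∑ Re [Q_{k,l̄}(z,ξ) ∂²u/∂z_k∂z̄_l + Q_{k,l}(z,ξ) ∂²u/∂z_k∂z_l]`. -/
def QPart (B : Cn n → Matrix (Fin n) (Fin n) ℂ) (u : 𝓓'(U, ℂ)) (ξ : Cn n → Cn n) : 𝓓'(U, ℂ) :=
  ∑ k, ∑ l, reDist (mulDist (fun z => Qmixed B k l z (ξ z)) (dz k (dzbar l u)) +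
    mulDist (fun z => Qholo B k l z (ξ z)) (dz k (dz l u)))

/-- `∑ Re [(R^s_{k,l}(z) ξ_k ξ_l + R^s_{k,l̄}(z) ξ_k ξ̄_l + R^s_{k̄,l̄}(z) ξ̄_k ξ̄_l) ∂u/∂z_s]`. -/
def RPart (B : Cn n → Matrix (Fin n) (Fin n) ℂ) (u : 𝓓'(U, ℂ)) (ξ : Cn n → Cn n) : 𝓓'(U, ℂ) :=
  ∑ k, ∑ l, ∑ s, reDist (mulDist (fun z => Rkl B k l s z * ξ z k * ξ z l +
    Rklbar B k l s z * ξ z k * conj (ξ z l) +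
    Rkbarlbar B k l s z * conj (ξ z k) * conj (ξ z l)) (dz s u))

/-- `∑ Im [(2 B̄^{h,r̄,k̄}_{s,l} z_r z̄_h + B̄^{r,h,k̄}_{s,l} z̄_r z̄_h) ∂u/∂z_s ξ_k ξ̄_l]`. -/
def reducedPart (B : Cn n → Matrix (Fin n) (Fin n) ℂ) (u : 𝓓'(U, ℂ)) (ξ : Cn n → Cn n) :
    𝓓'(U, ℂ) :=
  ∑ k, ∑ l, ∑ s, ∑ r, ∑ h, imDist (mulDist
    (fun z => (2 * conj (B₁₂ B h r k s l) * z r * conj (z h) +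
      conj (B₂₁ B r h k s l) * conj (z r) * conj (z h)) * ξ z k * conj (ξ z l)) (dz s u))

/-- `f` belongs on `U` to the cube of the ideal of the complex smooth functions vanishing at the
origin: it is a finite sum of products of three such functions. -/
def InMaximalIdealCube (U : TopologicalSpace.Opens (Cn n)) (f : Cn n → ℂ) : Prop :=
  ∃ (m : ℕ) (a : Fin m → Fin 3 → Cn n → ℂ),
    (∀ i j, ContDiffOn ℝ ∞ (a i j) U ∧ a i j 0 = 0) ∧ ∀ z ∈ U, f z = ∑ i, ∏ j, a i j z

/-- The variables `ξ_k` (index `inl k`) and `ξ̄_k` (index `inr k`). -/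
def xiVar (ξ : Cn n) : Fin n ⊕ Fin n → ℂ := Sum.elim ξ (fun k => conj (ξ k))

/-- The derivations `∂/∂z_k` (index `inl k`) and `∂/∂z̄_k` (index `inr k`). -/
def derivation : Fin n ⊕ Fin n → 𝓓'(U, ℂ) → 𝓓'(U, ℂ) := Sum.elim dz dzbar

/-- A homogeneous polynomial of degree two in the variables `ξ_k`, `ξ̄_k`, whose coefficients are
`∑ F ∂²u + ∑ G ∂u` with coefficient functions `F` and `G`. -/
def quadraticTerm (F : (a b c d : Fin n ⊕ Fin n) → Cn n → ℂ)
    (G : (a b c : Fin n ⊕ Fin n) → Cn n → ℂ) (u : 𝓓'(U, ℂ)) (ξ : Cn n → Cn n) : 𝓓'(U, ℂ) :=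
  ∑ a, ∑ b, mulDist (fun z => xiVar (ξ z) a * xiVar (ξ z) b)
    (∑ c, ∑ d, mulDist (F a b c d) (derivation c (derivation d u)) +
      ∑ c, mulDist (G a b c) (derivation c u))

end Expansion

end AlmostComplex

end

/-! Put η = Jξ. Because η^{1,0} = i ξ^{1,0} and η^{0,1} = -i ξ^{0,1}, the definition of the Hessian
collapses to ½(ξ.ξ.u + η.η.u + (J[ξ,η]).u), which is `hessian_eq_realDeriv`. In coordinates J² = -1
makes all derivatives of ξ cancel. What remains is a second order operator whose coefficients at z
are quadratic in the value ξ(z): ½(ξ_c ξ_d + η_c η_d) in front of D_c D_d, and the components of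
½((∂_η J)ξ - (∂_ξ J)η) in front of D_c (`hessian_eq_op2`). Distributions form a module over the
smooth functions with a Leibniz rule, so from here on only coefficient functions have to be
compared, and u plays no role beyond its reality.

The remainder must be a polynomial in ξ, ξ̄ with coefficients independent of ξ. Coefficients are
therefore compared modulo forms whose coefficients vanish to order three at 0 (`Ord`, `IsForm`,
`Eqv`), and three applications of Hadamard's lemma put those coefficients in the cube of the ideal
(`Ord.inMaximalIdealCube`).

The equation J² = -1 reads A² + B̄B = -1, whence A - i = (i/2)B̄B modulo order four, and B governs
everything. Absence of pure z̄ monomials in B makes B and ∂B/∂z̄ vanish at 0 and removes the z̄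
terms from their jets. Writing Jξ = iξ + ζ, with ζ the conjugate of Bξ plus (A - i)ξ, the second
order coefficients give Q (`eqv_Qholo`, `eqv_Qmixed`). In the first order coefficients each product
is truncated at order three (`firstOrderSum_eqv`), and the result is identified with the polynomial
in R by contracting indices (`firstOrderJet_eq`). Third derivatives of B enter only through the
conjugate of ∂B/∂z̄_k, multiplied by 2i ξ_k ξ̄_l.

For vanishing 1-jet of the torsion: if B vanishes to order p + 1, then up to a constant and
conjugation the Nijenhuis tensor on coordinate fields is ∂B_{sl}/∂z_r - ∂B_{sr}/∂z_l modulo order p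
+ 1. So the z-derivatives of B become symmetric in (r, l), and symmetry moves the largest index into
the column, where the normalisation forces zero. Used with p = 0 and then p = 1, this kills the
2-jet of B (`jets_eq_zero`). Then Q vanishes and R keeps only its third order jets. In complex
coordinates J is constant, so the first order field is zero and the second order coefficients are
those of the Levi form. -/

namespace AlmostComplex

local notation "conj" => starRingEnd ℂ

/-! ### Wirtinger derivatives of smooth functions -/

section Wirtinger

variable {n : ℕ} {U : TopologicalSpace.Opens (Cn n)} {f g : Cn n → ℂ}

/-- The Wirtinger derivatives `∂/∂z_k` (index `inl k`) and `∂/∂z̄_k` (index `inr k`). -/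
noncomputable def wd (c : Fin n ⊕ Fin n) (f : Cn n → ℂ) : Cn n → ℂ :=
  Sum.elim (fun k => wirt k f) (fun k => wirtBar k f) c

@[simp] lemma wd_inl (k : Fin n) : wd (.inl k) f = wirt k f := rfl

@[simp] lemma wd_inr (k : Fin n) : wd (.inr k) f = wirtBar k f := rfl

/-- The complex vector along which `wd c` differentiates has real part `½ wdRe c` and imaginary
part `½ wdIm c`. -/
def wdRe (c : Fin n ⊕ Fin n) : Cn n := Sum.elim (fun k => Pi.single k 1) (fun k => Pi.single k 1) c

/-- See `wdRe`. -/
def wdIm (c : Fin n ⊕ Fin n) : Cn n :=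
  Sum.elim (fun k => -Pi.single k Complex.I) (fun k => Pi.single k Complex.I) c

lemma wd_apply (c : Fin n ⊕ Fin n) (z : Cn n) :
    wd c f z = (1 / 2 : ℂ) * (fderiv ℝ f z (wdRe c) + Complex.I * fderiv ℝ f z (wdIm c)) := by
  cases c <;> simp [wd, wirt, wirtBar, wdRe, wdIm, sub_eq_add_neg]

lemma differentiableAt_of_mem (hf : ContDiffOn ℝ ∞ f U) {z : Cn n} (hz : z ∈ U) :
    DifferentiableAt ℝ f z :=
  ((hf.contDiffAt (U.isOpen.mem_nhds hz)).differentiableAt (by simp))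

lemma contDiffOn_fderiv_apply {F : Type*} [NormedAddCommGroup F] [NormedSpace ℝ F] {f : Cn n → F}
    (hf : ContDiffOn ℝ ∞ f U) (v : Cn n) :
    ContDiffOn ℝ ∞ (fun z => fderiv ℝ f z v) U :=
  (hf.fderiv_of_isOpen U.isOpen (by simp)).clm_apply contDiffOn_const

lemma contDiffOn_wd (hf : ContDiffOn ℝ ∞ f U) (c : Fin n ⊕ Fin n) : ContDiffOn ℝ ∞ (wd c f) U := by
  have : wd c f = fun z =>
      (1 / 2 : ℂ) * (fderiv ℝ f z (wdRe c) + Complex.I * fderiv ℝ f z (wdIm c)) := by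
    ext z; exact wd_apply c z
  rw [this]
  exact contDiffOn_const.mul ((contDiffOn_fderiv_apply hf _).add
    (contDiffOn_const.mul (contDiffOn_fderiv_apply hf _)))

lemma fderiv_congr_of_mem {F : Type*} [NormedAddCommGroup F] [NormedSpace ℝ F] {f g : Cn n → F}
    (h : ∀ z ∈ U, f z = g z) {z : Cn n} (hz : z ∈ U) : fderiv ℝ f z = fderiv ℝ g z :=
  Filter.EventuallyEq.fderiv_eq (by
    filter_upwards [U.isOpen.mem_nhds hz] with w hw using h w hw)

lemma wd_congr (h : ∀ z ∈ U, f z = g z) (c : Fin n ⊕ Fin n) : ∀ z ∈ U, wd c f z = wd c g z := by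
  intro z hz
  rw [wd_apply, wd_apply, fderiv_congr_of_mem h hz]

lemma wd_add (hf : ContDiffOn ℝ ∞ f U) (hg : ContDiffOn ℝ ∞ g U) (c : Fin n ⊕ Fin n) {z : Cn n}
    (hz : z ∈ U) : wd c (fun z => f z + g z) z = wd c f z + wd c g z := by
  simp only [wd_apply]
  rw [fderiv_fun_add (differentiableAt_of_mem hf hz) (differentiableAt_of_mem hg hz)]
  simp only [_root_.add_apply]; ring

lemma wd_mul (hf : ContDiffOn ℝ ∞ f U) (hg : ContDiffOn ℝ ∞ g U) (c : Fin n ⊕ Fin n) {z : Cn n}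
    (hz : z ∈ U) : wd c (fun z => f z * g z) z = wd c f z * g z + f z * wd c g z := by
  simp only [wd_apply]
  rw [fderiv_fun_mul (differentiableAt_of_mem hf hz) (differentiableAt_of_mem hg hz)]
  simp only [_root_.add_apply, _root_.smul_apply, smul_eq_mul]; ring

@[simp] lemma wd_const (a : ℂ) (c : Fin n ⊕ Fin n) : wd c (fun _ => a) = fun _ => 0 := by
  ext z; simp [wd_apply]

lemma wd_const_mul (a : ℂ) (hf : ContDiffOn ℝ ∞ f U) (c : Fin n ⊕ Fin n) {z : Cn n} (hz : z ∈ U) :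
    wd c (fun z => a * f z) z = a * wd c f z := by
  simp only [wd_apply]
  rw [fderiv_const_mul (differentiableAt_of_mem hf hz)]
  simp only [_root_.smul_apply, smul_eq_mul]; ring

lemma wd_neg (c : Fin n ⊕ Fin n) (z : Cn n) : wd c (fun z => -f z) z = -wd c f z := by
  simp only [wd_apply]
  rw [fderiv_fun_neg]
  simp only [_root_.neg_apply]; ring

lemma wd_conj (hf : ContDiffOn ℝ ∞ f U) (c : Fin n ⊕ Fin n) {z : Cn n} (hz : z ∈ U) :
    wd c (fun z => conj (f z)) z = conj (wd c.swap f z) := by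
  have hd := differentiableAt_of_mem hf hz
  have h : fderiv ℝ (fun z => conj (f z)) z = (Complex.conjCLE : ℂ →L[ℝ] ℂ).comp (fderiv ℝ f z) :=
    ((Complex.conjCLE : ℂ →L[ℝ] ℂ).hasFDerivAt.comp z hd.hasFDerivAt).fderiv
  rw [wd_apply, wd_apply, h]
  cases c <;> simp [wdRe, wdIm, Complex.ext_iff]

lemma contDiffOn_conj (hf : ContDiffOn ℝ ∞ f U) : ContDiffOn ℝ ∞ (fun z => conj (f z)) U :=
  (Complex.conjCLE : ℂ →L[ℝ] ℂ).contDiff.comp_contDiffOn hf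

lemma fderiv_fderiv_apply (hf : ContDiffOn ℝ ∞ f U) {z : Cn n} (hz : z ∈ U) (v w : Cn n) :
    fderiv ℝ (fun y => fderiv ℝ f y v) z w = fderiv ℝ (fderiv ℝ f) z w v := by
  have h1 : DifferentiableAt ℝ (fderiv ℝ f) z :=
    ((hf.fderiv_of_isOpen (m := ∞) U.isOpen (by simp)).contDiffAt
      (U.isOpen.mem_nhds hz)).differentiableAt (by simp)
  have := (h1.hasFDerivAt.clm_apply (hasFDerivAt_const v z)).fderiv
  rw [this]; simp

lemma fderiv_fderiv_symm (hf : ContDiffOn ℝ ∞ f U) {z : Cn n} (hz : z ∈ U) (v w : Cn n) :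
    fderiv ℝ (fderiv ℝ f) z w v = fderiv ℝ (fderiv ℝ f) z v w :=
  ((hf.contDiffAt (U.isOpen.mem_nhds hz)).isSymmSndFDerivAt
    (by simpa using WithTop.coe_le_coe.2 (le_top : (2 : ℕ∞) ≤ ⊤))).eq w v

lemma wd_wd (hf : ContDiffOn ℝ ∞ f U) (c d : Fin n ⊕ Fin n) {z : Cn n} (hz : z ∈ U) :
    wd c (wd d f) z = (1 / 4 : ℂ) *
      (fderiv ℝ (fderiv ℝ f) z (wdRe c) (wdRe d) +
        Complex.I * fderiv ℝ (fderiv ℝ f) z (wdRe c) (wdIm d) +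
        Complex.I * fderiv ℝ (fderiv ℝ f) z (wdIm c) (wdRe d) -
        fderiv ℝ (fderiv ℝ f) z (wdIm c) (wdIm d)) := by
  have : wd d f = fun z =>
      (1 / 2 : ℂ) * (fderiv ℝ f z (wdRe d) + Complex.I * fderiv ℝ f z (wdIm d)) := by
    ext z; exact wd_apply d z
  have h1 := contDiffOn_fderiv_apply hf (wdRe d)
  have h2 := contDiffOn_fderiv_apply hf (wdIm d)
  rw [this, wd_const_mul _ (h1.add (contDiffOn_const.mul h2)) c hz,
    wd_add h1 (contDiffOn_const.mul h2) c hz, wd_const_mul _ h2 c hz, wd_apply, wd_apply]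
  simp only [fderiv_fderiv_apply hf hz]
  linear_combination (1 / 4 : ℂ) * fderiv ℝ (fderiv ℝ f) z (wdIm c) (wdIm d) * Complex.I_sq

lemma wd_comm (hf : ContDiffOn ℝ ∞ f U) (c d : Fin n ⊕ Fin n) {z : Cn n} (hz : z ∈ U) :
    wd c (wd d f) z = wd d (wd c f) z := by
  rw [wd_wd hf c d hz, wd_wd hf d c hz]
  simp only [fderiv_fderiv_symm hf hz (wdRe c), fderiv_fderiv_symm hf hz (wdIm c)]
  ring

lemma eq_sum_single (v : Cn n) : v = ∑ l, ((v l).re • (Pi.single l 1 : Cn n) +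
    (v l).im • (Pi.single l Complex.I : Cn n)) := by
  ext j
  simp only [Finset.sum_apply, Pi.add_apply, Pi.smul_apply, Pi.single_apply]
  simp [Finset.sum_add_distrib]

/-- A real linear form on `ℂⁿ` in terms of its complex coefficients. -/
lemma clm_eq_sum (T : Cn n →L[ℝ] ℂ) (v : Cn n) :
    T v = ∑ c, xiVar v c * ((1 / 2 : ℂ) * (T (wdRe c) + Complex.I * T (wdIm c))) := by
  conv_lhs => rw [eq_sum_single v]
  rw [Fintype.sum_sum_type, ← Finset.sum_add_distrib, map_sum]
  refine Finset.sum_congr rfl fun l _ => ?_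
  simp only [map_add, map_smul, Complex.real_smul, xiVar, Sum.elim_inl, Sum.elim_inr, wdRe, wdIm,
    map_neg]
  obtain ⟨a, b⟩ := v l
  rw [show (⟨a, b⟩ : ℂ) = (a : ℂ) + b * Complex.I from Complex.mk_eq_add_mul_I a b]
  simp only [map_add, map_mul, Complex.conj_ofReal, Complex.conj_I, Complex.add_re,
    Complex.add_im, Complex.ofReal_re, Complex.ofReal_im, Complex.mul_re, Complex.mul_im,
    Complex.I_re, Complex.I_im, mul_zero, mul_one, sub_zero, add_zero, zero_add]
  linear_combination (T (Pi.single l Complex.I) * b) * Complex.I_sq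

lemma fderiv_eq_sum_wd (z v : Cn n) : fderiv ℝ f z v = ∑ c, xiVar v c * wd c f z := by
  rw [clm_eq_sum]
  exact Finset.sum_congr rfl fun c _ => by rw [wd_apply]

/-- Bridge between `jet₂`, defined through Fréchet derivatives, and the Taylor coefficients of B,
defined through Wirtinger derivatives. -/
lemma fderiv_fderiv_eq_sum (hf : ContDiffOn ℝ ∞ f U) {z : Cn n} (hz : z ∈ U) (v w : Cn n) :
    fderiv ℝ (fderiv ℝ f) z v w = ∑ c, ∑ d, xiVar v c * xiVar w d * wd c (wd d f) z := by
  rw [← fderiv_fderiv_apply hf hz]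
  have h : ∀ y ∈ U, fderiv ℝ f y w = ∑ d, xiVar w d * wd d f y := fun y _ => fderiv_eq_sum_wd y w
  rw [fderiv_eq_sum_wd]
  refine Finset.sum_congr rfl fun c _ => ?_
  rw [wd_congr h c z hz]
  have : ∀ s : Finset (Fin n ⊕ Fin n), wd c (fun y => ∑ d ∈ s, xiVar w d * wd d f y) z =
      ∑ d ∈ s, xiVar w d * wd c (wd d f) z := by
    intro s
    induction s using Finset.induction_on with
    | empty => simp
    | insert a s ha ih =>
      simp only [Finset.sum_insert ha]
      rw [wd_add (contDiffOn_const.mul (contDiffOn_wd hf a))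
        (ContDiffOn.sum fun d _ => contDiffOn_const.mul (contDiffOn_wd hf d)) c hz, ih,
        wd_const_mul _ (contDiffOn_wd hf a) c hz]
  rw [this, Finset.mul_sum]
  exact Finset.sum_congr rfl fun d _ => by ring

lemma xiVar_swap (v : Cn n) (c : Fin n ⊕ Fin n) : xiVar v c.swap = conj (xiVar v c) := by
  cases c <;> simp [xiVar]

/-- The complex component with index `c` as a continuous linear map. -/
noncomputable def xiVarCLM (c : Fin n ⊕ Fin n) : Cn n →L[ℝ] ℂ :=
  Sum.elim (fun k => ContinuousLinearMap.proj (R := ℝ) (φ := fun _ : Fin n => ℂ) k)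
    (fun k => (Complex.conjCLE : ℂ →L[ℝ] ℂ).comp
      (ContinuousLinearMap.proj (R := ℝ) (φ := fun _ : Fin n => ℂ) k)) c

lemma xiVarCLM_apply (c : Fin n ⊕ Fin n) (v : Cn n) : xiVarCLM c v = xiVar v c := by
  cases c <;> simp [xiVarCLM, xiVar]

lemma contDiffOn_xiVar {ξ : Cn n → Cn n} (hξ : ContDiffOn ℝ ∞ ξ U) (c : Fin n ⊕ Fin n) :
    ContDiffOn ℝ ∞ (fun z => xiVar (ξ z) c) U := by
  simp only [← xiVarCLM_apply]
  exact (xiVarCLM c).contDiff.comp_contDiffOn hξ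

lemma fderiv_xiVar {ξ : Cn n → Cn n} (hξ : ContDiffOn ℝ ∞ ξ U) (c : Fin n ⊕ Fin n) {z : Cn n}
    (hz : z ∈ U) (v : Cn n) :
    fderiv ℝ (fun z => xiVar (ξ z) c) z v = xiVar (fderiv ℝ ξ z v) c := by
  have hd : DifferentiableAt ℝ ξ z :=
    (hξ.contDiffAt (U.isOpen.mem_nhds hz)).differentiableAt (by simp)
  simp only [← xiVarCLM_apply]
  exact congrArg (fun T => T v) ((xiVarCLM c).hasFDerivAt.comp z hd.hasFDerivAt).fderiv

lemma wd_coord (c d : Fin n ⊕ Fin n) (z : Cn n) :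
    wd c (fun z => xiVar z d) z = if c = d then 1 else 0 := by
  have h : fderiv ℝ (fun z => xiVar z d) z = xiVarCLM d := by
    simp only [← xiVarCLM_apply]
    exact (xiVarCLM d).fderiv
  rw [wd_apply, h, xiVarCLM_apply, xiVarCLM_apply]
  rcases c with c | c <;> rcases d with d | d <;>
    simp only [xiVar, wdRe, wdIm, Sum.elim_inl, Sum.elim_inr, Pi.single_apply, Pi.neg_apply,
      Sum.inl.injEq, Sum.inr.injEq, reduceCtorEq, if_false, eq_comm (a := d)] <;>
    split_ifs <;> simp <;> norm_num

end Wirtinger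

/-! ### The module structure of distributions over the smooth functions -/

section Module

variable {n : ℕ} {U : TopologicalSpace.Opens (Cn n)} {f g : Cn n → ℂ} {S T : 𝓓'(U, ℂ)}

/-- Test functions are supported in U, so values of the factor outside U never matter. This lets
identities known only on U be used under `mulDist`. -/
lemma mulDist_congr (hf : ContDiffOn ℝ ∞ f U) (h : ∀ z ∈ U, f z = g z) (T : 𝓓'(U, ℂ)) :
    mulDist f T = mulDist g T := by
  have hg : ContDiffOn ℝ ∞ g U := hf.congr fun z hz => (h z hz).symm
  ext φ
  rw [mulDist_apply hf, mulDist_apply hg]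
  have key : ∀ z, z ∈ U ∨ φ z = 0 := fun z => by
    by_cases hz : z ∈ tsupport φ
    · exact .inl (φ.tsupport_subset hz)
    · exact .inr (image_eq_zero_of_notMem_tsupport hz)
  have h1 : mulTestCLM (contDiffOn_re hf) φ = mulTestCLM (contDiffOn_re hg) φ := by
    ext z; rcases key z with hz | hz <;> simp [hz, h]
  have h2 : mulTestCLM (contDiffOn_im hf) φ = mulTestCLM (contDiffOn_im hg) φ := by
    ext z; rcases key z with hz | hz <;> simp [hz, h]
  rw [h1, h2]

lemma mulDist_add (hf : ContDiffOn ℝ ∞ f U) (S T : 𝓓'(U, ℂ)) :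
    mulDist f (S + T) = mulDist f S + mulDist f T := by
  ext φ
  simp only [mulDist_apply hf, _root_.add_apply]
  ring

lemma mulDist_smul (hf : ContDiffOn ℝ ∞ f U) (a : ℂ) (T : 𝓓'(U, ℂ)) :
    mulDist f (a • T) = a • mulDist f T := by
  ext φ
  simp only [mulDist_apply hf, _root_.smul_apply, smul_eq_mul]
  ring

lemma mulDist_neg (hf : ContDiffOn ℝ ∞ f U) (T : 𝓓'(U, ℂ)) :
    mulDist f (-T) = -mulDist f T := by
  ext φ
  simp only [mulDist_apply hf, _root_.neg_apply]
  ring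

/-- No smoothness is needed: for a non-smooth factor the product is 0 by convention. -/
lemma mulDist_zero (f : Cn n → ℂ) : mulDist f (0 : 𝓓'(U, ℂ)) = 0 := by
  by_cases hf : ContDiffOn ℝ ∞ f U
  · ext φ; simp [mulDist_apply hf]
  · simp [mulDist, hf]

lemma mulDist_sum {ι : Type*} (hf : ContDiffOn ℝ ∞ f U) (s : Finset ι) (T : ι → 𝓓'(U, ℂ)) :
    mulDist f (∑ i ∈ s, T i) = ∑ i ∈ s, mulDist f (T i) := by
  classical
  induction s using Finset.induction_on with
  | empty => simp [mulDist_zero]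
  | insert a s ha ih => rw [Finset.sum_insert ha, Finset.sum_insert ha, mulDist_add hf, ih]

lemma add_mulDist (hf : ContDiffOn ℝ ∞ f U) (hg : ContDiffOn ℝ ∞ g U) (T : 𝓓'(U, ℂ)) :
    mulDist (fun z => f z + g z) T = mulDist f T + mulDist g T := by
  ext φ
  have h1 : mulTestCLM (contDiffOn_re (hf.add hg)) φ =
      mulTestCLM (contDiffOn_re hf) φ + mulTestCLM (contDiffOn_re hg) φ := by
    ext z; simp [mul_add]
  have h2 : mulTestCLM (contDiffOn_im (hf.add hg)) φ =
      mulTestCLM (contDiffOn_im hf) φ + mulTestCLM (contDiffOn_im hg) φ := by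
    ext z; simp [mul_add]
  simp only [_root_.add_apply, mulDist_apply hf, mulDist_apply hg]
  rw [mulDist_apply (hf.add hg), h1, h2, map_add, map_add]
  ring

lemma const_mulDist (a : ℂ) (T : 𝓓'(U, ℂ)) : mulDist (fun _ => a) T = a • T := by
  ext φ
  rw [mulDist_apply contDiffOn_const]
  have h1 : mulTestCLM (contDiffOn_re (Ω := U) (f := fun _ => a) contDiffOn_const) φ = a.re • φ := by
    ext z; simp [mul_comm]
  have h2 : mulTestCLM (contDiffOn_im (Ω := U) (f := fun _ => a) contDiffOn_const) φ = a.im • φ := by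
    ext z; simp [mul_comm]
  rw [h1, h2, map_smul, map_smul, _root_.smul_apply]
  simp only [Complex.real_smul, smul_eq_mul]
  conv_rhs => rw [← Complex.re_add_im a]
  ring

lemma zero_mulDist (T : 𝓓'(U, ℂ)) : mulDist (fun _ => 0) T = 0 := by
  rw [const_mulDist]; exact zero_smul ℂ T

lemma sum_mulDist {ι : Type*} (s : Finset ι) {f : ι → Cn n → ℂ}
    (hf : ∀ i ∈ s, ContDiffOn ℝ ∞ (f i) U) (T : 𝓓'(U, ℂ)) :
    mulDist (fun z => ∑ i ∈ s, f i z) T = ∑ i ∈ s, mulDist (f i) T := by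
  classical
  induction s using Finset.induction_on with
  | empty => simp [zero_mulDist]
  | insert a s ha ih =>
    simp only [Finset.sum_insert ha]
    rw [add_mulDist (hf a (by simp)) (ContDiffOn.sum fun i hi => hf i (by simp [hi])),
      ih fun i hi => hf i (by simp [hi])]

lemma mul_mulDist (hf : ContDiffOn ℝ ∞ f U) (hg : ContDiffOn ℝ ∞ g U) (T : 𝓓'(U, ℂ)) :
    mulDist (fun z => f z * g z) T = mulDist f (mulDist g T) := by
  ext φ
  have h1 : mulTestCLM (contDiffOn_re (hf.mul hg)) φ =
      mulTestCLM (contDiffOn_re hg) (mulTestCLM (contDiffOn_re hf) φ) -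
        mulTestCLM (contDiffOn_im hg) (mulTestCLM (contDiffOn_im hf) φ) := by
    ext z; simp; ring
  have h2 : mulTestCLM (contDiffOn_im (hf.mul hg)) φ =
      mulTestCLM (contDiffOn_im hg) (mulTestCLM (contDiffOn_re hf) φ) +
        mulTestCLM (contDiffOn_re hg) (mulTestCLM (contDiffOn_im hf) φ) := by
    ext z; simp; ring
  rw [mulDist_apply (hf.mul hg), h1, h2, mulDist_apply hf, mulDist_apply hg, mulDist_apply hg,
    map_sub, map_add]
  linear_combination
    T (mulTestCLM (contDiffOn_im hg) (mulTestCLM (contDiffOn_im hf) φ)) * -Complex.I_sq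

lemma const_mul_mulDist (a : ℂ) (hf : ContDiffOn ℝ ∞ f U) (T : 𝓓'(U, ℂ)) :
    mulDist (fun z => a * f z) T = a • mulDist f T := by
  rw [mul_mulDist contDiffOn_const hf, const_mulDist]

lemma lineDeriv_apply (v : Cn n) (T : 𝓓'(U, ℂ)) (φ : 𝓓(U, ℝ)) :
    (∂_{v} T) φ = -T (∂_{v} φ) := by
  rw [Distribution.lineDerivOp_apply_apply, map_neg]

lemma lineDeriv_test_apply (v : Cn n) (φ : 𝓓(U, ℝ)) (z : Cn n) :
    (∂_{v} φ) z = fderiv ℝ φ z v := by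
  rw [TestFunction.lineDerivOp_eq_lineDerivCLM (𝕜 := ℝ),
    TestFunction.lineDerivCLM_apply_of_le (by simp)]
  exact (φ.contDiff.differentiable (by simp) z).lineDeriv_eq_fderiv

lemma lineDeriv_mulTest {g : Cn n → ℝ} (hg : ContDiffOn ℝ ∞ g U)
    (hg' : ∀ v, ContDiffOn ℝ ∞ (fun z => fderiv ℝ g z v) U) (v : Cn n) (φ : 𝓓(U, ℝ)) :
    ∂_{v} (mulTestCLM hg φ) = mulTestCLM hg (∂_{v} φ) + mulTestCLM (hg' v) φ := by
  ext z
  rw [_root_.add_apply, mulTestCLM_apply, mulTestCLM_apply, lineDeriv_test_apply,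
    lineDeriv_test_apply]
  by_cases hz : z ∈ tsupport φ
  · have hd : DifferentiableAt ℝ g z := (hg.contDiffAt (U.isOpen.mem_nhds
      (φ.tsupport_subset hz))).differentiableAt (by simp)
    have := (φ.contDiff.differentiable (by simp) z).hasFDerivAt.mul hd.hasFDerivAt
    change fderiv ℝ (fun z => φ z * g z) z v = _
    erw [this.fderiv]
    simp; ring
  -- Off the support of φ the function g may fail to be differentiable, but everything vanishes near
  -- z.
  · have h0 : φ =ᶠ[nhds z] fun _ => 0 := by
      filter_upwards [(isClosed_tsupport φ).isOpen_compl.mem_nhds hz] with w hw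
      exact image_eq_zero_of_notMem_tsupport hw
    have h1 : (mulTestCLM hg φ : Cn n → ℝ) =ᶠ[nhds z] fun _ => 0 := by
      filter_upwards [h0] with w hw
      simp [hw]
    rw [h0.fderiv_eq, h1.fderiv_eq, h0.self_of_nhds]
    simp

/-- Dual to the product rule for test functions; the minus sign in the distributional derivative
moves the term with the derivative of f to the other side. -/
lemma lineDeriv_mulDist (hf : ContDiffOn ℝ ∞ f U) (v : Cn n) (T : 𝓓'(U, ℂ)) :
    ∂_{v} (mulDist f T) = mulDist (fun z => fderiv ℝ f z v) T + mulDist f (∂_{v} T) := by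
  ext φ
  have hre : ∀ v : Cn n, ∀ z ∈ U, fderiv ℝ (fun z => (f z).re) z v = (fderiv ℝ f z v).re :=
    fun v z hz => congrArg (fun L => L v)
      (Complex.reCLM.hasFDerivAt.comp z (differentiableAt_of_mem hf hz).hasFDerivAt).fderiv
  have him : ∀ v : Cn n, ∀ z ∈ U, fderiv ℝ (fun z => (f z).im) z v = (fderiv ℝ f z v).im :=
    fun v z hz => congrArg (fun L => L v)
      (Complex.imCLM.hasFDerivAt.comp z (differentiableAt_of_mem hf hz).hasFDerivAt).fderiv
  have key : ∀ z, z ∈ U ∨ φ z = 0 := fun z => by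
    by_cases hz : z ∈ tsupport φ
    · exact .inl (φ.tsupport_subset hz)
    · exact .inr (image_eq_zero_of_notMem_tsupport hz)
  have hd := contDiffOn_fderiv_apply hf v
  have h1 : mulTestCLM (contDiffOn_fderiv_apply (contDiffOn_re hf) v) φ =
      mulTestCLM (contDiffOn_re hd) φ := by
    ext z; rcases key z with hz | hz <;> simp [hz, hre]
  have h2 : mulTestCLM (contDiffOn_fderiv_apply (contDiffOn_im hf) v) φ =
      mulTestCLM (contDiffOn_im hd) φ := by
    ext z; rcases key z with hz | hz <;> simp [hz, him]
  rw [lineDeriv_apply, _root_.add_apply, mulDist_apply hf, mulDist_apply hd, mulDist_apply hf,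
    lineDeriv_apply, lineDeriv_apply, lineDeriv_mulTest _ (contDiffOn_fderiv_apply
    (contDiffOn_re hf)), lineDeriv_mulTest _ (contDiffOn_fderiv_apply (contDiffOn_im hf)), h1, h2,
    map_add, map_add]
  ring

lemma lineDeriv_comm (v w : Cn n) (T : 𝓓'(U, ℂ)) : ∂_{v} (∂_{w} T) = ∂_{w} (∂_{v} T) := by
  ext φ
  simp only [lineDeriv_apply, neg_neg]
  congr 1
  ext z
  rw [lineDeriv_test_apply, lineDeriv_test_apply]
  have h : ∀ v : Cn n, ((∂_{v} φ : 𝓓(U, ℝ)) : Cn n → ℝ) = fun z => fderiv ℝ φ z v :=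
    fun v => funext fun z => lineDeriv_test_apply v φ z
  have hd : DifferentiableAt ℝ (fderiv ℝ φ) z :=
    (φ.contDiff.fderiv_right (m := ∞) (by simp)).contDiffAt.differentiableAt (by simp)
  have h' : ∀ v w : Cn n, fderiv ℝ (fun z => fderiv ℝ φ z v) z w = fderiv ℝ (fderiv ℝ φ) z w v := by
    intro v w
    rw [(hd.hasFDerivAt.clm_apply (hasFDerivAt_const v z)).fderiv]; simp
  rw [h, h, h', h']
  exact ((φ.contDiff.contDiffAt (x := z)).isSymmSndFDerivAt
    (by simpa using WithTop.coe_le_coe.2 (le_top : (2 : ℕ∞) ≤ ⊤))).eq _ _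

lemma lineDeriv_smul_complex (v : Cn n) (a : ℂ) (T : 𝓓'(U, ℂ)) : ∂_{v} (a • T) = a • ∂_{v} T := by
  ext φ
  simp

lemma derivation_eq (c : Fin n ⊕ Fin n) (T : 𝓓'(U, ℂ)) :
    derivation c T = (1 / 2 : ℂ) • (∂_{wdRe c} T + Complex.I • ∂_{wdIm c} T) := by
  cases c <;>
    simp [derivation, dz, dzbar, dx, dy, wdRe, wdIm, LineDeriv.lineDerivOp_left_neg, sub_eq_add_neg]

/-- With this Leibniz rule, compositions of vector fields acting on a distribution are computed on
coefficients alone. -/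
lemma derivation_mulDist (hf : ContDiffOn ℝ ∞ f U) (c : Fin n ⊕ Fin n) (T : 𝓓'(U, ℂ)) :
    derivation c (mulDist f T) = mulDist (wd c f) T + mulDist f (derivation c T) := by
  have h1 := contDiffOn_fderiv_apply hf (wdRe c)
  have h2 := contDiffOn_fderiv_apply hf (wdIm c)
  have hw : wd c f = fun z =>
      (1 / 2 : ℂ) * (fderiv ℝ f z (wdRe c) + Complex.I * fderiv ℝ f z (wdIm c)) := by
    ext z; exact wd_apply c z
  rw [derivation_eq, derivation_eq, lineDeriv_mulDist hf, lineDeriv_mulDist hf, hw,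
    const_mul_mulDist _ (h1.add (contDiffOn_const.mul h2)),
    add_mulDist h1 (contDiffOn_const.mul h2), const_mul_mulDist _ h2, mulDist_smul hf,
    mulDist_add hf, mulDist_smul hf]
  module

lemma derivation_comm (c d : Fin n ⊕ Fin n) (T : 𝓓'(U, ℂ)) :
    derivation c (derivation d T) = derivation d (derivation c T) := by
  simp only [derivation_eq, LineDeriv.lineDerivOp_add, lineDeriv_smul_complex]
  rw [lineDeriv_comm (wdRe d) (wdRe c), lineDeriv_comm (wdIm d) (wdRe c),
    lineDeriv_comm (wdRe d) (wdIm c), lineDeriv_comm (wdIm d) (wdIm c)]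
  module

lemma derivation_add (c : Fin n ⊕ Fin n) (S T : 𝓓'(U, ℂ)) :
    derivation c (S + T) = derivation c S + derivation c T := by
  simp only [derivation_eq, LineDeriv.lineDerivOp_add]; module

lemma derivation_smul (c : Fin n ⊕ Fin n) (a : ℂ) (T : 𝓓'(U, ℂ)) :
    derivation c (a • T) = a • derivation c T := by
  simp only [derivation_eq, lineDeriv_smul_complex]; module

lemma derivation_sum {ι : Type*} (c : Fin n ⊕ Fin n) (s : Finset ι) (T : ι → 𝓓'(U, ℂ)) :
    derivation c (∑ i ∈ s, T i) = ∑ i ∈ s, derivation c (T i) := by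
  classical
  induction s using Finset.induction_on with
  | empty => ext φ; simp [derivation_eq, LineDeriv.lineDerivOp_zero]
  | insert a s ha ih => rw [Finset.sum_insert ha, Finset.sum_insert ha, derivation_add, ih]

/-! ### Complex conjugation -/

lemma conjDist_apply (T : 𝓓'(U, ℂ)) (φ : 𝓓(U, ℝ)) : conjDist T φ = conj (T φ) := rfl

lemma conjDist_add (S T : 𝓓'(U, ℂ)) : conjDist (S + T) = conjDist S + conjDist T := map_add _ _ _

lemma conjDist_sum {ι : Type*} (s : Finset ι) (T : ι → 𝓓'(U, ℂ)) :
    conjDist (∑ i ∈ s, T i) = ∑ i ∈ s, conjDist (T i) := map_sum _ _ _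

lemma conjDist_smul (a : ℂ) (T : 𝓓'(U, ℂ)) : conjDist (a • T) = conj a • conjDist T := by
  ext φ
  simp [conjDist_apply]

lemma conjDist_mulDist (hf : ContDiffOn ℝ ∞ f U) (T : 𝓓'(U, ℂ)) :
    conjDist (mulDist f T) = mulDist (fun z => conj (f z)) (conjDist T) := by
  ext φ
  have hc := contDiffOn_conj hf
  have h1 : mulTestCLM (contDiffOn_re hc) φ = mulTestCLM (contDiffOn_re hf) φ := by ext z; simp
  have h2 : mulTestCLM (contDiffOn_im hc) φ = -mulTestCLM (contDiffOn_im hf) φ := by ext z; simp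
  rw [conjDist_apply, mulDist_apply hf, mulDist_apply hc, h1, h2]
  simp [conjDist_apply]

lemma conjDist_lineDeriv (v : Cn n) (T : 𝓓'(U, ℂ)) : conjDist (∂_{v} T) = ∂_{v} (conjDist T) := by
  ext φ
  simp [conjDist_apply]

lemma wdRe_swap (c : Fin n ⊕ Fin n) : wdRe c.swap = wdRe c := by cases c <;> rfl

lemma wdIm_swap (c : Fin n ⊕ Fin n) : wdIm c.swap = -wdIm c := by cases c <;> simp [wdIm]

lemma conjDist_derivation (c : Fin n ⊕ Fin n) (T : 𝓓'(U, ℂ)) :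
    conjDist (derivation c T) = derivation c.swap (conjDist T) := by
  simp only [derivation_eq, wdRe_swap, wdIm_swap, LineDeriv.lineDerivOp_left_neg, conjDist_smul,
    conjDist_add, conjDist_lineDeriv, map_div₀, map_one, map_ofNat, Complex.conj_I]
  module

lemma reDist_eq (T : 𝓓'(U, ℂ)) : reDist T = (1 / 2 : ℂ) • (T + conjDist T) := by
  ext φ
  change ((T φ).re : ℂ) = (1 / 2 : ℂ) • (T φ + conj (T φ))
  rw [Complex.add_conj]; simp

lemma imDist_eq (T : 𝓓'(U, ℂ)) : imDist T = (-Complex.I / 2 : ℂ) • (T - conjDist T) := by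
  ext φ
  change ((T φ).im : ℂ) = (-Complex.I / 2 : ℂ) • (T φ - conj (T φ))
  rw [Complex.sub_conj, smul_eq_mul]
  push_cast
  linear_combination ((T φ).im : ℂ) * Complex.I_sq

lemma conjDist_restrictComplex {V : TopologicalSpace.Opens (Cn n)} (hU : U ≤ V) (u : 𝓓'(V, ℝ)) :
    conjDist (restrictComplex hU u) = restrictComplex hU u := by
  ext φ
  exact Complex.conj_ofReal _

end Module

/-! ### Second order operators and the coordinate expression of the Hessian -/

section SecondOrder

variable {n : ℕ} {U : TopologicalSpace.Opens (Cn n)}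

/-- The differential operator `∑ f_{c,d} D_c D_d + ∑ g_c D_c`. -/
noncomputable def op2 (f : (c d : Fin n ⊕ Fin n) → Cn n → ℂ) (g : (c : Fin n ⊕ Fin n) → Cn n → ℂ)
    (u : 𝓓'(U, ℂ)) : 𝓓'(U, ℂ) :=
  ∑ c, ∑ d, mulDist (f c d) (derivation c (derivation d u)) + ∑ c, mulDist (g c) (derivation c u)

variable {f f' : (c d : Fin n ⊕ Fin n) → Cn n → ℂ} {g g' : (c : Fin n ⊕ Fin n) → Cn n → ℂ}

lemma op2_add (hf : ∀ c d, ContDiffOn ℝ ∞ (f c d) U) (hf' : ∀ c d, ContDiffOn ℝ ∞ (f' c d) U)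
    (hg : ∀ c, ContDiffOn ℝ ∞ (g c) U) (hg' : ∀ c, ContDiffOn ℝ ∞ (g' c) U) (u : 𝓓'(U, ℂ)) :
    op2 f g u + op2 f' g' u =
      op2 (fun c d z => f c d z + f' c d z) (fun c z => g c z + g' c z) u := by
  simp only [op2, add_mulDist (hf _ _) (hf' _ _), add_mulDist (hg _) (hg' _),
    Finset.sum_add_distrib]
  abel

lemma op2_smul (hf : ∀ c d, ContDiffOn ℝ ∞ (f c d) U) (hg : ∀ c, ContDiffOn ℝ ∞ (g c) U) (a : ℂ)
    (u : 𝓓'(U, ℂ)) :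
    a • op2 f g u = op2 (fun c d z => a * f c d z) (fun c z => a * g c z) u := by
  simp only [op2, const_mul_mulDist _ (hf _ _), const_mul_mulDist _ (hg _), smul_add,
    Finset.smul_sum]

/-- Since D_c D_d = D_d D_c, an operator depends only on the symmetrized second order coefficients.
The proof doubles the second order sum, exchanges the indices in one copy, and halves again. -/
lemma op2_congr (hf : ∀ c d, ContDiffOn ℝ ∞ (f c d) U) (hf' : ∀ c d, ContDiffOn ℝ ∞ (f' c d) U)
    (hg : ∀ c, ContDiffOn ℝ ∞ (g c) U)
    (h : ∀ c d, ∀ z ∈ U, f c d z + f d c z = f' c d z + f' d c z)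
    (h' : ∀ c, ∀ z ∈ U, g c z = g' c z) (u : 𝓓'(U, ℂ)) : op2 f g u = op2 f' g' u := by
  have key : ∀ f : (c d : Fin n ⊕ Fin n) → Cn n → ℂ, (∀ c d, ContDiffOn ℝ ∞ (f c d) U) →
      (2 : ℂ) • ∑ c, ∑ d, mulDist (f c d) (derivation c (derivation d u)) =
      ∑ c, ∑ d, mulDist (fun z => f c d z + f d c z) (derivation c (derivation d u)) := by
    intro f hf
    simp only [add_mulDist (hf _ _) (hf _ _), Finset.sum_add_distrib]
    rw [show ∀ T : 𝓓'(U, ℂ), (2 : ℂ) • T = T + T from fun T => by module]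
    congr 1
    rw [Finset.sum_comm]
    exact Finset.sum_congr rfl fun c _ => Finset.sum_congr rfl fun d _ => by
      rw [derivation_comm]
  have h2 : (2 : ℂ) • ∑ c, ∑ d, mulDist (f c d) (derivation c (derivation d u)) =
      (2 : ℂ) • ∑ c, ∑ d, mulDist (f' c d) (derivation c (derivation d u)) := by
    rw [key f hf, key f' hf']
    exact Finset.sum_congr rfl fun c _ => Finset.sum_congr rfl fun d _ =>
      mulDist_congr ((hf c d).add (hf d c)) (h c d) _
  rw [op2, op2]
  congr 1
  · have := congrArg (fun T => (1 / 2 : ℂ) • T) h2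
    simpa only [smul_smul, show (1 / 2 : ℂ) * 2 = 1 by norm_num, one_smul] using this
  · exact Finset.sum_congr rfl fun c _ => mulDist_congr (hg c) (h' c) _

/-- Conjugation exchanges ∂/∂z_k and ∂/∂z̄_k. An operator whose coefficients are invariant under
conjugation combined with the swap of indices therefore preserves real distributions. -/
lemma conjDist_op2 (hf : ∀ c d, ContDiffOn ℝ ∞ (f c d) U) (hg : ∀ c, ContDiffOn ℝ ∞ (g c) U)
    (u : 𝓓'(U, ℂ)) :
    conjDist (op2 f g u) = op2 (fun c d z => conj (f c.swap d.swap z))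
      (fun c z => conj (g c.swap z)) (conjDist u) := by
  simp only [op2, conjDist_add, conjDist_sum, conjDist_mulDist (hf _ _), conjDist_mulDist (hg _),
    conjDist_derivation]
  congr 1
  · rw [← (Equiv.sumComm (Fin n) (Fin n)).sum_comp]
    refine Finset.sum_congr rfl fun c _ => ?_
    rw [← (Equiv.sumComm (Fin n) (Fin n)).sum_comp]
    simp
  · rw [← (Equiv.sumComm (Fin n) (Fin n)).sum_comp]
    simp

/-- The derivative of a distribution along a real vector field, in complex components. -/
noncomputable def realDeriv (X : Cn n → Cn n) (T : 𝓓'(U, ℂ)) : 𝓓'(U, ℂ) :=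
  ∑ c, mulDist (fun z => xiVar (X z) c) (derivation c T)

variable {X Y : Cn n → Cn n}

lemma xiVar_add (v w : Cn n) (c : Fin n ⊕ Fin n) : xiVar (v + w) c = xiVar v c + xiVar w c := by
  simp only [← xiVarCLM_apply, map_add]

lemma xiVar_sub (v w : Cn n) (c : Fin n ⊕ Fin n) : xiVar (v - w) c = xiVar v c - xiVar w c := by
  simp only [← xiVarCLM_apply, map_sub]

lemma xiVar_smul (a : ℝ) (v : Cn n) (c : Fin n ⊕ Fin n) : xiVar (a • v) c = a * xiVar v c := by
  simp only [← xiVarCLM_apply, map_smul, Complex.real_smul]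

lemma realDeriv_neg (hX : ContDiffOn ℝ ∞ X U) (T : 𝓓'(U, ℂ)) :
    realDeriv (fun z => -X z) T = -realDeriv X T := by
  rw [realDeriv, realDeriv, ← Finset.sum_neg_distrib]
  refine Finset.sum_congr rfl fun c _ => ?_
  have : (fun z => xiVar (-X z) c) = fun z => (-1 : ℂ) * xiVar (X z) c := by
    ext z; simp [← xiVarCLM_apply]
  rw [this, const_mul_mulDist _ (contDiffOn_xiVar hX c)]
  module

lemma realDeriv_add_right (hX : ContDiffOn ℝ ∞ X U) (S T : 𝓓'(U, ℂ)) :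
    realDeriv X (S + T) = realDeriv X S + realDeriv X T := by
  simp only [realDeriv, derivation_add, mulDist_add (contDiffOn_xiVar hX _),
    Finset.sum_add_distrib]

lemma realDeriv_smul_right (hX : ContDiffOn ℝ ∞ X U) (a : ℂ) (T : 𝓓'(U, ℂ)) :
    realDeriv X (a • T) = a • realDeriv X T := by
  simp only [realDeriv, derivation_smul, mulDist_smul (contDiffOn_xiVar hX _), Finset.smul_sum]

lemma realDeriv_neg_right (hX : ContDiffOn ℝ ∞ X U) (T : 𝓓'(U, ℂ)) :
    realDeriv X (-T) = -realDeriv X T := by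
  rw [show -T = (-1 : ℂ) • T by module, realDeriv_smul_right hX]
  module

lemma contDiffOn_apply (hX : ContDiffOn ℝ ∞ X U) (k : Fin n) :
    ContDiffOn ℝ ∞ (fun z => X z k) U :=
  contDiffOn_xiVar hX (.inl k)

/-- Passes from the derivations ∂/∂x, ∂/∂y to ∂/∂z, ∂/∂z̄. The factor ½ is built in because every
field in the Hessian is a (1,0)- or (0,1)-part, and equality on U suffices because J is controlled
only there. -/
lemma deriv_eq_realDeriv (V : ComplexField n) (hX : ContDiffOn ℝ ∞ X U) (hY : ContDiffOn ℝ ∞ Y U)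
    (hre : ∀ z ∈ U, V.re z = (1 / 2 : ℝ) • X z) (him : ∀ z ∈ U, V.im z = (1 / 2 : ℝ) • Y z)
    (T : 𝓓'(U, ℂ)) :
    V.deriv T = (1 / 2 : ℂ) • (realDeriv X T + Complex.I • realDeriv Y T) := by
  simp only [ComplexField.deriv, realDeriv, Fintype.sum_sum_type, Finset.smul_sum, smul_add,
    ← Finset.sum_add_distrib]
  refine Finset.sum_congr rfl fun k _ => ?_
  have hr : ∀ {Z : Cn n → Cn n}, ContDiffOn ℝ ∞ Z U →
      ContDiffOn ℝ ∞ (fun z => ((Z z k).re : ℂ)) U := fun hZ =>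
    Complex.ofRealCLM.contDiff.comp_contDiffOn (contDiffOn_re (contDiffOn_apply hZ k))
  have hi : ∀ {Z : Cn n → Cn n}, ContDiffOn ℝ ∞ Z U →
      ContDiffOn ℝ ∞ (fun z => ((Z z k).im : ℂ)) U := fun hZ =>
    Complex.ofRealCLM.contDiff.comp_contDiffOn (contDiffOn_im (contDiffOn_apply hZ k))
  have e1 : ∀ S : 𝓓'(U, ℂ),
      mulDist (fun z => ((V.re z k).re : ℂ) + Complex.I * ((V.im z k).re : ℂ)) S =
      (1 / 2 : ℂ) • (mulDist (fun z => ((X z k).re : ℂ)) S +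
        Complex.I • mulDist (fun z => ((Y z k).re : ℂ)) S) := by
    intro S
    rw [← const_mul_mulDist _ (hr hY), ← add_mulDist (hr hX) (contDiffOn_const.mul (hr hY)),
      ← const_mul_mulDist _ ((hr hX).add (contDiffOn_const.mul (hr hY)))]
    refine (mulDist_congr (contDiffOn_const.mul ((hr hX).add (contDiffOn_const.mul (hr hY))))
      (fun z hz => ?_) _).symm
    rw [hre z hz, him z hz]
    simp; ring
  have e2 : ∀ S : 𝓓'(U, ℂ),
      mulDist (fun z => ((V.re z k).im : ℂ) + Complex.I * ((V.im z k).im : ℂ)) S =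
      (1 / 2 : ℂ) • (mulDist (fun z => ((X z k).im : ℂ)) S +
        Complex.I • mulDist (fun z => ((Y z k).im : ℂ)) S) := by
    intro S
    rw [← const_mul_mulDist _ (hi hY), ← add_mulDist (hi hX) (contDiffOn_const.mul (hi hY)),
      ← const_mul_mulDist _ ((hi hX).add (contDiffOn_const.mul (hi hY)))]
    refine (mulDist_congr (contDiffOn_const.mul ((hi hX).add (contDiffOn_const.mul (hi hY))))
      (fun z hz => ?_) _).symm
    rw [hre z hz, him z hz]
    simp; ring
  have e3 : ∀ {Z : Cn n → Cn n} (_ : ContDiffOn ℝ ∞ Z U) (S : 𝓓'(U, ℂ)),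
      mulDist (fun z => xiVar (Z z) (.inl k)) S = mulDist (fun z => ((Z z k).re : ℂ)) S +
        Complex.I • mulDist (fun z => ((Z z k).im : ℂ)) S := by
    intro Z hZ S
    rw [← const_mul_mulDist _ (hi hZ), ← add_mulDist (hr hZ) (contDiffOn_const.mul (hi hZ))]
    congr 1
    ext z
    simp only [xiVar, Sum.elim_inl]
    rw [mul_comm, Complex.re_add_im]
  have e4 : ∀ {Z : Cn n → Cn n} (_ : ContDiffOn ℝ ∞ Z U) (S : 𝓓'(U, ℂ)),
      mulDist (fun z => xiVar (Z z) (.inr k)) S = mulDist (fun z => ((Z z k).re : ℂ)) S +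
        (-Complex.I) • mulDist (fun z => ((Z z k).im : ℂ)) S := by
    intro Z hZ S
    rw [← const_mul_mulDist _ (hi hZ), ← add_mulDist (hr hZ) (contDiffOn_const.mul (hi hZ))]
    congr 1
    ext z
    simp only [xiVar, Sum.elim_inr]
    apply Complex.ext <;> simp
  rw [e1, e2, e3 hX, e3 hY, e4 hX, e4 hY]
  simp only [derivation, Sum.elim_inl, Sum.elim_inr, dz, dzbar, mulDist_smul (hr hX),
    mulDist_smul (hr hY), mulDist_smul (hi hX), mulDist_smul (hi hY), mulDist_add (hr hX),
    mulDist_add (hr hY), mulDist_add (hi hX), mulDist_add (hi hY), sub_eq_add_neg,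
    mulDist_neg (hr hX), mulDist_neg (hr hY), mulDist_neg (hi hX), mulDist_neg (hi hY)]
  match_scalars <;> (ring_nf; try simp [Complex.I_sq])
  all_goals (try norm_num)

lemma realDeriv_realDeriv (hX : ContDiffOn ℝ ∞ X U) (hY : ContDiffOn ℝ ∞ Y U) (T : 𝓓'(U, ℂ)) :
    realDeriv X (realDeriv Y T) = op2 (fun c d z => xiVar (X z) c * xiVar (Y z) d)
      (fun d z => xiVar (fderiv ℝ Y z (X z)) d) T := by
  have hX' := contDiffOn_xiVar hX
  have hY' := contDiffOn_xiVar hY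
  simp only [realDeriv, derivation_sum, mulDist_sum (hX' _), derivation_mulDist (hY' _),
    mulDist_add (hX' _), ← mul_mulDist (hX' _) (hY' _),
    ← mul_mulDist (hX' _) (contDiffOn_wd (hY' _) _), Finset.sum_add_distrib, op2]
  rw [add_comm]
  congr 1
  rw [Finset.sum_comm]
  refine Finset.sum_congr rfl fun d _ => ?_
  have hs : ∀ c ∈ (Finset.univ : Finset (Fin n ⊕ Fin n)), ContDiffOn ℝ ∞
      (fun z => xiVar (X z) c * wd c (fun w => xiVar (Y w) d) z) U :=
    fun c _ => (hX' c).mul (contDiffOn_wd (hY' d) c)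
  rw [← sum_mulDist _ hs]
  refine mulDist_congr (ContDiffOn.sum hs) (fun z hz => ?_) _
  rw [← fderiv_eq_sum_wd, fderiv_xiVar hY d hz]

lemma realDeriv_eq_op2 (T : 𝓓'(U, ℂ)) :
    realDeriv X T = op2 (fun _ _ _ => 0) (fun d z => xiVar (X z) d) T := by
  simp [realDeriv, op2, zero_mulDist]

end SecondOrder

/-! ### The Hessian as a second order operator that is pointwise quadratic in ξ -/

section HessianFormula

variable {n : ℕ} {U : TopologicalSpace.Opens (Cn n)} {J : Cn n → Cn n →L[ℝ] Cn n}
  {X Y ξ : Cn n → Cn n}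

/-- The (1,0)- and (0,1)-parts equal multiples of ξ and Jξ on U only; brackets are local, so this is
enough. -/
lemma lieBracket_of_eqOn_smul {V W : Cn n → Cn n} (hX : ContDiffOn ℝ ∞ X U)
    (hY : ContDiffOn ℝ ∞ Y U) (a b : ℝ) (hV : ∀ z ∈ U, V z = a • X z) (hW : ∀ z ∈ U, W z = b • Y z)
    {z : Cn n} (hz : z ∈ U) :
    VectorField.lieBracket ℝ V W z = (a * b) • VectorField.lieBracket ℝ X Y z := by
  have hdX : DifferentiableAt ℝ X z :=
    (hX.contDiffAt (U.isOpen.mem_nhds hz)).differentiableAt (by simp)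
  have hdY : DifferentiableAt ℝ Y z :=
    (hY.contDiffAt (U.isOpen.mem_nhds hz)).differentiableAt (by simp)
  rw [VectorField.lieBracket_eq, VectorField.lieBracket_eq]
  simp only
  rw [fderiv_congr_of_mem hV hz, fderiv_congr_of_mem hW hz, hV z hz, hW z hz,
    fderiv_fun_const_smul hdX, fderiv_fun_const_smul hdY]
  simp only [_root_.smul_apply, map_smul]
  module

lemma contDiffOn_lieBracket (hX : ContDiffOn ℝ ∞ X U) (hY : ContDiffOn ℝ ∞ Y U) :
    ContDiffOn ℝ ∞ (VectorField.lieBracket ℝ X Y) U := by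
  rw [VectorField.lieBracket_eq]
  exact ((hY.fderiv_of_isOpen U.isOpen (by simp)).clm_apply hX).sub
    ((hX.fderiv_of_isOpen U.isOpen (by simp)).clm_apply hY)

/-- The second order parts of XY and YX differ only by exchanging indices, so `op2_congr` removes
them; the first order parts give the bracket. -/
lemma realDeriv_lieBracket (hX : ContDiffOn ℝ ∞ X U) (hY : ContDiffOn ℝ ∞ Y U) (T : 𝓓'(U, ℂ)) :
    realDeriv (VectorField.lieBracket ℝ X Y) T =
      realDeriv X (realDeriv Y T) - realDeriv Y (realDeriv X T) := by
  have hX' := contDiffOn_xiVar hX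
  have hY' := contDiffOn_xiVar hY
  have hb := contDiffOn_xiVar (contDiffOn_lieBracket hX hY)
  have hYX := contDiffOn_xiVar ((hY.fderiv_of_isOpen (m := ∞) U.isOpen (by simp)).clm_apply hX)
  have hXY := contDiffOn_xiVar ((hX.fderiv_of_isOpen (m := ∞) U.isOpen (by simp)).clm_apply hY)
  rw [eq_sub_iff_add_eq, realDeriv_realDeriv hX hY, realDeriv_realDeriv hY hX, realDeriv_eq_op2,
    op2_add (fun _ _ => contDiffOn_const) (fun c d => (hY' c).mul (hX' d)) hb hXY]
  refine op2_congr (fun c d => contDiffOn_const.add ((hY' c).mul (hX' d)))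
    (fun c d => (hX' c).mul (hY' d)) (fun c => (hb c).add (hXY c)) ?_ ?_ T
  · intro c d z _; ring
  · intro c z _
    rw [VectorField.lieBracket_eq, xiVar_sub]
    ring

lemma contDiffOn_endo_apply (hJ : ContDiffOn ℝ ∞ J U) (hξ : ContDiffOn ℝ ∞ ξ U) :
    ContDiffOn ℝ ∞ (fun z => J z (ξ z)) U := hJ.clm_apply hξ

/-- The Hessian is `½ (ξ.ξ.u + η.η.u + (J [ξ, η]).u)` with `η = J ξ`. -/
lemma hessian_eq_realDeriv (hJ : ContDiffOn ℝ ∞ J U) (hJ2 : ∀ z ∈ U, ∀ v, J z (J z v) = -v)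
    (hξ : ContDiffOn ℝ ∞ ξ U) (u : 𝓓'(U, ℂ)) :
    hessian J u ξ = (1 / 2 : ℂ) • (realDeriv ξ (realDeriv ξ u) +
      realDeriv (fun z => J z (ξ z)) (realDeriv (fun z => J z (ξ z)) u) +
      realDeriv (fun z => J z (VectorField.lieBracket ℝ ξ (fun z => J z (ξ z)) z)) u) := by
  set η : Cn n → Cn n := fun z => J z (ξ z) with hη_def
  have hη : ContDiffOn ℝ ∞ η U := contDiffOn_endo_apply hJ hξ
  have hηn : ContDiffOn ℝ ∞ (fun z => -η z) U := hη.neg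
  have hξn : ContDiffOn ℝ ∞ (fun z => -ξ z) U := hξ.neg
  have hJη : ∀ z ∈ U, J z (η z) = -ξ z := fun z hz => hJ2 z hz (ξ z)
  set b := VectorField.lieBracket ℝ ξ η with hb_def
  have hb : ContDiffOn ℝ ∞ b U := contDiffOn_lieBracket hξ hη
  have hJb : ContDiffOn ℝ ∞ (fun z => J z (b z)) U := contDiffOn_endo_apply hJ hb
  set V : ComplexField n := .ofReal ξ
  set W : ComplexField n := .ofReal η
  have V10r : ∀ z ∈ U, (V.part10 J).re z = (1 / 2 : ℝ) • ξ z := fun z _ => by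
    simp [ComplexField.part10, V, ComplexField.ofReal]
  have V10i : ∀ z ∈ U, (V.part10 J).im z = (1 / 2 : ℝ) • -η z := fun z _ => by
    simp [ComplexField.part10, V, ComplexField.ofReal, η]
  have V01r : ∀ z ∈ U, (V.part01 J).re z = (1 / 2 : ℝ) • ξ z := fun z _ => by
    simp [ComplexField.part01, V, ComplexField.ofReal]
  have V01i : ∀ z ∈ U, (V.part01 J).im z = (1 / 2 : ℝ) • η z := fun z _ => by
    simp [ComplexField.part01, V, ComplexField.ofReal, η]
  have W10r : ∀ z ∈ U, (W.part10 J).re z = (1 / 2 : ℝ) • η z := fun z _ => by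
    simp [ComplexField.part10, W, ComplexField.ofReal]
  have W10i : ∀ z ∈ U, (W.part10 J).im z = (1 / 2 : ℝ) • ξ z := fun z hz => by
    simp [ComplexField.part10, W, ComplexField.ofReal, hJη z hz]
  have W01r : ∀ z ∈ U, (W.part01 J).re z = (1 / 2 : ℝ) • η z := fun z _ => by
    simp [ComplexField.part01, W, ComplexField.ofReal]
  have W01i : ∀ z ∈ U, (W.part01 J).im z = (1 / 2 : ℝ) • -ξ z := fun z hz => by
    simp [ComplexField.part01, W, ComplexField.ofReal, hJη z hz]
  have W01i' : ∀ z ∈ U, (W.part01 J).im z = (-(1 / 2) : ℝ) • ξ z := fun z hz => by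
    rw [W01i z hz]; module
  have V10i' : ∀ z ∈ U, (V.part10 J).im z = (-(1 / 2) : ℝ) • η z := fun z hz => by
    rw [V10i z hz]; module
  have hsymm : ∀ z, VectorField.lieBracket ℝ η ξ z = -b z := fun z => by
    rw [hb_def, VectorField.lieBracket_swap]
  have hself : ∀ (X : Cn n → Cn n) z, VectorField.lieBracket ℝ X X z = 0 := fun X z => by
    simp
  obtain ⟨E, hE⟩ : ∃ E, E = ((((V.part10 J).bracket (W.part10 J)).part10 J).add
      (((V.part01 J).bracket (W.part10 J)).part01 J)).add
        (((V.part10 J).bracket (W.part01 J)).part01 J) := ⟨_, rfl⟩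
  have hE₀ := hE
  -- Here W^{1,0} = i V^{1,0}, so the bracket of the two (1,0)-parts vanishes.
  have h1r : ∀ z ∈ U, ((V.part10 J).bracket (W.part10 J)).re z = 0 := fun z hz => by
    simp only [ComplexField.bracket]
    rw [lieBracket_of_eqOn_smul hξ hη _ _ V10r W10r hz,
      lieBracket_of_eqOn_smul hη hξ _ _ V10i' W10i hz, hsymm]
    module
  have h1i : ∀ z ∈ U, ((V.part10 J).bracket (W.part10 J)).im z = 0 := fun z hz => by
    simp only [ComplexField.bracket]
    rw [lieBracket_of_eqOn_smul hξ hξ _ _ V10r W10i hz,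
      lieBracket_of_eqOn_smul hη hη _ _ V10i' W10r hz, hself, hself]
    module
  -- From W^{1,0} = i V^{1,0} and W^{0,1} = -i V^{0,1}, both mixed brackets equal ½[ξ, η] with zero
  -- imaginary part. The argument of the current is thus the (0,1)-part of [ξ, η].
  have h2r : ∀ z ∈ U, ((V.part01 J).bracket (W.part10 J)).re z = (1 / 2 : ℝ) • b z :=
    fun z hz => by
    simp only [ComplexField.bracket]
    rw [lieBracket_of_eqOn_smul hξ hη _ _ V01r W10r hz,
      lieBracket_of_eqOn_smul hη hξ _ _ V01i W10i hz, hsymm]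
    module
  have h2i : ∀ z ∈ U, ((V.part01 J).bracket (W.part10 J)).im z = 0 := fun z hz => by
    simp only [ComplexField.bracket]
    rw [lieBracket_of_eqOn_smul hξ hξ _ _ V01r W10i hz,
      lieBracket_of_eqOn_smul hη hη _ _ V01i W10r hz, hself, hself]
    module
  have h3r : ∀ z ∈ U, ((V.part10 J).bracket (W.part01 J)).re z = (1 / 2 : ℝ) • b z :=
    fun z hz => by
    simp only [ComplexField.bracket]
    rw [lieBracket_of_eqOn_smul hξ hη _ _ V10r W01r hz,
      lieBracket_of_eqOn_smul hη hξ _ _ V10i' W01i' hz, hsymm]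
    module
  have h3i : ∀ z ∈ U, ((V.part10 J).bracket (W.part01 J)).im z = 0 := fun z hz => by
    simp only [ComplexField.bracket]
    rw [lieBracket_of_eqOn_smul hξ hξ _ _ V10r W01i' hz,
      lieBracket_of_eqOn_smul hη hη _ _ V10i' W01r hz, hself, hself]
    module
  -- Only the values of the brackets on U are used now, so they become opaque fields and are not
  -- unfolded again.
  generalize (V.part10 J).bracket (W.part10 J) = E₁ at h1r h1i hE
  generalize (V.part01 J).bracket (W.part10 J) = E₂ at h2r h2i hE
  generalize (V.part10 J).bracket (W.part01 J) = E₃ at h3r h3i hE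
  have hEre : ∀ z ∈ U, E.re z = (1 / 2 : ℝ) • b z := by
    intro z hz
    simp only [hE, ComplexField.add, ComplexField.part10, ComplexField.part01, h1r z hz, h1i z hz,
      h2r z hz, h2i z hz, h3r z hz, h3i z hz, map_zero]
    module
  have hEim : ∀ z ∈ U, E.im z = (1 / 2 : ℝ) • J z (b z) := by
    intro z hz
    simp only [hE, ComplexField.add, ComplexField.part10, ComplexField.part01, h1r z hz, h1i z hz,
      h2r z hz, h2i z hz, h3r z hz, h3i z hz, map_zero, map_smul]
    module
  have hE01r : ∀ z ∈ U, (E.part01 J).re z = (1 / 2 : ℝ) • b z := fun z hz => by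
    simp only [ComplexField.part01, hEre z hz, hEim z hz, map_smul, hJ2 z hz]
    module
  have hE01i : ∀ z ∈ U, (E.part01 J).im z = (1 / 2 : ℝ) • J z (b z) := fun z hz => by
    simp only [ComplexField.part01, hEre z hz, hEim z hz, map_smul]
    module
  have key : hessian J u ξ = Complex.I • ((V.part10 J).deriv ((W.part01 J).deriv u) -
    (W.part10 J).deriv ((V.part01 J).deriv u) - (E.part01 J).deriv u) := by
    rw [hE₀]; rfl
  rw [key]
  -- The operator is now 2 V^{1,0} V^{0,1} - (i/2)b + ½ Jb with b = [ξ, η]. Since 2 V^{1,0} V^{0,1}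
  -- = ½(ξξ + ηη + i b), the terms in b cancel and only Jb survives.
  simp only [deriv_eq_realDeriv _ hξ hηn V10r V10i, deriv_eq_realDeriv _ hη hξn W01r W01i,
    deriv_eq_realDeriv _ hη hξ W10r W10i, deriv_eq_realDeriv _ hξ hη V01r V01i,
    deriv_eq_realDeriv _ hb hJb hE01r hE01i, realDeriv_neg hη, realDeriv_neg hξ,
    realDeriv_add_right hξ, realDeriv_add_right hη, realDeriv_smul_right hξ,
    realDeriv_smul_right hη, realDeriv_neg_right hξ, realDeriv_neg_right hη, hb_def,
    realDeriv_lieBracket hξ hη]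
  match_scalars <;> ring_nf <;> (try simp only [Complex.I_sq]) <;> norm_num

/-- The vector field `½ ((∂_η J) ξ - (∂_ξ J) η)`, where `η = J ξ`. -/
noncomputable def firstOrderField (J : Cn n → Cn n →L[ℝ] Cn n) (z v : Cn n) : Cn n :=
  (1 / 2 : ℝ) • (fderiv ℝ J z (J z v) v - fderiv ℝ J z v (J z v))

/-- The coefficient of `D_c D_d` in the Hessian. -/
noncomputable def hessSecond (J : Cn n → Cn n →L[ℝ] Cn n) (c d : Fin n ⊕ Fin n) (z v : Cn n) : ℂ :=
  (1 / 2 : ℂ) * (xiVar v c * xiVar v d + xiVar (J z v) c * xiVar (J z v) d)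

lemma contDiffOn_hessSecond (hJ : ContDiffOn ℝ ∞ J U) (hξ : ContDiffOn ℝ ∞ ξ U)
    (c d : Fin n ⊕ Fin n) : ContDiffOn ℝ ∞ (fun z => hessSecond J c d z (ξ z)) U := by
  have hη := contDiffOn_endo_apply hJ hξ
  exact contDiffOn_const.mul (((contDiffOn_xiVar hξ c).mul (contDiffOn_xiVar hξ d)).add
    ((contDiffOn_xiVar hη c).mul (contDiffOn_xiVar hη d)))

lemma contDiffOn_firstOrderField (hJ : ContDiffOn ℝ ∞ J U) (hξ : ContDiffOn ℝ ∞ ξ U) :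
    ContDiffOn ℝ ∞ (fun z => firstOrderField J z (ξ z)) U := by
  have hη := contDiffOn_endo_apply hJ hξ
  have hJ' := hJ.fderiv_of_isOpen (m := ∞) U.isOpen (by simp)
  exact (((hJ'.clm_apply hη).clm_apply hξ).sub ((hJ'.clm_apply hξ).clm_apply hη)).const_smul _

/-- The Hessian is tensorial in ξ: no derivative of ξ appears in the coefficients. This is what
makes a remainder polynomial in ξ, ξ̄ possible. -/
lemma hessian_eq_op2 (hJ : ContDiffOn ℝ ∞ J U) (hJ2 : ∀ z ∈ U, ∀ v, J z (J z v) = -v)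
    (hξ : ContDiffOn ℝ ∞ ξ U) (u : 𝓓'(U, ℂ)) :
    hessian J u ξ = op2 (fun c d z => hessSecond J c d z (ξ z))
      (fun c z => xiVar (firstOrderField J z (ξ z)) c) u := by
  have hη := contDiffOn_endo_apply hJ hξ
  have hb := contDiffOn_lieBracket hξ hη
  have hJb := contDiffOn_endo_apply hJ hb
  have hξ' := contDiffOn_xiVar hξ
  have hη' := contDiffOn_xiVar hη
  have d1 := contDiffOn_xiVar ((hξ.fderiv_of_isOpen (m := ∞) U.isOpen (by simp)).clm_apply hξ)
  have d2 := contDiffOn_xiVar ((hη.fderiv_of_isOpen (m := ∞) U.isOpen (by simp)).clm_apply hη)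
  have d3 := contDiffOn_xiVar hJb
  have f1 : ∀ c d : Fin n ⊕ Fin n, ContDiffOn ℝ ∞ (fun z => xiVar (ξ z) c * xiVar (ξ z) d) U :=
    fun c d => (hξ' c).mul (hξ' d)
  have f2 : ∀ c d : Fin n ⊕ Fin n,
      ContDiffOn ℝ ∞ (fun z => xiVar (J z (ξ z)) c * xiVar (J z (ξ z)) d) U :=
    fun c d => (hη' c).mul (hη' d)
  rw [hessian_eq_realDeriv hJ hJ2 hξ, realDeriv_realDeriv hξ hξ, realDeriv_realDeriv hη hη,
    realDeriv_eq_op2, op2_add f1 f2 d1 d2, op2_add (fun c d => (f1 c d).add (f2 c d))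
      (fun _ _ => contDiffOn_const) (fun c => (d1 c).add (d2 c)) d3,
    op2_smul (fun c d => ((f1 c d).add (f2 c d)).add contDiffOn_const)
      (fun c => ((d1 c).add (d2 c)).add (d3 c))]
  refine op2_congr
    (fun c d => contDiffOn_const.mul (((f1 c d).add (f2 c d)).add contDiffOn_const))
    (fun c d => contDiffOn_hessSecond hJ hξ c d)
    (fun c => contDiffOn_const.mul (((d1 c).add (d2 c)).add (d3 c))) ?_ ?_ u
  · intro c d z _
    simp only [hessSecond]
    ring
  · intro c z hz
    have hdJ : DifferentiableAt ℝ J z :=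
      (hJ.contDiffAt (U.isOpen.mem_nhds hz)).differentiableAt (by simp)
    have hdξ : DifferentiableAt ℝ ξ z :=
      (hξ.contDiffAt (U.isOpen.mem_nhds hz)).differentiableAt (by simp)
    have hdη : ∀ v, fderiv ℝ (fun z => J z (ξ z)) z v =
        fderiv ℝ J z v (ξ z) + J z (fderiv ℝ ξ z v) := fun v => by
      rw [(hdJ.hasFDerivAt.clm_apply hdξ.hasFDerivAt).fderiv]
      simp [add_comm]
    -- Differentiating J² = -1 shows that J anticommutes with its derivatives.
    have hanti : ∀ v w, J z (fderiv ℝ J z v w) = -fderiv ℝ J z v (J z w) := fun v w => by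
      have h1 : fderiv ℝ (fun z => J z (J z w)) z v = 0 := by
        rw [fderiv_congr_of_mem (U := U) (g := fun _ => -w) (fun z hz => hJ2 z hz w) hz]
        simp
      rw [(hdJ.hasFDerivAt.clm_apply (hdJ.hasFDerivAt.clm_apply (hasFDerivAt_const w z))).fderiv]
        at h1
      simp only [ContinuousLinearMap.comp_zero, zero_add] at h1
      rw [eq_neg_iff_add_eq_zero, ← h1]
      simp
    -- In ∂_ξ ξ + ∂_η η + J(∂_ξ η - ∂_η ξ) the terms with a derivative of ξ are ∂_ξ ξ + J∂_η ξ +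
    -- J²∂_ξ ξ - J∂_η ξ = 0; the term J(∂_ξ J)ξ becomes -(∂_ξ J)η by anticommutation.
    have hvec : fderiv ℝ ξ z (ξ z) + fderiv ℝ (fun z => J z (ξ z)) z (J z (ξ z)) +
        J z (VectorField.lieBracket ℝ ξ (fun z => J z (ξ z)) z) =
        fderiv ℝ J z (J z (ξ z)) (ξ z) - fderiv ℝ J z (ξ z) (J z (ξ z)) := by
      rw [VectorField.lieBracket_eq]
      simp only [map_sub, hdη, map_add, hJ2 z hz, hanti]
      abel
    rw [← xiVar_add, ← xiVar_add, hvec, firstOrderField, xiVar_smul]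
    push_cast
    ring

end HessianFormula

/-! ### The order of vanishing of a smooth function at the origin -/

section Order

variable {n : ℕ} {U : TopologicalSpace.Opens (Cn n)} {f g : Cn n → ℂ}

/-- `f` is smooth on `U` and its derivatives of order less than `k` vanish at the origin. -/
def Ord (U : TopologicalSpace.Opens (Cn n)) : ℕ → (Cn n → ℂ) → Prop
  | 0, f => ContDiffOn ℝ ∞ f U
  | k + 1, f => ContDiffOn ℝ ∞ f U ∧ f 0 = 0 ∧ ∀ c, Ord U k (wd c f)

lemma Ord.contDiffOn {k : ℕ} (hf : Ord U k f) : ContDiffOn ℝ ∞ f U := by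
  cases k with
  | zero => exact hf
  | succ k => exact hf.1

lemma Ord.wd {k : ℕ} (hf : Ord U (k + 1) f) (c : Fin n ⊕ Fin n) : Ord U k (wd c f) := hf.2.2 c

lemma Ord.apply_zero {k : ℕ} (hf : Ord U (k + 1) f) : f 0 = 0 := hf.2.1

lemma Ord.of_succ {k : ℕ} (hf : Ord U (k + 1) f) : Ord U k f := by
  induction k generalizing f with
  | zero => exact hf.1
  | succ k ih => exact ⟨hf.1, hf.2.1, fun c => ih (hf.2.2 c)⟩

lemma Ord.mono {j k : ℕ} (hf : Ord U k f) (h : j ≤ k) : Ord U j f := by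
  induction h with
  | refl => exact hf
  | step _ ih => exact ih hf.of_succ

/-- The vanishing conditions concern only the jet at 0, so the domain may be shrunk or enlarged as
long as smoothness holds there. -/
lemma Ord.of_contDiffOn {V : TopologicalSpace.Opens (Cn n)} {k : ℕ} (hf : Ord U k f)
    (hV : ContDiffOn ℝ ∞ f V) : Ord V k f := by
  induction k generalizing f with
  | zero => exact hV
  | succ k ih => exact ⟨hV, hf.2.1, fun c => ih (hf.2.2 c) (contDiffOn_wd hV c)⟩

lemma Ord.congr (h0 : 0 ∈ U) {k : ℕ} (hf : Ord U k f) (h : ∀ z ∈ U, f z = g z) : Ord U k g := by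
  induction k generalizing f g with
  | zero => exact ContDiffOn.congr hf fun z hz => (h z hz).symm
  | succ k ih =>
    exact ⟨hf.1.congr fun z hz => (h z hz).symm, (h 0 h0).symm.trans hf.2.1,
      fun c => ih (hf.2.2 c) (wd_congr h c)⟩

lemma Ord.zero (k : ℕ) : Ord U k (fun _ => 0) := by
  induction k with
  | zero => exact contDiffOn_const
  | succ k ih => exact ⟨contDiffOn_const, rfl, fun c => by rw [wd_const]; exact ih⟩

lemma Ord.add (h0 : 0 ∈ U) {k : ℕ} (hf : Ord U k f) (hg : Ord U k g) :
    Ord U k (fun z => f z + g z) := by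
  induction k generalizing f g with
  | zero => exact ContDiffOn.add hf hg
  | succ k ih =>
    refine ⟨hf.1.add hg.1, by simp [hf.2.1, hg.2.1], fun c => ?_⟩
    exact (ih (hf.2.2 c) (hg.2.2 c)).congr h0 fun z hz => (wd_add hf.1 hg.1 c hz).symm

/-- Leibniz rule and induction on j + k, not on either order alone, because each derivative lowers
one of the two orders. -/
lemma Ord.mul (h0 : 0 ∈ U) {j k : ℕ} (hf : Ord U j f) (hg : Ord U k g) :
    Ord U (j + k) (fun z => f z * g z) := by
  obtain ⟨m, hm⟩ : ∃ m, j + k = m := ⟨_, rfl⟩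
  induction m generalizing f g j k with
  | zero =>
    rw [hm]
    exact hf.contDiffOn.mul hg.contDiffOn
  | succ m ih =>
    rw [hm]
    have hz : f 0 * g 0 = 0 := by
      rcases j with _ | j
      · rcases k with _ | k
        · omega
        · rw [hg.2.1, mul_zero]
      · rw [hf.2.1, zero_mul]
    refine ⟨hf.contDiffOn.mul hg.contDiffOn, hz, fun c => ?_⟩
    refine Ord.congr h0 (Ord.add h0 (f := fun z => AlmostComplex.wd c f z * g z)
      (g := fun z => f z * AlmostComplex.wd c g z) ?_ ?_)
      fun z hz => (wd_mul hf.contDiffOn hg.contDiffOn c hz).symm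
    -- When the differentiated factor already has order zero, its derivative still has order zero,
    -- and one order of the other factor is given up instead.
    · rcases j with _ | j
      · have h' : Ord U 0 (AlmostComplex.wd c f) := contDiffOn_wd hf.contDiffOn c
        have hk : k = m + 1 := by omega
        subst hk
        simpa using ih h' hg.of_succ (by omega)
      · have := ih (hf.2.2 c) hg (by omega)
        rwa [show j + k = m by omega] at this
    · rcases k with _ | k
      · have h' : Ord U 0 (AlmostComplex.wd c g) := contDiffOn_wd hg.contDiffOn c
        have hk : j = m + 1 := by omega
        subst hk
        simpa using ih hf.of_succ h' (by omega)
      · have := ih hf (hg.2.2 c) (by omega)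
        rwa [show j + k = m by omega] at this

lemma Ord.const (a : ℂ) : Ord U 0 (fun _ => a) := contDiffOn_const

lemma Ord.const_mul (h0 : 0 ∈ U) (a : ℂ) {k : ℕ} (hf : Ord U k f) : Ord U k (fun z => a * f z) := by
  simpa using Ord.mul h0 (Ord.const a) hf

lemma Ord.neg (h0 : 0 ∈ U) {k : ℕ} (hf : Ord U k f) : Ord U k (fun z => -f z) := by
  simpa using hf.const_mul h0 (-1)

lemma Ord.sub (h0 : 0 ∈ U) {k : ℕ} (hf : Ord U k f) (hg : Ord U k g) :
    Ord U k (fun z => f z - g z) := by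
  simpa [sub_eq_add_neg] using hf.add h0 (hg.neg h0)

lemma Ord.sum (h0 : 0 ∈ U) {ι : Type*} (s : Finset ι) {k : ℕ} {f : ι → Cn n → ℂ}
    (hf : ∀ i ∈ s, Ord U k (f i)) : Ord U k (fun z => ∑ i ∈ s, f i z) := by
  classical
  induction s using Finset.induction_on with
  | empty => simpa using Ord.zero k
  | insert a s ha ih =>
    simp only [Finset.sum_insert ha]
    exact (hf a (by simp)).add h0 (ih fun i hi => hf i (by simp [hi]))

lemma Ord.conj (h0 : 0 ∈ U) {k : ℕ} (hf : Ord U k f) : Ord U k (fun z => conj (f z)) := by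
  induction k generalizing f with
  | zero => exact contDiffOn_conj hf
  | succ k ih =>
    refine ⟨contDiffOn_conj hf.1, by simp [hf.2.1], fun c => ?_⟩
    exact (ih (hf.2.2 c.swap)).congr h0 fun z hz => (wd_conj hf.1 c hz).symm

lemma Ord.coord (c : Fin n ⊕ Fin n) : Ord U 1 (fun z => xiVar z c) := by
  refine ⟨contDiffOn_xiVar contDiffOn_id c, by cases c <;> simp [xiVar], fun d => ?_⟩
  rw [funext fun z => wd_coord d c z]
  exact contDiffOn_const

lemma wd_sum {ι : Type*} (s : Finset ι) {f : ι → Cn n → ℂ}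
    (hf : ∀ i ∈ s, ContDiffOn ℝ ∞ (f i) U) (c : Fin n ⊕ Fin n) {z : Cn n} (hz : z ∈ U) :
    wd c (fun z => ∑ i ∈ s, f i z) z = ∑ i ∈ s, wd c (f i) z := by
  classical
  induction s using Finset.induction_on with
  | empty => simp
  | insert a s ha ih =>
    simp only [Finset.sum_insert ha]
    rw [wd_add (hf a (by simp)) (ContDiffOn.sum fun i hi => hf i (by simp [hi])) c hz,
      ih fun i hi => hf i (by simp [hi])]

lemma wd_sub (hf : ContDiffOn ℝ ∞ f U) (hg : ContDiffOn ℝ ∞ g U) (c : Fin n ⊕ Fin n) {z : Cn n}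
    (hz : z ∈ U) : wd c (fun z => f z - g z) z = wd c f z - wd c g z := by
  simp only [sub_eq_add_neg]
  rw [wd_add hf hg.neg c hz, wd_neg]

/-! ### Taylor expansion -/

lemma contDiffOn_coord (c : Fin n ⊕ Fin n) : ContDiffOn ℝ ∞ (fun z => xiVar z c) U :=
  contDiffOn_xiVar contDiffOn_id c

lemma ord_sub_taylor_one (hf : ContDiffOn ℝ ∞ f U) : Ord U 1 (fun z => f z - f 0) :=
  ⟨hf.sub contDiffOn_const, sub_self _, fun c =>
    contDiffOn_wd (hf.sub contDiffOn_const) c⟩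

/-- Each Wirtinger derivative of f minus its Taylor polynomial is the derivative of f minus its
Taylor polynomial of one degree less; so each degree follows from the previous one. -/
lemma ord_sub_taylor_two (h0 : 0 ∈ U) (hf : ContDiffOn ℝ ∞ f U) :
    Ord U 2 (fun z => f z - (f 0 + ∑ c, wd c f 0 * xiVar z c)) := by
  have hs : ∀ c ∈ (Finset.univ : Finset (Fin n ⊕ Fin n)),
      ContDiffOn ℝ ∞ (fun z => wd c f 0 * xiVar z c) U :=
    fun c _ => contDiffOn_const.mul (contDiffOn_coord c)
  have hp : ContDiffOn ℝ ∞ (fun z => f 0 + ∑ c, wd c f 0 * xiVar z c) U :=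
    contDiffOn_const.add (ContDiffOn.sum hs)
  refine ⟨hf.sub hp, ?_, fun e => ?_⟩
  · simp [xiVar]
  · refine (ord_sub_taylor_one (contDiffOn_wd hf e)).congr h0 fun z hz => ?_
    rw [wd_sub hf hp e hz, wd_add contDiffOn_const (ContDiffOn.sum hs) e hz, wd_sum _ hs e hz]
    simp [wd_const_mul _ (contDiffOn_coord (U := U) _) e hz, wd_coord]

lemma ord_sub_taylor_three (h0 : 0 ∈ U) (hf : ContDiffOn ℝ ∞ f U) :
    Ord U 3 (fun z => f z - (f 0 + ∑ c, wd c f 0 * xiVar z c +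
      (1 / 2 : ℂ) * ∑ c, ∑ d, wd c (wd d f) 0 * (xiVar z c * xiVar z d))) := by
  have hs : ∀ c ∈ (Finset.univ : Finset (Fin n ⊕ Fin n)),
      ContDiffOn ℝ ∞ (fun z => wd c f 0 * xiVar z c) U :=
    fun c _ => contDiffOn_const.mul (contDiffOn_coord c)
  have hq : ∀ c d : Fin n ⊕ Fin n, ContDiffOn ℝ ∞ (fun z => xiVar z c * xiVar z d) U :=
    fun c d => (contDiffOn_coord c).mul (contDiffOn_coord d)
  have hd : ∀ c, ∀ d ∈ (Finset.univ : Finset (Fin n ⊕ Fin n)),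
      ContDiffOn ℝ ∞ (fun z => wd c (wd d f) 0 * (xiVar z c * xiVar z d)) U :=
    fun c d _ => contDiffOn_const.mul (hq c d)
  have hdd : ∀ c ∈ (Finset.univ : Finset (Fin n ⊕ Fin n)),
      ContDiffOn ℝ ∞ (fun z => ∑ d, wd c (wd d f) 0 * (xiVar z c * xiVar z d)) U :=
    fun c _ => ContDiffOn.sum (hd c)
  have hl : ContDiffOn ℝ ∞ (fun z => f 0 + ∑ c, wd c f 0 * xiVar z c) U :=
    contDiffOn_const.add (ContDiffOn.sum hs)
  have hp : ContDiffOn ℝ ∞ (fun z => f 0 + ∑ c, wd c f 0 * xiVar z c +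
      (1 / 2 : ℂ) * ∑ c, ∑ d, wd c (wd d f) 0 * (xiVar z c * xiVar z d)) U :=
    hl.add (contDiffOn_const.mul (ContDiffOn.sum hdd))
  refine ⟨hf.sub hp, ?_, fun e => ?_⟩
  · simp [xiVar]
  · refine (ord_sub_taylor_two h0 (contDiffOn_wd hf e)).congr h0 fun z hz => ?_
    rw [wd_sub hf hp e hz, wd_add hl (contDiffOn_const.mul (ContDiffOn.sum hdd)) e hz,
      wd_add contDiffOn_const (ContDiffOn.sum hs) e hz, wd_sum _ hs e hz,
      wd_const_mul _ (ContDiffOn.sum hdd) e hz, wd_sum _ hdd e hz]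
    have h1 : ∀ c, wd e (fun z => wd c f 0 * xiVar z c) z = if e = c then wd c f 0 else 0 :=
      fun c => by rw [wd_const_mul _ (contDiffOn_coord (U := U) _) e hz, wd_coord]; simp
    have h2 : ∀ c, wd e (fun z => ∑ d, wd c (wd d f) 0 * (xiVar z c * xiVar z d)) z =
        (if e = c then ∑ d, wd c (wd d f) 0 * xiVar z d else 0) +
          wd c (wd e f) 0 * xiVar z c := fun c => by
      rw [wd_sum _ (hd c) e hz]
      have : ∀ d, wd e (fun z => wd c (wd d f) 0 * (xiVar z c * xiVar z d)) z =
          (if e = c then wd c (wd d f) 0 * xiVar z d else 0) +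
            if e = d then wd c (wd d f) 0 * xiVar z c else 0 := fun d => by
        rw [wd_const_mul _ (hq c d) e hz, wd_mul (contDiffOn_coord c) (contDiffOn_coord d) e hz,
          wd_coord, wd_coord]
        split_ifs <;> ring
      simp only [this, Finset.sum_add_distrib, Finset.sum_ite_eq, Finset.mem_univ, if_true]
      split_ifs <;> simp
    simp only [h1, h2, Finset.sum_add_distrib, Finset.sum_ite_eq, Finset.mem_univ, if_true,
      wd_const]
    -- Differentiating the quadratic part yields two linear sums, which agree by symmetry of second
    -- derivatives and absorb the factor ½.
    have h3 : ∑ d, wd e (wd d f) 0 * xiVar z d = ∑ d, wd d (wd e f) 0 * xiVar z d :=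
      Finset.sum_congr rfl fun d _ => by rw [wd_comm hf e d h0]
    rw [h3]
    ring

end Order

/-! ### Hadamard's lemma -/

section Hadamard

variable {n : ℕ}

/-- The mean `∫₀¹ t^m f(tz) dt` along rays. -/
noncomputable def rayMean (m : ℕ) (f : Cn n → ℂ) (z : Cn n) : ℂ :=
  ∫ t in (0 : ℝ)..1, (t : ℂ) ^ m * f (t • z)

/-- Differentiation under the integral sign, dominated by the maximum of the derivative on the
compact set [0,1] × (closed unit ball about z). -/
lemma hasFDerivAt_rayMean (m : ℕ) {f : Cn n → ℂ} (hf : ContDiff ℝ ∞ f) (z : Cn n) :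
    HasFDerivAt (rayMean m f)
      (∫ t in (0 : ℝ)..1, ((t : ℂ) ^ m) • t • fderiv ℝ f (t • z)) z := by
  have hf' : Continuous (fderiv ℝ f) := hf.continuous_fderiv (by simp)
  have hc : Continuous fun p : ℝ × Cn n => ((p.1 : ℂ) ^ m) • p.1 • fderiv ℝ f (p.1 • p.2) := by
    fun_prop
  obtain ⟨C, hC⟩ := ((isCompact_Icc (a := (0 : ℝ)) (b := 1)).prod
    (isCompact_closedBall z 1)).exists_bound_of_continuousOn hc.continuousOn
  refine (intervalIntegral.hasFDerivAt_integral_of_dominated_of_fderiv_le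
    (F := fun z t => (t : ℂ) ^ m * f (t • z))
    (F' := fun z t => ((t : ℂ) ^ m) • t • fderiv ℝ f (t • z)) (bound := fun _ => C)
    (Metric.closedBall_mem_nhds z one_pos) ?_ ?_ ?_ ?_ ?_ ?_)
  · refine Filter.Eventually.of_forall fun w => Continuous.aestronglyMeasurable ?_
    have := hf.continuous
    fun_prop
  · refine Continuous.intervalIntegrable ?_ _ _
    have := hf.continuous
    fun_prop
  · refine Continuous.aestronglyMeasurable ?_
    fun_prop
  · refine Filter.Eventually.of_forall fun t ht w hw => hC (t, w) ⟨?_, hw⟩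
    rw [Set.uIoc_of_le zero_le_one] at ht
    exact ⟨ht.1.le, ht.2⟩
  · exact intervalIntegrable_const
  · refine Filter.Eventually.of_forall fun t _ w _ => ?_
    have h1 : HasFDerivAt (fun w : Cn n => t • w) (t • ContinuousLinearMap.id ℝ (Cn n)) w :=
      (hasFDerivAt_id w).const_smul t
    have h2 := ((hf.differentiable (by simp) (t • w)).hasFDerivAt.comp w h1).const_mul ((t : ℂ) ^ m)
    refine h2.congr_fderiv ?_
    ext v
    simp

lemma fderiv_rayMean (m : ℕ) {f : Cn n → ℂ} (hf : ContDiff ℝ ∞ f) (z v : Cn n) :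
    fderiv ℝ (rayMean m f) z v = rayMean (m + 1) (fun w => fderiv ℝ f w v) z := by
  have hf' : Continuous (fderiv ℝ f) := hf.continuous_fderiv (by simp)
  have hc : Continuous fun t : ℝ => ((t : ℂ) ^ m) • t • fderiv ℝ f (t • z) := by fun_prop
  rw [(hasFDerivAt_rayMean m hf z).fderiv,
    ContinuousLinearMap.intervalIntegral_apply (hc.intervalIntegrable _ _)]
  refine intervalIntegral.integral_congr fun t _ => ?_
  simp
  ring

lemma contDiff_fderiv_apply' {f : Cn n → ℂ} (hf : ContDiff ℝ ∞ f) (v : Cn n) :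
    ContDiff ℝ ∞ (fun w => fderiv ℝ f w v) :=
  (hf.fderiv_right (by simp)).clm_apply contDiff_const

/-- Differentiating raises the weight t^m to t^(m+1) and replaces f by a derivative, so the
induction on the smoothness order must let both m and f vary. -/
lemma contDiff_rayMean (m : ℕ) {f : Cn n → ℂ} (hf : ContDiff ℝ ∞ f) :
    ContDiff ℝ ∞ (rayMean m f) := by
  have key : ∀ (k : ℕ) (m : ℕ) (f : Cn n → ℂ), ContDiff ℝ ∞ f → ContDiff ℝ k (rayMean m f) := by
    intro k
    induction k with
    | zero =>
      intro m f hf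
      exact contDiff_zero.2 (continuous_iff_continuousAt.2 fun z =>
        (hasFDerivAt_rayMean m hf z).continuousAt)
    | succ k ih =>
      intro m f hf
      rw [Nat.cast_succ, contDiff_succ_iff_fderiv_apply]
      refine ⟨fun z => (hasFDerivAt_rayMean m hf z).differentiableAt, by simp, fun v => ?_⟩
      rw [funext fun z => fderiv_rayMean m hf z v]
      exact ih _ _ (contDiff_fderiv_apply' hf v)
  exact contDiff_infty.2 fun k => key k m f hf

lemma rayMean_zero (m : ℕ) {f : Cn n → ℂ} (hf : f 0 = 0) : rayMean m f 0 = 0 := by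
  simp [rayMean, hf]

lemma wd_rayMean (m : ℕ) {f : Cn n → ℂ} (hf : ContDiff ℝ ∞ f) (c : Fin n ⊕ Fin n) :
    wd c (rayMean m f) = rayMean (m + 1) (wd c f) := by
  ext z
  rw [wd_apply, fderiv_rayMean m hf, fderiv_rayMean m hf, rayMean, rayMean, rayMean]
  have hc : ∀ v : Cn n, Continuous fun t : ℝ => (t : ℂ) ^ (m + 1) * fderiv ℝ f (t • z) v := by
    intro v
    have := (contDiff_fderiv_apply' hf v).continuous
    fun_prop
  rw [← intervalIntegral.integral_const_mul, ← intervalIntegral.integral_add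
    ((hc _).intervalIntegrable _ _) (((hc _).intervalIntegrable _ _).const_mul _),
    ← intervalIntegral.integral_const_mul]
  refine intervalIntegral.integral_congr fun t _ => ?_
  simp only [wd_apply]
  ring

lemma Ord.rayMean {k : ℕ} {f : Cn n → ℂ} (hf : Ord ⊤ k f) (m : ℕ) :
    Ord ⊤ k (rayMean m f) := by
  have hs : ∀ {f : Cn n → ℂ}, ContDiffOn ℝ ∞ f (⊤ : TopologicalSpace.Opens (Cn n)) →
      ContDiff ℝ ∞ f := fun h => by simpa [contDiffOn_univ] using h
  induction k generalizing f m with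
  | zero => exact (contDiff_rayMean m (hs hf)).contDiffOn
  | succ k ih =>
    refine ⟨(contDiff_rayMean m (hs hf.1)).contDiffOn, rayMean_zero m hf.2.1, fun c => ?_⟩
    rw [wd_rayMean m (hs hf.1)]
    exact ih (hf.2.2 c) _

/-- Hadamard's lemma: a function vanishing to order `k + 1` is a combination of the coordinates
with coefficients that vanish to order `k`. -/
lemma Ord.eq_sum_coord {k : ℕ} {f : Cn n → ℂ} (hf : Ord ⊤ (k + 1) f) :
    ∃ g : Fin n ⊕ Fin n → Cn n → ℂ, (∀ c, Ord ⊤ k (g c)) ∧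
      ∀ z, f z = ∑ c, xiVar z c * g c z := by
  refine ⟨fun c => AlmostComplex.rayMean 0 (AlmostComplex.wd c f), fun c => (hf.wd c).rayMean 0,
    fun z => ?_⟩
  have hs : ContDiff ℝ ∞ f := by simpa [contDiffOn_univ] using hf.1
  have hw : ∀ c, Continuous (AlmostComplex.wd c f) := fun c => by
    have := contDiffOn_wd hf.1 c
    exact ContDiff.continuous (n := ∞) (𝕜 := ℝ) (by simpa [contDiffOn_univ] using this)
  have hd : ∀ t : ℝ, HasDerivAt (fun t : ℝ => f (t • z)) (fderiv ℝ f (t • z) z) t := fun t => by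
    have h1 : HasDerivAt (fun t : ℝ => t • z) z t := by
      simpa using (hasDerivAt_id t).smul_const z
    exact (hs.differentiable (by simp) (t • z)).hasFDerivAt.comp_hasDerivAt t h1
  have hc : Continuous fun t : ℝ => fderiv ℝ f (t • z) z := by
    have := (contDiff_fderiv_apply' hs z).continuous
    fun_prop
  have := intervalIntegral.integral_eq_sub_of_hasDerivAt (a := 0) (b := 1) (fun t _ => hd t)
    (hc.intervalIntegrable _ _)
  simp only [one_smul, zero_smul, hf.2.1, sub_zero] at this
  rw [← this]
  simp only [AlmostComplex.rayMean, pow_zero, one_mul, ← intervalIntegral.integral_const_mul]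
  rw [← intervalIntegral.integral_finsetSum fun c _ => Continuous.intervalIntegrable (by
    have := hw c
    fun_prop) _ _]
  exact intervalIntegral.integral_congr fun t _ => fderiv_eq_sum_wd _ _

/-- Hadamard's lemma integrates along rays from 0, which may leave U. The function is therefore
first replaced by a global one agreeing with it on the compact closure of U; this is why the closure
must lie in V. -/
lemma Ord.inMaximalIdealCube {U V : TopologicalSpace.Opens (Cn n)} {f : Cn n → ℂ} (h0 : 0 ∈ U)
    (hf : Ord V 3 f) (hU : IsCompact (closure (U : Set (Cn n))))
    (hUV : closure (U : Set (Cn n)) ⊆ V) : InMaximalIdealCube U f := by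
  obtain ⟨G, hG, hGf⟩ := exists_global_extension (Ω := V)
    (g := fun z => (f z).re) (contDiffOn_re hf.contDiffOn) ⟨_, hU⟩ hUV
  obtain ⟨G', hG', hGf'⟩ := exists_global_extension (Ω := V)
    (g := fun z => (f z).im) (contDiffOn_im hf.contDiffOn) ⟨_, hU⟩ hUV
  set H : Cn n → ℂ := fun z => (G z : ℂ) + G' z * Complex.I
  have hH : ContDiff ℝ ∞ H := (Complex.ofRealCLM.contDiff.comp hG).add
    ((Complex.ofRealCLM.contDiff.comp hG').mul contDiff_const)
  have hHf : ∀ z ∈ U, f z = H z := fun z hz => by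
    have hz' : z ∈ (⟨_, hU⟩ : TopologicalSpace.Compacts (Cn n)) := subset_closure hz
    simp only [H, hGf z hz', hGf' z hz', Complex.re_add_im]
  have hU' : ContDiffOn ℝ ∞ f U := hf.contDiffOn.mono (subset_closure.trans hUV)
  -- The global function equals f near 0, so it inherits the vanishing of the jet.
  have hH3 : Ord ⊤ 3 H := ((hf.of_contDiffOn hU').congr h0 hHf).of_contDiffOn hH.contDiffOn
  obtain ⟨g₁, hg₁, h₁⟩ := hH3.eq_sum_coord
  choose g₂ hg₂ h₂ using fun c => (hg₁ c).eq_sum_coord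
  choose g₃ hg₃ h₃ using fun c d => (hg₂ c d).eq_sum_coord
  let ι := (Fin n ⊕ Fin n) × (Fin n ⊕ Fin n) × (Fin n ⊕ Fin n)
  let e := Fintype.equivFin ι
  have h00 : ∀ c : Fin n ⊕ Fin n, xiVar (0 : Cn n) c = 0 := fun c => by cases c <;> simp [xiVar]
  -- One product for each triple of coordinates; the coefficient left after the third application of
  -- Hadamard's lemma need not vanish at 0 and is absorbed in the last factor.
  refine ⟨Fintype.card ι, fun i => ![fun z => xiVar z (e.symm i).1, fun z => xiVar z (e.symm i).2.1,
    fun z => xiVar z (e.symm i).2.2 * g₃ (e.symm i).1 (e.symm i).2.1 (e.symm i).2.2 z], ?_, ?_⟩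
  · intro i j
    fin_cases j
    · exact ⟨contDiffOn_coord _, h00 _⟩
    · exact ⟨contDiffOn_coord _, h00 _⟩
    · exact ⟨(contDiffOn_coord _).mul ((hg₃ _ _ _).contDiffOn.mono (fun _ _ => trivial)),
        by simp [h00]⟩
  · intro z hz
    rw [hHf z hz, h₁, ← e.sum_comp]
    simp only [Equiv.symm_apply_apply, Fin.prod_univ_three, Matrix.cons_val_zero,
      Matrix.cons_val_one, Matrix.cons_val]
    rw [Fintype.sum_prod_type]
    refine Finset.sum_congr rfl fun c _ => ?_
    rw [h₂, Fintype.sum_prod_type, Finset.mul_sum]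
    refine Finset.sum_congr rfl fun d _ => ?_
    rw [h₃, Finset.mul_sum, Finset.mul_sum]
    exact Finset.sum_congr rfl fun x _ => by ring

end Hadamard

/-! ### Homogeneous polynomials in `ξ`, `ξ̄` whose coefficients vanish to a given order -/

section Forms

variable {n : ℕ} {U : TopologicalSpace.Opens (Cn n)}

/-- On `U`, the function `φ z v` is a homogeneous polynomial of degree `d` in the `v_k`, `v̄_k` with
coefficients in `Ord U k`. -/
def IsForm (U : TopologicalSpace.Opens (Cn n)) (d k : ℕ) (φ : Cn n → Cn n → ℂ) : Prop :=
  ∃ a : (Fin d → Fin n ⊕ Fin n) → Cn n → ℂ, (∀ i, Ord U k (a i)) ∧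
    ∀ z ∈ U, ∀ v, φ z v = ∑ i, a i z * ∏ j, xiVar v (i j)

variable {d e j k m p : ℕ} {φ φ' ψ ψ' χ : Cn n → Cn n → ℂ}

lemma IsForm.congr (hφ : IsForm U d k φ) (h : ∀ z ∈ U, ∀ v, φ z v = ψ z v) : IsForm U d k ψ := by
  obtain ⟨a, ha, h'⟩ := hφ
  exact ⟨a, ha, fun z hz v => by rw [← h z hz, h' z hz]⟩

lemma IsForm.mono (hφ : IsForm U d k φ) (h : j ≤ k) : IsForm U d j φ := by
  obtain ⟨a, ha, h'⟩ := hφ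
  exact ⟨a, fun i => (ha i).mono h, h'⟩

lemma IsForm.coeff {f : Cn n → ℂ} (hf : Ord U k f) : IsForm U 0 k (fun z _ => f z) :=
  ⟨fun _ => f, fun _ => hf, fun z _ v => by simp⟩

lemma IsForm.var (c : Fin n ⊕ Fin n) : IsForm U 1 0 (fun _ v => xiVar v c) := by
  classical
  refine ⟨fun i _ => if i 0 = c then 1 else 0, fun i => Ord.const _, fun z _ v => ?_⟩
  rw [← (Equiv.funUnique (Fin 1) (Fin n ⊕ Fin n)).symm.sum_comp]
  simp

lemma IsForm.var_apply (k : Fin n) : IsForm U 1 0 (fun _ v => v k) := IsForm.var (.inl k)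

lemma IsForm.var_conj (k : Fin n) : IsForm U 1 0 (fun _ v => conj (v k)) := IsForm.var (.inr k)

lemma IsForm.zero : IsForm U d k (fun _ _ => 0) :=
  ⟨fun _ _ => 0, fun _ => Ord.zero k, fun z _ v => by simp⟩

lemma IsForm.add (h0 : 0 ∈ U) (hφ : IsForm U d k φ) (hψ : IsForm U d k ψ) :
    IsForm U d k (fun z v => φ z v + ψ z v) := by
  obtain ⟨a, ha, h⟩ := hφ
  obtain ⟨b, hb, h'⟩ := hψ
  refine ⟨fun i z => a i z + b i z, fun i => (ha i).add h0 (hb i), fun z hz v => ?_⟩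
  simp only [h z hz, h' z hz, add_mul, Finset.sum_add_distrib]

lemma IsForm.sum (h0 : 0 ∈ U) {ι : Type*} (s : Finset ι) {φ : ι → Cn n → Cn n → ℂ}
    (hφ : ∀ i ∈ s, IsForm U d k (φ i)) : IsForm U d k (fun z v => ∑ i ∈ s, φ i z v) := by
  classical
  induction s using Finset.induction_on with
  | empty => simpa using IsForm.zero
  | insert a s ha ih =>
    simp only [Finset.sum_insert ha]
    exact (hφ a (by simp)).add h0 (ih fun i hi => hφ i (by simp [hi]))

/-- Monomials multiply by concatenating their index tuples, and the coefficients multiply as in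
`Ord.mul`. -/
lemma IsForm.mul (h0 : 0 ∈ U) (hφ : IsForm U d j φ) (hψ : IsForm U e k ψ) :
    IsForm U (d + e) (j + k) (fun z v => φ z v * ψ z v) := by
  obtain ⟨a, ha, h⟩ := hφ
  obtain ⟨b, hb, h'⟩ := hψ
  refine ⟨fun i z => a (fun x => i (Fin.castAdd e x)) z * b (fun x => i (Fin.natAdd d x)) z,
    fun i => (ha _).mul h0 (hb _), fun z hz v => ?_⟩
  beta_reduce
  rw [h z hz, h' z hz, Finset.sum_mul_sum,
    ← (Fin.appendEquiv d e (α := Fin n ⊕ Fin n)).sum_comp, Fintype.sum_prod_type]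
  refine Finset.sum_congr rfl fun x _ => Finset.sum_congr rfl fun y _ => ?_
  rw [Fin.prod_univ_add]
  simp only [Fin.appendEquiv, Equiv.coe_fn_mk, Fin.append_left, Fin.append_right]
  ring

lemma IsForm.const_mul (h0 : 0 ∈ U) (c : ℂ) (hφ : IsForm U d k φ) :
    IsForm U d k (fun z v => c * φ z v) := by
  simpa using (IsForm.coeff (U := U) (Ord.const c)).mul h0 hφ

lemma IsForm.neg (h0 : 0 ∈ U) (hφ : IsForm U d k φ) : IsForm U d k (fun z v => -φ z v) := by
  simpa using hφ.const_mul h0 (-1)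

lemma IsForm.sub (h0 : 0 ∈ U) (hφ : IsForm U d k φ) (hψ : IsForm U d k ψ) :
    IsForm U d k (fun z v => φ z v - ψ z v) := by
  simpa [sub_eq_add_neg] using hφ.add h0 (hψ.neg h0)

lemma IsForm.conj (h0 : 0 ∈ U) (hφ : IsForm U d k φ) :
    IsForm U d k (fun z v => conj (φ z v)) := by
  obtain ⟨a, ha, h⟩ := hφ
  refine ⟨fun i z => conj (a (fun x => (i x).swap) z), fun i => (ha _).conj h0, fun z hz v => ?_⟩
  beta_reduce
  rw [h z hz, map_sum, ← (Equiv.arrowCongr (Equiv.refl (Fin d))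
    (Equiv.sumComm (Fin n) (Fin n))).sum_comp]
  refine Finset.sum_congr rfl fun i _ => ?_
  simp only [map_mul, map_prod, ← xiVar_swap]
  simp [Equiv.arrowCongr, Function.comp_def]

/-- The functions `φ` and `ψ` differ by a form of degree `d` with coefficients in `Ord U k`. -/
def Eqv (U : TopologicalSpace.Opens (Cn n)) (d k : ℕ) (φ ψ : Cn n → Cn n → ℂ) : Prop :=
  IsForm U d k (fun z v => φ z v - ψ z v)

lemma Eqv.symm (h0 : 0 ∈ U) (h : Eqv U d k φ ψ) : Eqv U d k ψ φ :=
  (IsForm.neg h0 h).congr fun _ _ _ => neg_sub _ _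

lemma Eqv.trans (h0 : 0 ∈ U) (h : Eqv U d k φ ψ) (h' : Eqv U d k ψ χ) : Eqv U d k φ χ :=
  (IsForm.add h0 h h').congr fun _ _ _ => sub_add_sub_cancel _ _ _

lemma Eqv.of_eq (h : ∀ z ∈ U, ∀ v, φ z v = ψ z v) : Eqv U d k φ ψ :=
  (IsForm.zero (U := U)).congr fun z hz v => by rw [h z hz, sub_self]

lemma Eqv.mono (h : Eqv U d k φ ψ) (hj : j ≤ k) : Eqv U d j φ ψ := IsForm.mono h hj

lemma Eqv.add (h0 : 0 ∈ U) (h : Eqv U d k φ φ') (h' : Eqv U d k ψ ψ') :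
    Eqv U d k (fun z v => φ z v + ψ z v) (fun z v => φ' z v + ψ' z v) :=
  (IsForm.add h0 h h').congr fun z _ v => by ring

lemma Eqv.sub (h0 : 0 ∈ U) (h : Eqv U d k φ φ') (h' : Eqv U d k ψ ψ') :
    Eqv U d k (fun z v => φ z v - ψ z v) (fun z v => φ' z v - ψ' z v) :=
  (IsForm.sub h0 h h').congr fun z _ v => by ring

lemma Eqv.const_mul (h0 : 0 ∈ U) (c : ℂ) (h : Eqv U d k φ φ') :
    Eqv U d k (fun z v => c * φ z v) (fun z v => c * φ' z v) :=
  (IsForm.const_mul h0 c h).congr fun z _ v => by ring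

lemma Eqv.conj (h0 : 0 ∈ U) (h : Eqv U d k φ φ') :
    Eqv U d k (fun z v => conj (φ z v)) (fun z v => conj (φ' z v)) :=
  (IsForm.conj h0 h).congr fun _ _ _ => map_sub _ _ _

lemma Eqv.sum (h0 : 0 ∈ U) {ι : Type*} (s : Finset ι) {φ ψ : ι → Cn n → Cn n → ℂ}
    (h : ∀ i ∈ s, Eqv U d k (φ i) (ψ i)) :
    Eqv U d k (fun z v => ∑ i ∈ s, φ i z v) (fun z v => ∑ i ∈ s, ψ i z v) :=
  (IsForm.sum h0 s h).congr fun z _ v => by rw [Finset.sum_sub_distrib]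

/-- Congruences can be multiplied. -/
lemma Eqv.mul (h0 : 0 ∈ U) (hφ : IsForm U d j φ) (hψ' : IsForm U e p ψ') {q r : ℕ}
    (h : Eqv U d q φ φ') (h' : Eqv U e r ψ ψ') (h₁ : k ≤ j + r) (h₂ : k ≤ q + p) :
    Eqv U (d + e) k (fun z v => φ z v * ψ z v) (fun z v => φ' z v * ψ' z v) := by
  -- Uses φψ - φ'ψ' = φ(ψ - ψ') + (φ - φ')ψ', which is why bounds are required only for φ and ψ'.
  refine (IsForm.add h0 ((hφ.mul h0 h').mono h₁) ((IsForm.mul h0 h hψ').mono h₂)).congr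
    fun z _ v => ?_
  ring

lemma Eqv.mul_left (h0 : 0 ∈ U) (hφ : IsForm U d j φ) {r : ℕ} (h' : Eqv U e r ψ ψ')
    (h₁ : k ≤ j + r) :
    Eqv U (d + e) k (fun z v => φ z v * ψ z v) (fun z v => φ z v * ψ' z v) :=
  ((hφ.mul h0 h').mono h₁).congr fun z _ v => by ring

lemma Eqv.mul_right (h0 : 0 ∈ U) (hψ : IsForm U e j ψ) {r : ℕ} (h' : Eqv U d r φ φ')
    (h₁ : k ≤ r + j) :
    Eqv U (d + e) k (fun z v => φ z v * ψ z v) (fun z v => φ' z v * ψ z v) :=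
  ((IsForm.mul h0 h' hψ).mono h₁).congr fun z _ v => by ring

lemma Eqv.isForm (h0 : 0 ∈ U) (h : Eqv U d k φ ψ) (hψ : IsForm U d k ψ) : IsForm U d k φ :=
  (IsForm.add h0 h hψ).congr fun z _ v => by ring

lemma Eqv.coeff {f g : Cn n → ℂ} (h : Ord U k (fun z => f z - g z)) :
    Eqv U 0 k (fun z _ => f z) (fun z _ => g z) := IsForm.coeff h

lemma IsForm.exists_quadratic (hφ : IsForm U 2 k φ) :
    ∃ a : Fin n ⊕ Fin n → Fin n ⊕ Fin n → Cn n → ℂ, (∀ c d, Ord U k (a c d)) ∧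
      ∀ z ∈ U, ∀ v, φ z v = ∑ c, ∑ d, a c d z * (xiVar v c * xiVar v d) := by
  obtain ⟨a, ha, h⟩ := hφ
  refine ⟨fun c d => a ![c, d], fun c d => ha _, fun z hz v => ?_⟩
  rw [h z hz, ← (finTwoArrowEquiv (Fin n ⊕ Fin n)).symm.sum_comp, Fintype.sum_prod_type]
  simp

end Forms

/-! ### Products of forms of total degree one and two -/

section FormsExtra

variable {n : ℕ} {U : TopologicalSpace.Opens (Cn n)} {f f' : Cn n → ℂ}
  {d j k p q r : ℕ} {φ φ' ψ ψ' : Cn n → Cn n → ℂ}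

lemma IsForm.smul (h0 : 0 ∈ U) (hf : Ord U j f) (hφ : IsForm U d k φ) :
    IsForm U d (j + k) (fun z v => f z * φ z v) := by
  have := (IsForm.coeff hf).mul h0 hφ
  rwa [zero_add] at this

lemma Eqv.smul (h0 : 0 ∈ U) (hf : Ord U j f) (hψ' : IsForm U d p ψ')
    (h : Ord U q (fun z => f z - f' z)) (h' : Eqv U d r ψ ψ') (h₁ : k ≤ j + r) (h₂ : k ≤ q + p) :
    Eqv U d k (fun z v => f z * ψ z v) (fun z v => f' z * ψ' z v) := by
  have := Eqv.mul h0 (IsForm.coeff hf) hψ' (Eqv.coeff h) h' h₁ h₂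
  rwa [zero_add] at this

lemma Eqv.smul_right (h0 : 0 ∈ U) (hψ : IsForm U d p ψ) (h : Ord U q (fun z => f z - f' z))
    (h₂ : k ≤ q + p) : Eqv U d k (fun z v => f z * ψ z v) (fun z v => f' z * ψ z v) := by
  have := Eqv.mul_right h0 hψ (Eqv.coeff h) h₂
  rwa [zero_add] at this

lemma IsForm.mul_linear (h0 : 0 ∈ U) (hφ : IsForm U 1 j φ) (hψ : IsForm U 1 k ψ) :
    IsForm U 2 (j + k) (fun z v => φ z v * ψ z v) := hφ.mul h0 hψ

lemma IsForm.linear_mul (h0 : 0 ∈ U) (hφ : IsForm U 1 0 φ) (hψ : IsForm U 1 k ψ) :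
    IsForm U 2 k (fun z v => φ z v * ψ z v) := (hφ.mul_linear h0 hψ).mono (by omega)

lemma Eqv.mul_linear (h0 : 0 ∈ U) (hφ : IsForm U 1 j φ) (hψ' : IsForm U 1 p ψ')
    (h : Eqv U 1 q φ φ') (h' : Eqv U 1 r ψ ψ') (h₁ : k ≤ j + r) (h₂ : k ≤ q + p) :
    Eqv U 2 k (fun z v => φ z v * ψ z v) (fun z v => φ' z v * ψ' z v) :=
  Eqv.mul h0 hφ hψ' h h' h₁ h₂

lemma Eqv.mul_linear_right (h0 : 0 ∈ U) (hψ : IsForm U 1 p ψ) (h : Eqv U 1 q φ φ')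
    (h₂ : k ≤ q + p) : Eqv U 2 k (fun z v => φ z v * ψ z v) (fun z v => φ' z v * ψ z v) :=
  Eqv.mul_right h0 hψ h h₂

lemma Eqv.mul_linear_left (h0 : 0 ∈ U) (hφ : IsForm U 1 p φ) (h : Eqv U 1 q ψ ψ')
    (h₂ : k ≤ p + q) : Eqv U 2 k (fun z v => φ z v * ψ z v) (fun z v => φ z v * ψ' z v) :=
  Eqv.mul_left h0 hφ h h₂

/-- Congruence of products of functions. -/
lemma Ord.mul_sub_mul (h0 : 0 ∈ U) {g g' : Cn n → ℂ} (hf : Ord U j f) (hg' : Ord U p g')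
    (h : Ord U q (fun z => f z - f' z)) (h' : Ord U r (fun z => g z - g' z)) (h₁ : k ≤ j + r)
    (h₂ : k ≤ q + p) : Ord U k (fun z => f z * g z - f' z * g' z) :=
  ((((hf.mul h0 h').mono h₁).add h0 ((h.mul h0 hg').mono h₂))).congr h0 fun z _ => by ring

end FormsExtra

/-! ### Jets of the matrix `B` -/

section Jets

variable {n : ℕ} {U : TopologicalSpace.Opens (Cn n)} {f : Cn n → ℂ}

/-- The holomorphic linear part of the Taylor expansion. -/
noncomputable def jetLin (f : Cn n → ℂ) (z : Cn n) : ℂ := ∑ r, wirt r f 0 * z r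

/-- The quadratic part of the Taylor expansion, apart from the terms `z̄_r z̄_h`. -/
noncomputable def jetQuad (f : Cn n → ℂ) (z : Cn n) : ℂ :=
  ∑ r, ∑ h, ((1 / 2 : ℂ) * wirt r (wirt h f) 0 * z r * z h +
    wirt r (wirtBar h f) 0 * z r * conj (z h))

lemma ord_sub_jetLin (h0 : 0 ∈ U) (hf : ContDiffOn ℝ ∞ f U) (hf0 : f 0 = 0)
    (h1 : ∀ s, wirtBar s f 0 = 0) : Ord U 2 (fun z => f z - jetLin f z) :=
  (ord_sub_taylor_two h0 hf).congr h0 fun z _ => by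
    simp [Fintype.sum_sum_type, h1, hf0, jetLin, xiVar]

lemma wirt_comm (hf : ContDiffOn ℝ ∞ f U) (h0 : 0 ∈ U) (r s : Fin n) :
    wirt r (wirt s f) 0 = wirt s (wirt r f) 0 := wd_comm hf (.inl r) (.inl s) h0

lemma wirtBar_wirt (hf : ContDiffOn ℝ ∞ f U) (h0 : 0 ∈ U) (r s : Fin n) :
    wirtBar r (wirt s f) 0 = wirt s (wirtBar r f) 0 := wd_comm hf (.inr r) (.inl s) h0

/-- When the pure z̄ coefficients vanish, the quadratic Taylor polynomial loses its z̄z̄ terms. The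
zz̄ and z̄z terms coincide, so the mixed part has no factor ½. -/
lemma ord_sub_jetLin_add_jetQuad (h0 : 0 ∈ U) (hf : ContDiffOn ℝ ∞ f U) (hf0 : f 0 = 0)
    (h1 : ∀ s, wirtBar s f 0 = 0) (h2 : ∀ s t, wirtBar s (wirtBar t f) 0 = 0) :
    Ord U 3 (fun z => f z - (jetLin f z + jetQuad f z)) :=
  (ord_sub_taylor_three h0 hf).congr h0 fun z _ => by
    simp only [Fintype.sum_sum_type, wd_inl, wd_inr, h1, hf0, h2, jetLin, xiVar, Sum.elim_inl,
      Sum.elim_inr, zero_mul, Finset.sum_const_zero, add_zero, zero_add, wirtBar_wirt hf h0,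
      jetQuad]
    refine congrArg (fun x => f z - (∑ r, wirt r f 0 * z r + x)) ?_
    simp only [Finset.sum_add_distrib]
    rw [Finset.sum_comm (f := fun r s => wirt s (wirtBar r f) 0 * (conj (z r) * z s))]
    simp only [mul_add, Finset.mul_sum, ← Finset.sum_add_distrib]
    refine Finset.sum_congr rfl fun r _ => Finset.sum_congr rfl fun s _ => ?_
    ring

lemma ord_sub_jet₂ (h0 : 0 ∈ U) (hf : ContDiffOn ℝ ∞ f U) : Ord U 3 (fun z => f z - jet₂ f z) :=
  (ord_sub_taylor_three h0 hf).congr h0 fun z _ => by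
    rw [jet₂, fderiv_eq_sum_wd, fderiv_fderiv_eq_sum hf h0]
    congr 2
    · simp only [mul_comm]
    · simp only [mul_comm]

lemma ord_apply (r : Fin n) : Ord U 1 (fun z => z r) := Ord.coord (.inl r)

lemma ord_conj_apply (r : Fin n) : Ord U 1 (fun z => conj (z r)) := Ord.coord (.inr r)

lemma ord_jetLin (h0 : 0 ∈ U) : Ord U 1 (jetLin f) :=
  Ord.sum h0 _ fun r _ => (ord_apply r).const_mul h0 _

lemma ord_jetQuad (h0 : 0 ∈ U) : Ord U 2 (jetQuad f) :=
  Ord.sum h0 _ fun r _ => Ord.sum h0 _ fun h _ =>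
    (((ord_apply r).const_mul h0 _).mul h0 (ord_apply h)).add h0
      (((ord_apply r).const_mul h0 _).mul h0 (ord_conj_apply h))

/-- The matrix functions of an almost complex structure near `0`, in coordinates in which the
coefficients of the monomials in `z̄` alone vanish in the Taylor expansion of `B` up to order `3`. -/
structure NormalForm (U : TopologicalSpace.Opens (Cn n))
    (A B : Cn n → Matrix (Fin n) (Fin n) ℂ) : Prop where
  mem : 0 ∈ U
  smoothA : ∀ k l, ContDiffOn ℝ ∞ (fun z => A z k l) U
  smoothB : ∀ k l, ContDiffOn ℝ ∞ (fun z => B z k l) U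
  sq : ∀ z ∈ U, ∀ k l, ∑ j, (A z k j * A z j l + conj (B z k j) * B z j l) =
    -(1 : Matrix (Fin n) (Fin n) ℂ) k l
  matA_zero : ∀ k l, A 0 k l = Complex.I * (1 : Matrix (Fin n) (Fin n) ℂ) k l
  matB_zero : ∀ k l, B 0 k l = 0
  wirtBar_zero : ∀ k l s, wirtBar s (fun z => B z k l) 0 = 0
  wirtBar₂_zero : ∀ k l s t, wirtBar s (wirtBar t (fun z => B z k l)) 0 = 0
  wirtBar₃_zero : ∀ k l s t r, wirtBar s (wirtBar t (wirtBar r (fun z => B z k l))) 0 = 0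

variable (A B : Cn n → Matrix (Fin n) (Fin n) ℂ)

/-- The deviation of `A` from `i I`. -/
noncomputable def devA (k l : Fin n) (z : Cn n) : ℂ :=
  A z k l - Complex.I * (1 : Matrix (Fin n) (Fin n) ℂ) k l

/-- The linear part of `B`. -/
noncomputable def linB (k l : Fin n) : Cn n → ℂ := jetLin fun z => B z k l

/-- The quadratic part of `B`. -/
noncomputable def quadB (k l : Fin n) : Cn n → ℂ := jetQuad fun z => B z k l

/-- The linear part of `∂B/∂z_t`. -/
noncomputable def linDB (t k l : Fin n) (z : Cn n) : ℂ :=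
  ∑ h, (2 * B₂ B t h k l * z h + B₁₁ B t h k l * conj (z h))

/-- The linear part of `∂B/∂z̄_t`. -/
noncomputable def linDbarB (t k l : Fin n) : Cn n → ℂ := jetLin (wirtBar t fun z => B z k l)

/-- The quadratic part of `∂B/∂z̄_t`. -/
noncomputable def quadDbarB (t k l : Fin n) : Cn n → ℂ := jetQuad (wirtBar t fun z => B z k l)

variable {A B}

namespace NormalForm

variable (H : NormalForm U A B)
include H

lemma ord_B (k l : Fin n) : Ord U 1 (fun z => B z k l) :=
  ⟨H.smoothB k l, H.matB_zero k l, fun c => contDiffOn_wd (H.smoothB k l) c⟩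

lemma ord_B_sub_linB (k l : Fin n) : Ord U 2 (fun z => B z k l - linB B k l z) :=
  ord_sub_jetLin H.mem (H.smoothB k l) (H.matB_zero k l) (H.wirtBar_zero k l)

lemma ord_B_sub_quadB (k l : Fin n) :
    Ord U 3 (fun z => B z k l - (linB B k l z + quadB B k l z)) :=
  ord_sub_jetLin_add_jetQuad H.mem (H.smoothB k l) (H.matB_zero k l) (H.wirtBar_zero k l)
    (H.wirtBar₂_zero k l)

lemma smooth_wirt (t k l : Fin n) : ContDiffOn ℝ ∞ (wirt t fun z => B z k l) U :=
  contDiffOn_wd (H.smoothB k l) (.inl t)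

lemma smooth_wirtBar (t k l : Fin n) : ContDiffOn ℝ ∞ (wirtBar t fun z => B z k l) U :=
  contDiffOn_wd (H.smoothB k l) (.inr t)

lemma ord_wirt_sub (t k l : Fin n) :
    Ord U 1 (fun z => wirt t (fun z => B z k l) z - B₁ B t k l) :=
  ord_sub_taylor_one (H.smooth_wirt t k l)

/-- The factor 2 in `linDB` undoes the ½ in `B₂`. Unlike `linDbarB`, this linear part does contain
z̄. -/
lemma ord_wirt_sub_linDB (t k l : Fin n) :
    Ord U 2 (fun z => wirt t (fun z => B z k l) z - (B₁ B t k l + linDB B t k l z)) :=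
  (ord_sub_taylor_two H.mem (H.smooth_wirt t k l)).congr H.mem fun z _ => by
    simp only [Fintype.sum_sum_type, wd_inl, wd_inr, wirtBar_wirt (H.smoothB k l) H.mem, xiVar,
      Sum.elim_inl, Sum.elim_inr, linDB, Finset.sum_add_distrib]
    have h1 : ∀ h, 2 * B₂ B t h k l = wirt h (wirt t fun z => B z k l) 0 := fun h => by
      rw [wirt_comm (H.smoothB k l) H.mem h t, B₂]
      simp [iterWirt]
    simp only [h1]
    rfl

lemma ord_wirtBar (t k l : Fin n) : Ord U 1 (wirtBar t fun z => B z k l) :=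
  ⟨H.smooth_wirtBar t k l, H.wirtBar_zero k l t, fun c => contDiffOn_wd (H.smooth_wirtBar t k l) c⟩

lemma ord_wirtBar_sub_linDbarB (t k l : Fin n) :
    Ord U 2 (fun z => wirtBar t (fun z => B z k l) z - linDbarB B t k l z) :=
  ord_sub_jetLin H.mem (H.smooth_wirtBar t k l) (H.wirtBar_zero k l t)
    fun s => H.wirtBar₂_zero k l s t

/-- This is where the third order part of the normal form is used: it removes the z̄z̄ terms from
the quadratic part of ∂B/∂z̄. -/
lemma ord_wirtBar_sub_quadDbarB (t k l : Fin n) :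
    Ord U 3 (fun z => wirtBar t (fun z => B z k l) z -
      (linDbarB B t k l z + quadDbarB B t k l z)) :=
  ord_sub_jetLin_add_jetQuad H.mem (H.smooth_wirtBar t k l) (H.wirtBar_zero k l t)
    (fun s => H.wirtBar₂_zero k l s t) fun s r => H.wirtBar₃_zero k l s r t

omit H in
lemma ord_linB (h0 : 0 ∈ U) (k l : Fin n) : Ord U 1 (linB B k l) := ord_jetLin h0

omit H in
lemma ord_linDbarB (h0 : 0 ∈ U) (t k l : Fin n) : Ord U 1 (linDbarB B t k l) := ord_jetLin h0

/-! ### The matrix `A` in terms of `B` -/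

lemma smooth_devA (k l : Fin n) : ContDiffOn ℝ ∞ (devA A k l) U :=
  (H.smoothA k l).sub contDiffOn_const

/-- With D = A - i, the identity A² + B̄B = -1 becomes D² + 2iD + B̄B = 0; this is that equation
solved for the linear term. -/
lemma devA_eq (k l : Fin n) : ∀ z ∈ U, devA A k l z = Complex.I / 2 *
    (∑ j, devA A k j z * devA A j l z + ∑ j, conj (B z k j) * B z j l) := by
  intro z hz
  have h := H.sq z hz k l
  rw [Finset.sum_add_distrib] at h
  have h1 : ∀ j, A z k j * A z j l = devA A k j z * devA A j l z +
      Complex.I * ((1 : Matrix (Fin n) (Fin n) ℂ) k j * A z j l) +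
      Complex.I * (A z k j * (1 : Matrix (Fin n) (Fin n) ℂ) j l) +
      (1 : Matrix (Fin n) (Fin n) ℂ) k j * (1 : Matrix (Fin n) (Fin n) ℂ) j l := fun j => by
    simp only [devA]
    linear_combination
      -(1 : Matrix (Fin n) (Fin n) ℂ) k j * (1 : Matrix (Fin n) (Fin n) ℂ) j l * Complex.I_sq
  simp only [h1, Finset.sum_add_distrib, ← Finset.mul_sum] at h
  have h2 : ∑ j, (1 : Matrix (Fin n) (Fin n) ℂ) k j * A z j l = A z k l := by
    simp [Matrix.one_apply]
  have h3 : ∑ j, A z k j * (1 : Matrix (Fin n) (Fin n) ℂ) j l = A z k l := by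
    simp [Matrix.one_apply]
  have h4 : ∑ j, (1 : Matrix (Fin n) (Fin n) ℂ) k j * (1 : Matrix (Fin n) (Fin n) ℂ) j l =
      (1 : Matrix (Fin n) (Fin n) ℂ) k l := by
    simp [Matrix.one_apply]
  rw [h2, h3, h4] at h
  have h5 : A z k l = devA A k l z + Complex.I * (1 : Matrix (Fin n) (Fin n) ℂ) k l := by
    simp [devA]
  rw [h5] at h
  linear_combination (-Complex.I / 2) * h +
    (devA A k l z + Complex.I * (1 : Matrix (Fin n) (Fin n) ℂ) k l) * Complex.I_sq

lemma ord_devA_one (k l : Fin n) : Ord U 1 (devA A k l) :=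
  ⟨H.smooth_devA k l, by simp [devA, H.matA_zero], fun c => contDiffOn_wd (H.smooth_devA k l) c⟩

lemma ord_conj_mul {m : ℕ} (hB : ∀ k l, Ord U m (fun z => B z k l)) (k l : Fin n) :
    Ord U (m + m) (fun z => ∑ j, conj (B z k j) * B z j l) :=
  Ord.sum H.mem _ fun j _ => ((hB k j).conj H.mem).mul H.mem (hB j l)

/-- Bootstrap in `devA_eq`: D vanishes at 0, so D² and B̄B both have order two, hence so does D. -/
lemma ord_devA (k l : Fin n) : Ord U 2 (devA A k l) :=
  ((Ord.add H.mem (Ord.sum H.mem _ fun j _ =>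
    (H.ord_devA_one k j).mul H.mem (H.ord_devA_one j l)) (H.ord_conj_mul H.ord_B k l)).const_mul
      H.mem _).congr H.mem fun z hz => (H.devA_eq k l z hz).symm

/-- Second round of the bootstrap: D now has order two, so D² has order four and drops out. -/
lemma ord_devA_sub (k l : Fin n) :
    Ord U 4 (fun z => devA A k l z - Complex.I / 2 * ∑ j, conj (B z k j) * B z j l) :=
  ((Ord.sum H.mem Finset.univ fun j _ => (H.ord_devA k j).mul H.mem
    (H.ord_devA j l)).const_mul H.mem (Complex.I / 2)).congr H.mem fun z hz => by
      rw [H.devA_eq k l z hz]; ring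

lemma smooth_conj_mul (k j l : Fin n) : ContDiffOn ℝ ∞ (fun z => conj (B z k j) * B z j l) U :=
  (contDiffOn_conj (H.smoothB k j)).mul (H.smoothB j l)

lemma ord_wd_devA_sub (c : Fin n ⊕ Fin n) (k l : Fin n) :
    Ord U 3 (fun z => wd c (devA A k l) z - Complex.I / 2 * ∑ j,
      (conj (wd c.swap (fun z => B z k j) z) * B z j l +
        conj (B z k j) * wd c (fun z => B z j l) z)) := by
  have hs : ∀ j ∈ (Finset.univ : Finset (Fin n)),
      ContDiffOn ℝ ∞ (fun z => conj (B z k j) * B z j l) U := fun j _ => H.smooth_conj_mul k j l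
  refine ((H.ord_devA_sub k l).wd c).congr H.mem fun z hz => ?_
  rw [wd_sub (H.smooth_devA k l) (contDiffOn_const.mul (ContDiffOn.sum hs)) c hz,
    wd_const_mul _ (ContDiffOn.sum hs) c hz, wd_sum _ hs c hz]
  simp only [wd_mul (contDiffOn_conj (H.smoothB k _)) (H.smoothB _ l) c hz,
    wd_conj (H.smoothB k _) c hz]

/-- `∂A_{kl}/∂z_t` to second order. -/
lemma ord_wirt_devA_sub (t k l : Fin n) :
    Ord U 2 (fun z => wirt t (devA A k l) z -
      Complex.I / 2 * ∑ j, conj (linB B k j z) * B₁ B t j l) := by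
  have h1 := (H.ord_wd_devA_sub (.inl t) k l).of_succ
  -- The derivative ∂/∂z_t falls on B̄ as the conjugate of ∂B/∂z̄_t, which vanishes at 0. That
  -- product has order two, and only the term differentiating B survives.
  have h2 : Ord U 2 (fun z => Complex.I / 2 * ∑ j,
      ((conj (wirtBar t (fun z => B z k j) z) * B z j l) +
        (conj (B z k j) * wirt t (fun z => B z j l) z - conj (linB B k j z) * B₁ B t j l))) :=
    Ord.const_mul H.mem _ (Ord.sum H.mem _ fun j _ =>
      (((H.ord_wirtBar t k j).conj H.mem).mul H.mem (H.ord_B j l)).add H.mem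
        (Ord.mul_sub_mul H.mem ((H.ord_B k j).conj H.mem) (Ord.const _)
          (((H.ord_B_sub_linB k j).conj H.mem).congr H.mem fun z _ => map_sub _ _ _)
          (H.ord_wirt_sub t j l) le_rfl le_rfl))
  refine (h1.add H.mem h2).congr H.mem fun z _ => ?_
  simp only [Sum.swap_inl, wd_inl, wd_inr, Finset.sum_add_distrib, Finset.sum_sub_distrib]
  ring

/-- `∂A_{kl}/∂z̄_t` to second order. -/
lemma ord_wirtBar_devA_sub (t k l : Fin n) :
    Ord U 2 (fun z => wirtBar t (devA A k l) z -
      Complex.I / 2 * ∑ j, conj (B₁ B t k j) * linB B j l z) := by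
  have h1 := (H.ord_wd_devA_sub (.inr t) k l).of_succ
  -- Here the roles are reversed: the term with ∂B/∂z̄_t is negligible and the one differentiating
  -- B̄ survives.
  have h2 : Ord U 2 (fun z => Complex.I / 2 * ∑ j,
      ((conj (wirt t (fun z => B z k j) z) * B z j l - conj (B₁ B t k j) * linB B j l z) +
        (conj (B z k j) * wirtBar t (fun z => B z j l) z))) :=
    Ord.const_mul H.mem _ (Ord.sum H.mem _ fun j _ =>
      Ord.add H.mem (Ord.mul_sub_mul H.mem (Ord.conj (k := 0) H.mem (H.smooth_wirt t k j))
          (ord_linB H.mem j l)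
          (((H.ord_wirt_sub t k j).conj H.mem).congr H.mem fun z _ => map_sub _ _ _)
          (H.ord_B_sub_linB j l) le_rfl le_rfl)
        (((H.ord_B k j).conj H.mem).mul H.mem (H.ord_wirtBar t j l)))
  refine (h1.add H.mem h2).congr H.mem fun z _ => ?_
  simp only [Sum.swap_inr, wd_inl, wd_inr, Finset.sum_add_distrib, Finset.sum_sub_distrib]
  ring

lemma ord_wd_devA (c : Fin n ⊕ Fin n) (k l : Fin n) : Ord U 1 (wd c (devA A k l)) :=
  (H.ord_devA k l).wd c

/-- `A_{kl} - i δ_{kl}` to third order. -/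
lemma ord_devA_sub_lin (k l : Fin n) :
    Ord U 3 (fun z => devA A k l z - Complex.I / 2 * ∑ j, conj (linB B k j z) * linB B j l z) := by
  have h2 : Ord U 3 (fun z => Complex.I / 2 * ∑ j,
      (conj (B z k j) * B z j l - conj (linB B k j z) * linB B j l z)) :=
    Ord.const_mul H.mem _ (Ord.sum H.mem _ fun j _ =>
      Ord.mul_sub_mul H.mem ((H.ord_B k j).conj H.mem) (ord_linB H.mem j l)
        (((H.ord_B_sub_linB k j).conj H.mem).congr H.mem fun z _ => map_sub _ _ _)
        (H.ord_B_sub_linB j l) le_rfl le_rfl)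
  refine ((H.ord_devA_sub k l).of_succ.add H.mem h2).congr H.mem fun z _ => ?_
  simp only [Finset.sum_sub_distrib]
  ring

end NormalForm

end Jets

/-! ### The first order coefficient of the Hessian -/

section FirstOrder

variable {n : ℕ} {U : TopologicalSpace.Opens (Cn n)} (A B : Cn n → Matrix (Fin n) (Fin n) ℂ)

/-- `B v`. -/
noncomputable def evB (k : Fin n) (z v : Cn n) : ℂ := ∑ l, B z k l * v l

/-- `B v` to first order. -/
noncomputable def evLin (k : Fin n) (z v : Cn n) : ℂ := ∑ l, linB B k l z * v l

/-- `B v` to second order. -/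
noncomputable def evQuad (k : Fin n) (z v : Cn n) : ℂ := ∑ l, (linB B k l z + quadB B k l z) * v l

/-- `(A - i) v`. -/
noncomputable def evDev (k : Fin n) (z v : Cn n) : ℂ := ∑ l, devA A k l z * v l

/-- `J v - i v`. -/
noncomputable def zeta (k : Fin n) (z v : Cn n) : ℂ := evDev A k z v + conj (evB B k z v)

/-- Twice the component `s` of the field `firstOrderField`, in terms of `A` and `B`. -/
noncomputable def firstOrderSum (s : Fin n) (z v : Cn n) : ℂ := ∑ k, ∑ l,
  (wirt k (devA A s l) z * (zeta A B k z v * v l - v k * zeta A B l z v) +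
    wirtBar k (devA A s l) z * (-2 * Complex.I * (conj (v k) * v l) +
      (conj (zeta A B k z v) * v l - conj (v k) * zeta A B l z v)) +
    conj (wirtBar k (fun z => B z s l) z) * (2 * Complex.I * (v k * conj (v l)) +
      (zeta A B k z v * conj (v l) - v k * conj (zeta A B l z v))) +
    conj (wirt k (fun z => B z s l) z) *
      (conj (zeta A B k z v) * conj (v l) - conj (v k) * conj (zeta A B l z v)))

/-- `firstOrderSum` to second order. -/
noncomputable def firstOrderJet (s : Fin n) (z v : Cn n) : ℂ := ∑ k, ∑ l,
  (Complex.I / 2 * (∑ j, conj (linB B s j z) * B₁ B k j l) *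
      (conj (evLin B k z v) * v l - v k * conj (evLin B l z v)) +
    (∑ j, conj (linB B s j z) * linDbarB B k j l z) * (conj (v k) * v l) +
    Complex.I / 2 * (∑ j, conj (B₁ B k s j) * linB B j l z) *
      (evLin B k z v * v l - conj (v k) * conj (evLin B l z v)) +
    2 * Complex.I * (conj (linDbarB B k s l z + quadDbarB B k s l z) * (v k * conj (v l))) +
    conj (linDbarB B k s l z) * (conj (evLin B k z v) * conj (v l) - v k * evLin B l z v) +
    (conj (B₁ B k s l) * (evQuad B k z v * conj (v l)) +
      conj (linDB B k s l z) * (evLin B k z v * conj (v l))) +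
    conj (B₁ B k s l) * (-Complex.I / 2 *
      ((∑ j, linB B k j z * conj (evLin B j z v)) * conj (v l) -
        conj (v k) * ∑ j, linB B l j z * conj (evLin B j z v))))

variable {A B}

namespace NormalForm

variable (H : NormalForm U A B)
include H

lemma isForm_evB (k : Fin n) : IsForm U 1 1 (evB B k) :=
  IsForm.sum H.mem _ fun l _ => IsForm.smul H.mem (H.ord_B k l) (IsForm.var_apply l)

lemma isForm_evLin (k : Fin n) : IsForm U 1 1 (evLin B k) :=
  IsForm.sum H.mem _ fun l _ => IsForm.smul H.mem (ord_linB H.mem k l) (IsForm.var_apply l)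

lemma isForm_evQuad (k : Fin n) : IsForm U 1 1 (evQuad B k) :=
  IsForm.sum H.mem _ fun l _ => IsForm.smul H.mem
    ((ord_linB H.mem k l).add H.mem (ord_jetQuad H.mem).of_succ) (IsForm.var_apply l)

lemma isForm_evDev (k : Fin n) : IsForm U 1 2 (evDev A k) :=
  IsForm.sum H.mem _ fun l _ => IsForm.smul H.mem (H.ord_devA k l) (IsForm.var_apply l)

lemma evB_eqv_evLin (k : Fin n) : Eqv U 1 2 (evB B k) (evLin B k) :=
  Eqv.sum H.mem _ fun l _ => Eqv.smul_right H.mem (IsForm.var_apply l) (H.ord_B_sub_linB k l) le_rfl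

lemma evB_eqv_evQuad (k : Fin n) : Eqv U 1 3 (evB B k) (evQuad B k) :=
  Eqv.sum H.mem _ fun l _ => Eqv.smul_right H.mem (IsForm.var_apply l) (H.ord_B_sub_quadB k l)
    le_rfl

lemma evDev_eqv (k : Fin n) :
    Eqv U 1 3 (evDev A k) (fun z v => Complex.I / 2 * ∑ j, conj (linB B k j z) * evLin B j z v) := by
  refine Eqv.trans H.mem (Eqv.sum H.mem _ fun l _ => Eqv.smul_right H.mem (IsForm.var_apply l)
    (H.ord_devA_sub_lin k l) le_rfl) (Eqv.of_eq fun z _ v => ?_)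
  simp only [evLin, Finset.mul_sum, Finset.sum_mul]
  rw [Finset.sum_comm]
  exact Finset.sum_congr rfl fun j _ => Finset.sum_congr rfl fun l _ => by ring

lemma isForm_zeta (k : Fin n) : IsForm U 1 1 (zeta A B k) :=
  IsForm.add H.mem ((H.isForm_evDev k).mono one_le_two) ((H.isForm_evB k).conj H.mem)

lemma zeta_eqv (k : Fin n) : Eqv U 1 2 (zeta A B k) (fun z v => conj (evLin B k z v)) :=
  (IsForm.add H.mem (H.isForm_evDev k) (IsForm.conj H.mem (H.evB_eqv_evLin k))).congr
    fun z _ v => by simp only [zeta, map_sub]; ring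

lemma conj_zeta_eqv (k : Fin n) : Eqv U 1 2 (fun z v => conj (zeta A B k z v)) (evLin B k) := by
  have := (H.zeta_eqv k).conj H.mem
  simpa only [Complex.conj_conj] using this

omit H in
lemma _root_.AlmostComplex.Eqv.mul_var (h0 : 0 ∈ U) {φ ψ : Cn n → Cn n → ℂ} {q : ℕ}
    (h : Eqv U 1 q φ ψ) (l : Fin n) :
    Eqv U 2 q (fun z v => φ z v * v l) (fun z v => ψ z v * v l) :=
  Eqv.mul_linear_right h0 (IsForm.var_apply l) h le_rfl

omit H in
lemma _root_.AlmostComplex.Eqv.mul_conj_var (h0 : 0 ∈ U) {φ ψ : Cn n → Cn n → ℂ} {q : ℕ}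
    (h : Eqv U 1 q φ ψ) (l : Fin n) :
    Eqv U 2 q (fun z v => φ z v * conj (v l)) (fun z v => ψ z v * conj (v l)) :=
  Eqv.mul_linear_right h0 (IsForm.var_conj l) h le_rfl

omit H in
lemma _root_.AlmostComplex.Eqv.var_mul (h0 : 0 ∈ U) {φ ψ : Cn n → Cn n → ℂ} {q : ℕ}
    (h : Eqv U 1 q φ ψ) (l : Fin n) :
    Eqv U 2 q (fun z v => v l * φ z v) (fun z v => v l * ψ z v) :=
  Eqv.mul_linear_left h0 (IsForm.var_apply l) h (by omega)

omit H in
lemma _root_.AlmostComplex.Eqv.conj_var_mul (h0 : 0 ∈ U) {φ ψ : Cn n → Cn n → ℂ} {q : ℕ}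
    (h : Eqv U 1 q φ ψ) (l : Fin n) :
    Eqv U 2 q (fun z v => conj (v l) * φ z v) (fun z v => conj (v l) * ψ z v) :=
  Eqv.mul_linear_left h0 (IsForm.var_conj l) h (by omega)

lemma isForm_conj_evLin (k : Fin n) : IsForm U 1 1 (fun z v => conj (evLin B k z v)) :=
  (H.isForm_evLin k).conj H.mem

/-- Both the derivative of A and ζ have order one, so knowing each to order two determines the
product to order three. -/
lemma eqv_wirt_devA (s k l : Fin n) : Eqv U 2 3
    (fun z v => wirt k (devA A s l) z * (zeta A B k z v * v l - v k * zeta A B l z v))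
    (fun z v => Complex.I / 2 * (∑ j, conj (linB B s j z) * B₁ B k j l) *
      (conj (evLin B k z v) * v l - v k * conj (evLin B l z v))) :=
  Eqv.smul H.mem (H.ord_wd_devA (.inl k) s l)
    (IsForm.sub H.mem ((H.isForm_conj_evLin k).mul_linear H.mem (IsForm.var_apply l))
      ((IsForm.var_apply k).linear_mul H.mem (H.isForm_conj_evLin l)))
    (H.ord_wirt_devA_sub k s l)
    (((H.zeta_eqv k).mul_var H.mem l).sub H.mem ((H.zeta_eqv l).var_mul H.mem k)) le_rfl le_rfl

lemma eqv_wirtBar_devA (s k l : Fin n) : Eqv U 2 3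
    (fun z v => wirtBar k (devA A s l) z *
      (conj (zeta A B k z v) * v l - conj (v k) * zeta A B l z v))
    (fun z v => Complex.I / 2 * (∑ j, conj (B₁ B k s j) * linB B j l z) *
      (evLin B k z v * v l - conj (v k) * conj (evLin B l z v))) :=
  Eqv.smul H.mem (H.ord_wd_devA (.inr k) s l)
    (IsForm.sub H.mem ((H.isForm_evLin k).mul_linear H.mem (IsForm.var_apply l))
      ((IsForm.var_conj k).linear_mul H.mem (H.isForm_conj_evLin l)))
    (H.ord_wirtBar_devA_sub k s l)
    (((H.conj_zeta_eqv k).mul_var H.mem l).sub H.mem ((H.zeta_eqv l).conj_var_mul H.mem k))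
    le_rfl le_rfl

/-- The factor v̄_k v_l does not vanish with z, so ∂A/∂z̄ is needed to order three. The first sum is
left with the full B because it later cancels exactly, sparing its expansion. -/
lemma eqv_wirtBar_devA_lead (s k l : Fin n) : Eqv U 2 3
    (fun z v => wirtBar k (devA A s l) z * (-2 * Complex.I * (conj (v k) * v l)))
    (fun z v => (∑ j, conj (wirt k (fun z => B z s j) z) * B z j l) * (conj (v k) * v l) +
      (∑ j, conj (linB B s j z) * linDbarB B k j l z) * (conj (v k) * v l)) := by
  have h1 : Ord U 3 (fun z => Complex.I / 2 * ∑ j,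
      (conj (B z s j) * wirtBar k (fun z => B z j l) z -
        conj (linB B s j z) * linDbarB B k j l z)) :=
    Ord.const_mul H.mem _ (Ord.sum H.mem _ fun j _ =>
      Ord.mul_sub_mul H.mem ((H.ord_B s j).conj H.mem) (ord_linDbarB H.mem k j l)
        (((H.ord_B_sub_linB s j).conj H.mem).congr H.mem fun z _ => map_sub _ _ _)
        (H.ord_wirtBar_sub_linDbarB k j l) le_rfl le_rfl)
  have h2 := (H.ord_wd_devA_sub (.inr k) s l).add H.mem h1
  have h3 := IsForm.smul H.mem h2 (IsForm.const_mul H.mem (-2 * Complex.I)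
    ((IsForm.var_conj k).mul_linear H.mem (IsForm.var_apply l)))
  refine IsForm.congr (h3.mono le_rfl) fun z _ v => ?_
  simp only [Sum.swap_inr, wd_inl, wd_inr, Finset.sum_add_distrib, Finset.sum_sub_distrib]
  linear_combination (∑ j, conj (wirt k (fun z => B z s j) z) * B z j l +
    ∑ j, conj (linB B s j z) * linDbarB B k j l z) * (conj (v k) * v l) * Complex.I_sq

lemma ord_conj_wirtBar_sub_quad (s k l : Fin n) :
    Ord U 3 (fun z => conj (wirtBar k (fun z => B z s l) z) -
      conj (linDbarB B k s l z + quadDbarB B k s l z)) :=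
  ((H.ord_wirtBar_sub_quadDbarB k s l).conj H.mem).congr H.mem fun _ _ => map_sub _ _ _

lemma ord_conj_wirtBar_sub_lin (s k l : Fin n) :
    Ord U 2 (fun z => conj (wirtBar k (fun z => B z s l) z) - conj (linDbarB B k s l z)) :=
  ((H.ord_wirtBar_sub_linDbarB k s l).conj H.mem).congr H.mem fun _ _ => map_sub _ _ _

/-- The term 2i v_k v̄_l needs ∂B/∂z̄ to order three, hence `quadDbarB`; the terms with ζ already
carry one order, and the linear part suffices there. -/
lemma eqv_wirtBar_B (s k l : Fin n) : Eqv U 2 3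
    (fun z v => conj (wirtBar k (fun z => B z s l) z) * (2 * Complex.I * (v k * conj (v l)) +
      (zeta A B k z v * conj (v l) - v k * conj (zeta A B l z v))))
    (fun z v =>
      2 * Complex.I * (conj (linDbarB B k s l z + quadDbarB B k s l z) * (v k * conj (v l))) +
      conj (linDbarB B k s l z) *
        (conj (evLin B k z v) * conj (v l) - v k * evLin B l z v)) := by
  have h1 := Eqv.const_mul H.mem (2 * Complex.I) (Eqv.smul_right (k := 3) H.mem
    ((IsForm.var_apply k).mul_linear H.mem (IsForm.var_conj l))
    (H.ord_conj_wirtBar_sub_quad s k l) le_rfl)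
  have h2 := Eqv.smul (k := 3) H.mem ((H.ord_wirtBar k s l).conj H.mem)
    (IsForm.sub H.mem ((H.isForm_conj_evLin k).mul_linear H.mem (IsForm.var_conj l))
      ((IsForm.var_apply k).linear_mul H.mem (H.isForm_evLin l)))
    (H.ord_conj_wirtBar_sub_lin s k l)
    (((H.zeta_eqv k).mul_conj_var H.mem l).sub H.mem ((H.conj_zeta_eqv l).var_mul H.mem k))
    le_rfl le_rfl
  exact (Eqv.add H.mem h1 h2).congr fun z _ v => by ring

/-- The derivative ∂B/∂z is split into its value at 0 and the rest. The value needs Bv to order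
three, while the rest has order one and needs Bv only to order two. -/
lemma eqv_wirt_B_evB (s k l : Fin n) : Eqv U 2 3
    (fun z v => conj (wirt k (fun z => B z s l) z) * (evB B k z v * conj (v l)))
    (fun z v => conj (B₁ B k s l) * (evQuad B k z v * conj (v l)) +
      conj (linDB B k s l z) * (evLin B k z v * conj (v l))) := by
  have h1 := Eqv.smul (k := 3) H.mem (f := fun _ => conj (B₁ B k s l))
    (f' := fun _ => conj (B₁ B k s l)) (Ord.const _)
    ((H.isForm_evQuad k).mul_linear H.mem (IsForm.var_conj l)) (q := 3)
    ((Ord.zero 3).congr H.mem fun _ _ => (sub_self _).symm)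
    ((H.evB_eqv_evQuad k).mul_conj_var H.mem l) le_rfl (by norm_num)
  have h2 := Eqv.smul (k := 3) H.mem
    (f := fun z => conj (wirt k (fun z => B z s l) z - B₁ B k s l))
    (f' := fun z => conj (linDB B k s l z)) ((H.ord_wirt_sub k s l).conj H.mem)
    ((H.isForm_evLin k).mul_linear H.mem (IsForm.var_conj l)) (q := 2)
    (((H.ord_wirt_sub_linDB k s l).conj H.mem).congr H.mem fun z _ => by
      simp only [map_sub, map_add]; ring)
    ((H.evB_eqv_evLin k).mul_conj_var H.mem l) le_rfl le_rfl
  exact (Eqv.add H.mem h1 h2).congr fun z _ v => by simp only [map_sub]; ring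

lemma conj_evDev_eqv (k : Fin n) : Eqv U 1 3 (fun z v => conj (evDev A k z v))
    (fun z v => -Complex.I / 2 * ∑ j, linB B k j z * conj (evLin B j z v)) :=
  ((H.evDev_eqv k).conj H.mem).congr fun z _ v => by
    simp only [map_mul, map_div₀, Complex.conj_I, map_ofNat, map_sum, Complex.conj_conj]

/-- Since (A - i)v has order two, only the value of ∂B/∂z at 0 contributes. -/
lemma eqv_wirt_B_evDev (s k l : Fin n) : Eqv U 2 3
    (fun z v => conj (wirt k (fun z => B z s l) z) *
      (conj (evDev A k z v) * conj (v l) - conj (v k) * conj (evDev A l z v)))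
    (fun z v => conj (B₁ B k s l) * (-Complex.I / 2 *
      ((∑ j, linB B k j z * conj (evLin B j z v)) * conj (v l) -
        conj (v k) * ∑ j, linB B l j z * conj (evLin B j z v)))) := by
  have hd : ∀ k, IsForm U 1 2 (fun z v => conj (evDev A k z v)) := fun k =>
    (H.isForm_evDev k).conj H.mem
  have hd' : ∀ k, IsForm U 1 2
      (fun z v => -Complex.I / 2 * ∑ j, linB B k j z * conj (evLin B j z v)) := fun k =>
    Eqv.isForm H.mem (((H.conj_evDev_eqv k).symm H.mem).mono (by norm_num)) (hd k)
  have := Eqv.smul (k := 3) H.mem (Ord.conj (k := 0) H.mem (H.smooth_wirt k s l))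
    (IsForm.sub H.mem ((hd' k).mul_linear H.mem (IsForm.var_conj l))
      ((IsForm.var_conj k).linear_mul H.mem (hd' l)))
    (f' := fun _ => conj (B₁ B k s l))
    (((H.ord_wirt_sub k s l).conj H.mem).congr H.mem fun z _ => map_sub _ _ _)
    (((H.conj_evDev_eqv k).mul_conj_var H.mem l).sub H.mem
      ((H.conj_evDev_eqv l).conj_var_mul H.mem k)) le_rfl le_rfl
  exact IsForm.congr this fun z _ v => by ring

/-- The comparisons above cover every term except one: the conjugate of ζ contains Bv, and its
product with v̄_k and the conjugate of ∂B_{sl}/∂z_k cancels the unexpanded part of the derivative of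
A. -/
theorem firstOrderSum_eqv (s : Fin n) :
    Eqv U 2 3 (firstOrderSum A B s) (firstOrderJet B s) := by
  have h := Eqv.sum H.mem Finset.univ fun k _ => Eqv.sum H.mem Finset.univ fun l _ =>
    Eqv.add H.mem (Eqv.add H.mem (Eqv.add H.mem (H.eqv_wirt_devA s k l)
      (Eqv.add H.mem (H.eqv_wirtBar_devA_lead s k l) (H.eqv_wirtBar_devA s k l)))
      (H.eqv_wirtBar_B s k l))
      (Eqv.add H.mem (H.eqv_wirt_B_evB s k l) (H.eqv_wirt_B_evDev s k l))
  refine IsForm.congr h fun z _ v => ?_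
  -- The cancelling terms agree only after summation over the indices: l and the inner index j
  -- exchange roles.
  have hcancel : ∑ k, ∑ l, (∑ j, conj (wirt k (fun z => B z s j) z) * B z j l) *
      (conj (v k) * v l) =
      ∑ k, ∑ l, conj (wirt k (fun z => B z s l) z) * (conj (v k) * evB B l z v) := by
    refine Finset.sum_congr rfl fun k _ => ?_
    simp only [evB, Finset.sum_mul, Finset.mul_sum]
    rw [Finset.sum_comm]
    exact Finset.sum_congr rfl fun j _ => Finset.sum_congr rfl fun l _ => by ring
  have hsum : firstOrderSum A B s z v = ∑ k, ∑ l,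
      (wirt k (devA A s l) z * (zeta A B k z v * v l - v k * zeta A B l z v) +
      (wirtBar k (devA A s l) z * (-2 * Complex.I * (conj (v k) * v l)) +
        wirtBar k (devA A s l) z *
          (conj (zeta A B k z v) * v l - conj (v k) * zeta A B l z v)) +
      conj (wirtBar k (fun z => B z s l) z) * (2 * Complex.I * (v k * conj (v l)) +
        (zeta A B k z v * conj (v l) - v k * conj (zeta A B l z v))) +
      (conj (wirt k (fun z => B z s l) z) * (evB B k z v * conj (v l)) +
        conj (wirt k (fun z => B z s l) z) *
          (conj (evDev A k z v) * conj (v l) - conj (v k) * conj (evDev A l z v)))) -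
      ∑ k, ∑ l, conj (wirt k (fun z => B z s l) z) * (conj (v k) * evB B l z v) := by
    rw [firstOrderSum]
    simp only [← Finset.sum_sub_distrib]
    refine Finset.sum_congr rfl fun k _ => Finset.sum_congr rfl fun l _ => ?_
    have : ∀ k, conj (zeta A B k z v) = conj (evDev A k z v) + evB B k z v := fun k => by
      simp [zeta]
    rw [this k, this l]
    ring
  rw [hsum, ← hcancel, firstOrderJet]
  simp only [Finset.sum_add_distrib]
  ring

end NormalForm

end FirstOrder

/-! ### The coefficients of the first order part -/

section Sums

variable {n : ℕ}

/-- Used throughout to turn a polynomial with coefficients given by products of Taylor coefficients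
into a product of linear forms such as `linB` or `evLin`. -/
lemma sum_contract (P Q : Fin n → Fin n → ℂ) (v w : Fin n → ℂ) :
    ∑ k, ∑ l, (∑ t, P t k * Q t l) * (v k * w l) =
      ∑ t, (∑ k, P t k * v k) * ∑ l, Q t l * w l := by
  simp only [Finset.sum_mul_sum]
  simp only [Finset.sum_mul]
  rw [Finset.sum_comm (s := Finset.univ (α := Fin n)) (t := Finset.univ (α := Fin n))
    (f := fun t k => ∑ l, P t k * v k * (Q t l * w l))]
  refine Finset.sum_congr rfl fun k _ => ?_
  rw [Finset.sum_comm]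
  exact Finset.sum_congr rfl fun t _ => Finset.sum_congr rfl fun l _ => by ring

lemma sum_contract₂ (c P Q : Fin n → Fin n → ℂ) (v w : Fin n → ℂ) :
    ∑ k, ∑ l, (∑ t, ∑ j, c t j * (P t k * Q j l)) * (v k * w l) =
      ∑ t, ∑ j, c t j * ((∑ k, P t k * v k) * ∑ l, Q j l * w l) := by
  have h : ∀ k l, ∑ t, ∑ j, c t j * (P t k * Q j l) = ∑ t, P t k * ∑ j, c t j * Q j l :=
    fun k l => Finset.sum_congr rfl fun t _ => by
      rw [Finset.mul_sum]
      exact Finset.sum_congr rfl fun j _ => by ring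
  have h' : ∀ t, ∑ l, (∑ j, c t j * Q j l) * w l = ∑ j, c t j * ∑ l, Q j l * w l := fun t => by
    simp only [Finset.sum_mul, Finset.mul_sum]
    rw [Finset.sum_comm]
    exact Finset.sum_congr rfl fun j _ => Finset.sum_congr rfl fun l _ => by ring
  simp only [h]
  rw [sum_contract P (fun t l => ∑ j, c t j * Q j l)]
  refine Finset.sum_congr rfl fun t _ => ?_
  rw [h', Finset.mul_sum]
  exact Finset.sum_congr rfl fun j _ => by ring

lemma sum_swap (G : Fin n → Fin n → ℂ) (v : Fin n → ℂ) :
    ∑ r, ∑ h, G h r * (v r * v h) = ∑ r, ∑ h, G r h * (v r * v h) := by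
  rw [Finset.sum_comm]
  exact Finset.sum_congr rfl fun r _ => Finset.sum_congr rfl fun h _ => by ring

end Sums

/-! ### Contraction of the coefficients R with z and with ξ -/

section Coefficients

variable {n : ℕ} (B : Cn n → Matrix (Fin n) (Fin n) ℂ)

lemma linB_eq (k l : Fin n) (z : Cn n) : linB B k l z = ∑ r, B₁ B r k l * z r := rfl

lemma conj_linB (k l : Fin n) (z : Cn n) :
    conj (linB B k l z) = ∑ r, conj (B₁ B r k l) * conj (z r) := by
  simp [linB_eq]

lemma linDbarB_eq (t k l : Fin n) (z : Cn n) : linDbarB B t k l z = ∑ r, B₁₁ B r t k l * z r := rfl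

lemma conj_linDbarB (t k l : Fin n) (z : Cn n) :
    conj (linDbarB B t k l z) = ∑ r, conj (B₁₁ B r t k l) * conj (z r) := by
  simp [linDbarB_eq]

lemma quadB_eq (k l : Fin n) (z : Cn n) :
    quadB B k l z = ∑ r, ∑ h, (B₂ B r h k l * z r * z h + B₁₁ B r h k l * z r * conj (z h)) := rfl

/-- The coefficient 2 restores the full mixed derivative, because `B₁₂` carries a ½. Conjugation
turns z_r z̄_h into z̄_r z_h, and renaming indices puts h before r in `B₁₂`. -/
lemma conj_quadDbarB (t k l : Fin n) (z : Cn n) : conj (quadDbarB B t k l z) =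
    ∑ r, ∑ h, (conj (B₂₁ B r h t k l) * conj (z r) * conj (z h) +
      2 * conj (B₁₂ B h r t k l) * z r * conj (z h)) := by
  have h1 : quadDbarB B t k l z = ∑ r, ∑ h, B₂₁ B r h t k l * z r * z h +
      ∑ r, ∑ h, 2 * B₁₂ B r h t k l * z r * conj (z h) := by
    simp only [← Finset.sum_add_distrib, quadDbarB, jetQuad]
    refine Finset.sum_congr rfl fun r _ => Finset.sum_congr rfl fun h _ => ?_
    simp only [B₂₁, B₁₂, iterWirt, List.foldr]
    ring
  have h2 : ∑ r, ∑ h, 2 * B₁₂ B r h t k l * z r * conj (z h) =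
      ∑ h, ∑ r, 2 * B₁₂ B r h t k l * z r * conj (z h) := Finset.sum_comm
  rw [h1, h2]
  simp only [map_add, map_sum, map_mul, Complex.conj_conj, map_ofNat, Finset.sum_add_distrib]
  congr 1
  exact Finset.sum_congr rfl fun r _ => Finset.sum_congr rfl fun h _ => by ring

/-- The symmetrization in (r, h) is invisible after multiplication by z_r z_h, so pairs of terms
merge and 1/8 becomes 1/4; the symmetrization in (k, l) remains. -/
lemma Rkl_eq (k l s : Fin n) (z : Cn n) : Rkl B k l s z =
    Complex.I / 4 * (∑ t, ∑ j, conj (B₁ B t s j) * (linB B t k z * linB B j l z) +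
      ∑ t, ∑ j, conj (B₁ B t s j) * (linB B t l z * linB B j k z)) -
    (1 / 2 : ℂ) * (∑ t, linB B t l z * conj (linDbarB B k s t z) +
      ∑ t, linB B t k z * conj (linDbarB B l s t z)) := by
  have e1 : ∀ k l, ∑ r, ∑ h, (∑ t, ∑ j, conj (B₁ B t s j) * (B₁ B r t k * B₁ B h j l)) *
      (z r * z h) = ∑ t, ∑ j, conj (B₁ B t s j) * (linB B t k z * linB B j l z) := fun k l =>
    sum_contract₂ (fun t j => conj (B₁ B t s j)) (fun t r => B₁ B r t k) (fun j h => B₁ B h j l) z z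
  have e2 : ∀ k l, ∑ r, ∑ h, (∑ t, ∑ j, conj (B₁ B t s j) * (B₁ B h t k * B₁ B r j l)) *
      (z r * z h) = ∑ t, ∑ j, conj (B₁ B t s j) * (linB B t k z * linB B j l z) := fun k l => by
    rw [← e1]
    exact sum_swap (fun r h => ∑ t, ∑ j, conj (B₁ B t s j) * (B₁ B r t k * B₁ B h j l)) z
  have e3 : ∀ k l, ∑ r, ∑ h, (∑ t, B₁ B r t l * conj (B₁₁ B h k s t)) * (z r * conj (z h)) =
      ∑ t, linB B t l z * conj (linDbarB B k s t z) := fun k l => by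
    simp only [conj_linDbarB]
    exact sum_contract (fun t r => B₁ B r t l) (fun t h => conj (B₁₁ B h k s t)) z
      (fun h => conj (z h))
  have : Rkl B k l s z = ∑ r, ∑ h, (Complex.I / 8 *
      ((∑ t, ∑ j, conj (B₁ B t s j) * (B₁ B r t k * B₁ B h j l)) * (z r * z h) +
      (∑ t, ∑ j, conj (B₁ B t s j) * (B₁ B h t k * B₁ B r j l)) * (z r * z h) +
      (∑ t, ∑ j, conj (B₁ B t s j) * (B₁ B r t l * B₁ B h j k)) * (z r * z h) +
      (∑ t, ∑ j, conj (B₁ B t s j) * (B₁ B h t l * B₁ B r j k)) * (z r * z h)) - (1 / 2 : ℂ) *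
      ((∑ t, B₁ B r t l * conj (B₁₁ B h k s t)) * (z r * conj (z h)) +
      (∑ t, B₁ B r t k * conj (B₁₁ B h l s t)) * (z r * conj (z h)))) := by
    refine Finset.sum_congr rfl fun r _ => Finset.sum_congr rfl fun h _ => ?_
    simp only [Rkl_rh, Rkl_rhbar, mul_add, Finset.sum_add_distrib,
      mul_comm (conj (B₁₁ B _ _ _ _))]
    ring
  rw [this]
  simp only [Finset.sum_sub_distrib, ← Finset.mul_sum, Finset.sum_add_distrib, e1, e2, e3]
  ring

/-- The mixed coefficients regroup by which jet they use. The z and z̄ parts of `linDB` come from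
different coefficients, as do the two kinds of monomials in `quadB`. -/
lemma Rklbar_eq (k l s : Fin n) (z : Cn n) : Rklbar B k l s z =
    ∑ t, linB B t k z * conj (B₁ B t s l) +
    2 * Complex.I * conj (linDbarB B k s l z + quadDbarB B k s l z) +
    (∑ t, linB B t k z * conj (linDB B t s l z) + ∑ t, quadB B t k z * conj (B₁ B t s l) +
      ∑ t, linDbarB B l t k z * conj (linB B s t z)) +
    Complex.I / 2 * ∑ t, ∑ j, (B₁ B t j k - B₁ B k j t) *
      (conj (linB B t l z) * conj (linB B s j z)) := by
  have a1 : ∑ r, ∑ t, B₁ B r t k * conj (B₁ B t s l) * z r =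
      ∑ t, linB B t k z * conj (B₁ B t s l) := by
    rw [Finset.sum_comm]
    simp only [linB_eq, Finset.sum_mul]
    exact Finset.sum_congr rfl fun t _ => Finset.sum_congr rfl fun r _ => by ring
  have a2 : ∑ r, 2 * Complex.I * conj (B₁₁ B r k s l) * conj (z r) =
      2 * Complex.I * conj (linDbarB B k s l z) := by
    simp only [conj_linDbarB, mul_assoc, Finset.mul_sum]
  have b1 : ∑ r, ∑ h, (∑ t, B₁ B r t k * conj (B₁₁ B t h s l)) * (z r * z h) =
      ∑ t, linB B t k z * ∑ h, conj (B₁₁ B t h s l) * z h :=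
    sum_contract (fun t r => B₁ B r t k) (fun t h => conj (B₁₁ B t h s l)) z z
  have b2 : ∑ r, ∑ h, (∑ t, B₁ B h t k * conj (B₁₁ B t r s l)) * (z r * z h) =
      ∑ t, linB B t k z * ∑ h, conj (B₁₁ B t h s l) * z h := by
    rw [← b1]
    exact sum_swap (fun r h => ∑ t, B₁ B r t k * conj (B₁₁ B t h s l)) z
  have b4 : ∑ r, ∑ h, (∑ t, B₁ B r t k * conj (2 * B₂ B t h s l)) * (z r * conj (z h)) =
      ∑ t, linB B t k z * ∑ h, conj (2 * B₂ B t h s l) * conj (z h) :=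
    sum_contract (fun t r => B₁ B r t k) (fun t h => conj (2 * B₂ B t h s l)) z
      fun h => conj (z h)
  have b14 : ∑ t, linB B t k z * conj (linDB B t s l z) =
      ∑ t, linB B t k z * ∑ h, conj (2 * B₂ B t h s l) * conj (z h) +
      ∑ t, linB B t k z * ∑ h, conj (B₁₁ B t h s l) * z h := by
    simp only [← Finset.sum_add_distrib, ← mul_add]
    refine Finset.sum_congr rfl fun t _ => ?_
    simp only [linDB, map_sum, map_add, map_mul, Complex.conj_conj]
  have b3 : ∑ r, ∑ h, ((∑ t, B₂ B r h t k * conj (B₁ B t s l)) * (z r * z h) +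
      (∑ t, B₁₁ B r h t k * conj (B₁ B t s l)) * (z r * conj (z h))) =
      ∑ t, quadB B t k z * conj (B₁ B t s l) := by
    simp only [quadB_eq, Finset.sum_mul, ← Finset.sum_add_distrib]
    conv_rhs => rw [Finset.sum_comm]
    refine Finset.sum_congr rfl fun r _ => ?_
    rw [Finset.sum_comm]
    exact Finset.sum_congr rfl fun h _ => Finset.sum_congr rfl fun t _ => by ring
  have b5 : ∑ r, ∑ h, (∑ t, B₁₁ B r l t k * conj (B₁ B h s t)) * (z r * conj (z h)) =
      ∑ t, linDbarB B l t k z * conj (linB B s t z) := by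
    simp only [conj_linB]
    exact sum_contract (fun t r => B₁₁ B r l t k) (fun t h => conj (B₁ B h s t)) z
      fun h => conj (z h)
  have c1 : ∑ r, ∑ h, (∑ t, ∑ j, (B₁ B t j k - B₁ B k j t) *
      (conj (B₁ B r t l) * conj (B₁ B h s j))) * (conj (z r) * conj (z h)) =
      ∑ t, ∑ j, (B₁ B t j k - B₁ B k j t) * (conj (linB B t l z) * conj (linB B s j z)) := by
    simp only [conj_linB]
    exact sum_contract₂ (fun t j => B₁ B t j k - B₁ B k j t) (fun t r => conj (B₁ B r t l))
      (fun j h => conj (B₁ B h s j)) (fun r => conj (z r)) fun h => conj (z h)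
  have c2 : ∑ r, ∑ h, (∑ t, ∑ j, (B₁ B t j k - B₁ B k j t) *
      (conj (B₁ B h t l) * conj (B₁ B r s j))) * (conj (z r) * conj (z h)) =
      ∑ t, ∑ j, (B₁ B t j k - B₁ B k j t) * (conj (linB B t l z) * conj (linB B s j z)) := by
    rw [← c1]
    exact sum_swap (fun r h => ∑ t, ∑ j, (B₁ B t j k - B₁ B k j t) *
      (conj (B₁ B r t l) * conj (B₁ B h s j))) fun r => conj (z r)
  have hsum : ∀ r h, (Rklbar_rh B k l s r h * z r * z h +
      Rklbar_rhbar B k l s r h * z r * conj (z h) +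
      Rklbar_rbarhbar B k l s r h * conj (z r) * conj (z h)) =
      (1 / 2 : ℂ) * ((∑ t, B₁ B r t k * conj (B₁₁ B t h s l)) * (z r * z h) +
        (∑ t, B₁ B h t k * conj (B₁₁ B t r s l)) * (z r * z h)) +
      ((∑ t, B₂ B r h t k * conj (B₁ B t s l)) * (z r * z h) +
        (∑ t, B₁₁ B r h t k * conj (B₁ B t s l)) * (z r * conj (z h))) +
      (∑ t, B₁ B r t k * conj (2 * B₂ B t h s l)) * (z r * conj (z h)) +
      (∑ t, B₁₁ B r l t k * conj (B₁ B h s t)) * (z r * conj (z h)) +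
      2 * Complex.I * (conj (B₂₁ B r h k s l) * conj (z r) * conj (z h) +
        2 * conj (B₁₂ B h r k s l) * z r * conj (z h)) +
      Complex.I / 4 * ((∑ t, ∑ j, (B₁ B t j k - B₁ B k j t) *
        (conj (B₁ B r t l) * conj (B₁ B h s j))) * (conj (z r) * conj (z h)) +
        (∑ t, ∑ j, (B₁ B t j k - B₁ B k j t) *
        (conj (B₁ B h t l) * conj (B₁ B r s j))) * (conj (z r) * conj (z h))) := fun r h => by
    have d1 : ∀ t, 2 * B₂ B r h t k * conj (B₁ B t s l) =
      2 * (B₂ B r h t k * conj (B₁ B t s l)) := fun t => by ring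
    have d2 : ∀ t, 2 * B₁ B r t k * conj (B₂ B t h s l) =
      B₁ B r t k * conj (2 * B₂ B t h s l) := fun t => by
        simp only [map_mul, map_ofNat]; ring
    have d3 : ∀ t j, (conj (B₁ B r t l) * conj (B₁ B h s j) +
      conj (B₁ B h t l) * conj (B₁ B r s j)) * (B₁ B t j k - B₁ B k j t) =
      (B₁ B t j k - B₁ B k j t) * (conj (B₁ B r t l) * conj (B₁ B h s j)) +
      (B₁ B t j k - B₁ B k j t) * (conj (B₁ B h t l) * conj (B₁ B r s j)) := fun t j => by ring
    simp only [Rklbar_rh, Rklbar_rhbar, Rklbar_rbarhbar, d1, d2, d3, Finset.sum_add_distrib,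
      ← Finset.mul_sum]
    ring
  rw [Rklbar]
  simp only [hsum, Finset.sum_add_distrib (f := fun r => ∑ t, B₁ B r t k * conj (B₁ B t s l) * z r),
    a1, a2]
  rw [b14, map_add, conj_quadDbarB, ← b3]
  simp only [Finset.sum_add_distrib, ← Finset.mul_sum, b1, b2, b4, b5, c1, c2]
  ring

lemma Rkbarlbar_eq (k l s : Fin n) (z : Cn n) : Rkbarlbar B k l s z =
    -(Complex.I / 4) * (∑ t, (∑ j, linB B t j z * conj (linB B j k z)) * conj (B₁ B t s l) +
      ∑ t, (∑ j, linB B t j z * conj (linB B j l z)) * conj (B₁ B t s k)) +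
    (1 / 2 : ℂ) * (∑ t, conj (linB B t k z) * conj (linDbarB B t s l z) +
      ∑ t, conj (linB B t l z) * conj (linDbarB B t s k z)) := by
  have e0 : ∀ k t, ∑ r, ∑ h, (∑ j, B₁ B r t j * conj (B₁ B h j k)) * (z r * conj (z h)) =
      ∑ j, linB B t j z * conj (linB B j k z) := fun k t => by
    simp only [conj_linB]
    exact sum_contract (fun j r => B₁ B r t j) (fun j h => conj (B₁ B h j k)) z
      fun h => conj (z h)
  have e1 : ∀ k l, ∑ r, ∑ h, (∑ t, ∑ j, B₁ B r t j * (conj (B₁ B h j k) * conj (B₁ B t s l))) *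
      (z r * conj (z h)) =
      ∑ t, (∑ j, linB B t j z * conj (linB B j k z)) * conj (B₁ B t s l) := fun k l => by
    simp only [← e0, Finset.sum_mul]
    conv_rhs => rw [Finset.sum_comm]
    refine Finset.sum_congr rfl fun r _ => ?_
    conv_rhs => rw [Finset.sum_comm]
    refine Finset.sum_congr rfl fun h _ => Finset.sum_congr rfl fun t _ =>
      Finset.sum_congr rfl fun j _ => by ring
  have e3 : ∀ k l, ∑ r, ∑ h, (∑ t, conj (B₁ B r t k) * conj (B₁₁ B h t s l)) *
      (conj (z r) * conj (z h)) =
      ∑ t, conj (linB B t k z) * conj (linDbarB B t s l z) := fun k l => by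
    simp only [conj_linB, conj_linDbarB]
    exact sum_contract (fun t r => conj (B₁ B r t k)) (fun t h => conj (B₁₁ B h t s l))
      (fun h => conj (z h)) fun h => conj (z h)
  have e4 : ∀ k l, ∑ r, ∑ h, (∑ t, conj (B₁ B h t k) * conj (B₁₁ B r t s l)) *
      (conj (z r) * conj (z h)) =
      ∑ t, conj (linB B t k z) * conj (linDbarB B t s l z) := fun k l => by
    rw [← e3]
    exact sum_swap (fun r h => ∑ t, conj (B₁ B r t k) * conj (B₁₁ B h t s l)) fun r => conj (z r)
  have : Rkbarlbar B k l s z = ∑ r, ∑ h, (-(Complex.I / 4) *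
      ((∑ t, ∑ j, B₁ B r t j * (conj (B₁ B h j k) * conj (B₁ B t s l))) * (z r * conj (z h)) +
      (∑ t, ∑ j, B₁ B r t j * (conj (B₁ B h j l) * conj (B₁ B t s k))) * (z r * conj (z h))) +
      (1 / 4 : ℂ) *
      ((∑ t, conj (B₁ B r t k) * conj (B₁₁ B h t s l)) * (conj (z r) * conj (z h)) +
      (∑ t, conj (B₁ B h t k) * conj (B₁₁ B r t s l)) * (conj (z r) * conj (z h)) +
      (∑ t, conj (B₁ B r t l) * conj (B₁₁ B h t s k)) * (conj (z r) * conj (z h)) +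
      (∑ t, conj (B₁ B h t l) * conj (B₁₁ B r t s k)) * (conj (z r) * conj (z h)))) := by
    refine Finset.sum_congr rfl fun r _ => Finset.sum_congr rfl fun h _ => ?_
    simp only [Rkbarlbar_rhbar, Rkbarlbar_rbarhbar, mul_add, Finset.sum_add_distrib]
    ring
  rw [this]
  simp only [← Finset.mul_sum, Finset.sum_add_distrib, e1, e3, e4]
  ring

lemma conj_evLin (k : Fin n) (z v : Cn n) :
    conj (evLin B k z v) = ∑ l, conj (linB B k l z) * conj (v l) := by
  simp [evLin]

/-- Contraction with v_k v_l merges the terms symmetrized in (k, l), just as contraction with z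
merged those in (r, h). -/
lemma sum_Rkl (s : Fin n) (z v : Cn n) : ∑ k, ∑ l, Rkl B k l s z * (v k * v l) =
    Complex.I / 2 * ∑ t, ∑ j, conj (B₁ B t s j) * (evLin B t z v * evLin B j z v) -
      ∑ k, ∑ t, conj (linDbarB B k s t z) * (v k * evLin B t z v) := by
  have e1 : ∑ k, ∑ l, (∑ t, ∑ j, conj (B₁ B t s j) * (linB B t k z * linB B j l z)) *
      (v k * v l) = ∑ t, ∑ j, conj (B₁ B t s j) * (evLin B t z v * evLin B j z v) :=
    sum_contract₂ (fun t j => conj (B₁ B t s j)) (fun t k => linB B t k z)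
      (fun j l => linB B j l z) v v
  have e2 : ∑ k, ∑ l, (∑ t, ∑ j, conj (B₁ B t s j) * (linB B t l z * linB B j k z)) *
      (v k * v l) = ∑ t, ∑ j, conj (B₁ B t s j) * (evLin B t z v * evLin B j z v) := by
    rw [← e1]
    exact sum_swap (fun k l => ∑ t, ∑ j, conj (B₁ B t s j) * (linB B t k z * linB B j l z)) v
  have e3 : ∑ k, ∑ l, (∑ t, linB B t k z * conj (linDbarB B l s t z)) * (v k * v l) =
      ∑ k, ∑ t, conj (linDbarB B k s t z) * (v k * evLin B t z v) := by
    rw [sum_contract (fun t k => linB B t k z) (fun t l => conj (linDbarB B l s t z)) v v]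
    conv_rhs => rw [Finset.sum_comm]
    refine Finset.sum_congr rfl fun t _ => ?_
    rw [Finset.mul_sum]
    exact Finset.sum_congr rfl fun k _ => by rw [evLin]; ring
  have e4 : ∑ k, ∑ l, (∑ t, linB B t l z * conj (linDbarB B k s t z)) * (v k * v l) =
      ∑ k, ∑ t, conj (linDbarB B k s t z) * (v k * evLin B t z v) := by
    rw [← e3]
    exact sum_swap (fun k l => ∑ t, linB B t k z * conj (linDbarB B l s t z)) v
  have : ∀ k l, Rkl B k l s z * (v k * v l) = Complex.I / 4 *
      ((∑ t, ∑ j, conj (B₁ B t s j) * (linB B t k z * linB B j l z)) * (v k * v l) +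
      (∑ t, ∑ j, conj (B₁ B t s j) * (linB B t l z * linB B j k z)) * (v k * v l)) -
      (1 / 2 : ℂ) * ((∑ t, linB B t l z * conj (linDbarB B k s t z)) * (v k * v l) +
      (∑ t, linB B t k z * conj (linDbarB B l s t z)) * (v k * v l)) := fun k l => by
    rw [Rkl_eq]; ring
  simp only [this, Finset.sum_sub_distrib, Finset.sum_add_distrib, ← Finset.mul_sum, e1, e2, e3,
    e4]
  ring

lemma sum_Rklbar (s : Fin n) (z v : Cn n) : ∑ k, ∑ l, Rklbar B k l s z * (v k * conj (v l)) =
    ∑ t, ∑ l, conj (B₁ B t s l) * (evQuad B t z v * conj (v l)) +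
    2 * Complex.I * ∑ k, ∑ l, conj (linDbarB B k s l z + quadDbarB B k s l z) *
      (v k * conj (v l)) +
    ∑ t, ∑ l, conj (linDB B t s l z) * (evLin B t z v * conj (v l)) +
    ∑ l, ∑ k, (∑ t, conj (linB B s t z) * linDbarB B l t k z) * (conj (v l) * v k) +
    Complex.I / 2 * ∑ k, ∑ t, (∑ j, conj (linB B s j z) * B₁ B t j k) *
      (conj (evLin B t z v) * v k) -
    Complex.I / 2 * ∑ k, ∑ t, (∑ j, conj (linB B s j z) * B₁ B k j t) *
      (v k * conj (evLin B t z v)) := by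
  have e1 : ∑ k, ∑ l, (∑ t, (linB B t k z + quadB B t k z) * conj (B₁ B t s l)) *
      (v k * conj (v l)) = ∑ t, ∑ l, conj (B₁ B t s l) * (evQuad B t z v * conj (v l)) := by
    rw [sum_contract (fun t k => linB B t k z + quadB B t k z) (fun t l => conj (B₁ B t s l)) v
      fun l => conj (v l)]
    refine Finset.sum_congr rfl fun t _ => ?_
    rw [Finset.mul_sum]
    exact Finset.sum_congr rfl fun l _ => by rw [evQuad]; ring
  have e2 : ∑ k, ∑ l, (∑ t, linB B t k z * conj (linDB B t s l z)) * (v k * conj (v l)) =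
      ∑ t, ∑ l, conj (linDB B t s l z) * (evLin B t z v * conj (v l)) := by
    rw [sum_contract (fun t k => linB B t k z) (fun t l => conj (linDB B t s l z)) v
      fun l => conj (v l)]
    refine Finset.sum_congr rfl fun t _ => ?_
    rw [Finset.mul_sum]
    exact Finset.sum_congr rfl fun l _ => by rw [evLin]; ring
  have e3 : ∑ k, ∑ l, (∑ t, linDbarB B l t k z * conj (linB B s t z)) * (v k * conj (v l)) =
      ∑ l, ∑ k, (∑ t, conj (linB B s t z) * linDbarB B l t k z) * (conj (v l) * v k) := by
    rw [Finset.sum_comm]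
    simp only [mul_comm (linDbarB B _ _ _ _), mul_comm (v _)]
  have e4 : ∀ F : Fin n → Fin n → Fin n → ℂ, ∑ k, ∑ l, (∑ t, ∑ j, F t j k *
      (conj (linB B t l z) * conj (linB B s j z))) * (v k * conj (v l)) =
      ∑ k, ∑ t, (∑ j, conj (linB B s j z) * F t j k) * (v k * conj (evLin B t z v)) := fun F => by
    refine Finset.sum_congr rfl fun k _ => ?_
    simp only [conj_evLin, Finset.mul_sum, Finset.sum_mul]
    rw [Finset.sum_comm]
    refine Finset.sum_congr rfl fun t _ => ?_
    refine Finset.sum_congr rfl fun l _ => Finset.sum_congr rfl fun j _ => by ring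
  have e5 := e4 fun t j k => B₁ B t j k
  have e6 := e4 fun t j k => B₁ B k j t
  have : ∀ k l, Rklbar B k l s z * (v k * conj (v l)) =
      (∑ t, (linB B t k z + quadB B t k z) * conj (B₁ B t s l)) * (v k * conj (v l)) +
      2 * Complex.I * (conj (linDbarB B k s l z + quadDbarB B k s l z) * (v k * conj (v l))) +
      (∑ t, linB B t k z * conj (linDB B t s l z)) * (v k * conj (v l)) +
      (∑ t, linDbarB B l t k z * conj (linB B s t z)) * (v k * conj (v l)) +
      Complex.I / 2 * ((∑ t, ∑ j, B₁ B t j k * (conj (linB B t l z) * conj (linB B s j z))) *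
        (v k * conj (v l))) -
      Complex.I / 2 * ((∑ t, ∑ j, B₁ B k j t * (conj (linB B t l z) * conj (linB B s j z))) *
        (v k * conj (v l))) := fun k l => by
    rw [Rklbar_eq]
    simp only [add_mul, sub_mul, Finset.sum_add_distrib, Finset.sum_sub_distrib]
    ring
  simp only [this, Finset.sum_sub_distrib, Finset.sum_add_distrib, ← Finset.mul_sum, e1, e2, e3,
    e5, e6, mul_comm (conj (evLin B _ z v))]

lemma sum_Rkbarlbar (s : Fin n) (z v : Cn n) :
    ∑ k, ∑ l, Rkbarlbar B k l s z * (conj (v k) * conj (v l)) =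
    -(Complex.I / 2) * ∑ t, ∑ l, conj (B₁ B t s l) *
      ((∑ j, linB B t j z * conj (evLin B j z v)) * conj (v l)) +
    ∑ t, ∑ l, conj (linDbarB B t s l z) * (conj (evLin B t z v) * conj (v l)) := by
  have e1 : ∑ k, ∑ l, (∑ t, (∑ j, linB B t j z * conj (linB B j k z)) * conj (B₁ B t s l)) *
      (conj (v k) * conj (v l)) = ∑ t, ∑ l, conj (B₁ B t s l) *
      ((∑ j, linB B t j z * conj (evLin B j z v)) * conj (v l)) := by
    rw [sum_contract (fun t k => ∑ j, linB B t j z * conj (linB B j k z))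
      (fun t l => conj (B₁ B t s l)) (fun k => conj (v k)) fun l => conj (v l)]
    refine Finset.sum_congr rfl fun t _ => ?_
    have : ∑ k, (∑ j, linB B t j z * conj (linB B j k z)) * conj (v k) =
        ∑ j, linB B t j z * conj (evLin B j z v) := by
      simp only [conj_evLin, Finset.sum_mul, Finset.mul_sum]
      rw [Finset.sum_comm]
      exact Finset.sum_congr rfl fun j _ => Finset.sum_congr rfl fun l _ => by ring
    rw [this, Finset.mul_sum]
    exact Finset.sum_congr rfl fun l _ => by ring
  have e2 : ∑ k, ∑ l, (∑ t, conj (linB B t k z) * conj (linDbarB B t s l z)) *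
      (conj (v k) * conj (v l)) =
      ∑ t, ∑ l, conj (linDbarB B t s l z) * (conj (evLin B t z v) * conj (v l)) := by
    rw [sum_contract (fun t k => conj (linB B t k z)) (fun t l => conj (linDbarB B t s l z))
      (fun k => conj (v k)) fun l => conj (v l)]
    refine Finset.sum_congr rfl fun t _ => ?_
    rw [Finset.mul_sum, conj_evLin]
    exact Finset.sum_congr rfl fun l _ => by ring
  have e3 := sum_swap (fun k l => ∑ t, (∑ j, linB B t j z * conj (linB B j k z)) *
    conj (B₁ B t s l)) fun k => conj (v k)
  have e4 := sum_swap (fun k l => ∑ t, conj (linB B t k z) * conj (linDbarB B t s l z))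
    fun k => conj (v k)
  have : ∀ k l, Rkbarlbar B k l s z * (conj (v k) * conj (v l)) =
      -(Complex.I / 4) * ((∑ t, (∑ j, linB B t j z * conj (linB B j k z)) * conj (B₁ B t s l)) *
        (conj (v k) * conj (v l)) +
      (∑ t, (∑ j, linB B t j z * conj (linB B j l z)) * conj (B₁ B t s k)) *
        (conj (v k) * conj (v l))) +
      (1 / 2 : ℂ) * ((∑ t, conj (linB B t k z) * conj (linDbarB B t s l z)) *
        (conj (v k) * conj (v l)) +
      (∑ t, conj (linB B t l z) * conj (linDbarB B t s k z)) *
        (conj (v k) * conj (v l))) := fun k l => by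
    rw [Rkbarlbar_eq]; ring
  simp only [this, Finset.sum_add_distrib, ← Finset.mul_sum, e1, e2, e3, e4]
  ring

/-- Both sides are reduced to sums in `evLin`, `evQuad` and the jets of B. Beyond relabelling of
indices there is one cancellation, between the derivative of A and the deviation of A from i. -/
theorem firstOrderJet_eq (s : Fin n) (z v : Cn n) : firstOrderJet B s z v = ∑ k, ∑ l,
    (Rkl B k l s z * v k * v l + Rklbar B k l s z * v k * conj (v l) +
      Rkbarlbar B k l s z * conj (v k) * conj (v l)) := by
  have h1 : ∑ k, ∑ l, (∑ j, conj (B₁ B k s j) * linB B j l z) * (evLin B k z v * v l) =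
      ∑ t, ∑ j, conj (B₁ B t s j) * (evLin B t z v * evLin B j z v) := by
    refine Finset.sum_congr rfl fun k _ => ?_
    simp only [Finset.sum_mul]
    rw [Finset.sum_comm]
    refine Finset.sum_congr rfl fun j _ => ?_
    rw [evLin.eq_1 B j, Finset.mul_sum, Finset.mul_sum]
    exact Finset.sum_congr rfl fun l _ => by ring
  -- These sums in v̄_k and the conjugate of `evLin` occur with coefficients -i/2 and +i/2, and
  -- leave no trace in R.
  have h2 : ∑ k, ∑ l, (∑ j, conj (B₁ B k s j) * linB B j l z) *
      (conj (v k) * conj (evLin B l z v)) =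
      ∑ k, ∑ l, conj (B₁ B k s l) * (conj (v k) * ∑ j, linB B l j z * conj (evLin B j z v)) := by
    refine Finset.sum_congr rfl fun k _ => ?_
    simp only [Finset.sum_mul, Finset.mul_sum]
    rw [Finset.sum_comm]
    exact Finset.sum_congr rfl fun j _ => Finset.sum_congr rfl fun l _ => by ring
  have h3 : ∑ k, ∑ l, (∑ j, conj (linB B s j z) * B₁ B k j l) * (conj (evLin B k z v) * v l) =
      ∑ k, ∑ t, (∑ j, conj (linB B s j z) * B₁ B t j k) * (conj (evLin B t z v) * v k) :=
    Finset.sum_comm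
  have hR : ∑ k, ∑ l, (Rkl B k l s z * v k * v l + Rklbar B k l s z * v k * conj (v l) +
      Rkbarlbar B k l s z * conj (v k) * conj (v l)) =
      ∑ k, ∑ l, Rkl B k l s z * (v k * v l) + ∑ k, ∑ l, Rklbar B k l s z * (v k * conj (v l)) +
      ∑ k, ∑ l, Rkbarlbar B k l s z * (conj (v k) * conj (v l)) := by
    simp only [Finset.sum_add_distrib, mul_assoc]
  have hL : firstOrderJet B s z v =
      Complex.I / 2 * (∑ k, ∑ l, (∑ j, conj (linB B s j z) * B₁ B k j l) *
        (conj (evLin B k z v) * v l) - ∑ k, ∑ l, (∑ j, conj (linB B s j z) * B₁ B k j l) *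
        (v k * conj (evLin B l z v))) +
      ∑ k, ∑ l, (∑ j, conj (linB B s j z) * linDbarB B k j l z) * (conj (v k) * v l) +
      Complex.I / 2 * (∑ k, ∑ l, (∑ j, conj (B₁ B k s j) * linB B j l z) *
        (evLin B k z v * v l) - ∑ k, ∑ l, (∑ j, conj (B₁ B k s j) * linB B j l z) *
        (conj (v k) * conj (evLin B l z v))) +
      2 * Complex.I * ∑ k, ∑ l, conj (linDbarB B k s l z + quadDbarB B k s l z) *
        (v k * conj (v l)) +
      (∑ k, ∑ l, conj (linDbarB B k s l z) * (conj (evLin B k z v) * conj (v l)) -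
        ∑ k, ∑ l, conj (linDbarB B k s l z) * (v k * evLin B l z v)) +
      (∑ k, ∑ l, conj (B₁ B k s l) * (evQuad B k z v * conj (v l)) +
        ∑ k, ∑ l, conj (linDB B k s l z) * (evLin B k z v * conj (v l))) -
      Complex.I / 2 * (∑ k, ∑ l, conj (B₁ B k s l) *
        ((∑ j, linB B k j z * conj (evLin B j z v)) * conj (v l)) -
        ∑ k, ∑ l, conj (B₁ B k s l) *
          (conj (v k) * ∑ j, linB B l j z * conj (evLin B j z v))) := by
    have hm : ∀ (a : ℂ) (F : Fin n → Fin n → ℂ), a * ∑ k, ∑ l, F k l = ∑ k, ∑ l, a * F k l :=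
      fun a F => by simp only [Finset.mul_sum]
    simp only [firstOrderJet, ← Finset.sum_sub_distrib, hm, ← Finset.sum_add_distrib]
    refine Finset.sum_congr rfl fun k _ => Finset.sum_congr rfl fun l _ => ?_
    ring
  rw [hR, sum_Rkl, sum_Rklbar, sum_Rkbarlbar, hL, h1, h2, h3]
  ring

end Coefficients

/-! ### The structure in terms of its matrices -/

section Matrices

variable {n : ℕ} {U : TopologicalSpace.Opens (Cn n)} {J : Cn n → Cn n →L[ℝ] Cn n}

lemma contDiffOn_apply_apply (hJ : ContDiffOn ℝ ∞ J U) (v : Cn n) (k : Fin n) :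
    ContDiffOn ℝ ∞ (fun z => J z v k) U :=
  contDiffOn_apply (contDiffOn_endo_apply hJ contDiffOn_const) k

lemma contDiffOn_matA (hJ : ContDiffOn ℝ ∞ J U) (k l : Fin n) :
    ContDiffOn ℝ ∞ (fun z => matA (J z) k l) U :=
  contDiffOn_const.mul ((contDiffOn_apply_apply hJ _ k).sub
    (contDiffOn_const.mul (contDiffOn_apply_apply hJ _ k)))

lemma contDiffOn_matB (hJ : ContDiffOn ℝ ∞ J U) (k l : Fin n) :
    ContDiffOn ℝ ∞ (fun z => matB (J z) k l) U :=
  contDiffOn_conj (contDiffOn_const.mul ((contDiffOn_apply_apply hJ _ k).add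
    (contDiffOn_const.mul (contDiffOn_apply_apply hJ _ k))))

lemma apply_single (T : Cn n →L[ℝ] Cn n) (l j : Fin n) (a : ℂ) :
    T (Pi.single l a) j = matA T j l * a + conj (matB T j l) * conj a := by
  rw [apply_eq_matA_matB, Finset.sum_eq_single l]
  · simp
  · intro b _ hb; simp [hb]
  · simp

lemma sum_matA_matB (T : Cn n →L[ℝ] Cn n) (hT : ∀ v, T (T v) = -v) (k l : Fin n) :
    ∑ j, (matA T k j * matA T j l + conj (matB T k j) * matB T j l) =
      -(1 : Matrix (Fin n) (Fin n) ℂ) k l := by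
  have h : ∀ a : ℂ, ∑ j, (matA T k j * (matA T j l * a + conj (matB T j l) * conj a) +
      conj (matB T k j) * conj (matA T j l * a + conj (matB T j l) * conj a)) =
      -((1 : Matrix (Fin n) (Fin n) ℂ) k l * a) := fun a => by
    have := congrFun (hT (Pi.single l a)) k
    rw [apply_eq_matA_matB] at this
    simp only [apply_single] at this
    rw [this, Matrix.one_apply, Pi.neg_apply, Pi.single_apply]
    simp
  have h1 := h 1
  have hI := h Complex.I
  -- J² applied to a·e_l is a real-linear function of a; half of its value at 1 minus i times its
  -- value at i extracts the complex-linear part.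
  have key : ∑ j, (matA T k j * matA T j l + conj (matB T k j) * matB T j l) =
      (1 / 2 : ℂ) * (∑ j, (matA T k j * (matA T j l * 1 + conj (matB T j l) * conj 1) +
      conj (matB T k j) * conj (matA T j l * 1 + conj (matB T j l) * conj 1)) - Complex.I *
      ∑ j, (matA T k j * (matA T j l * Complex.I + conj (matB T j l) * conj Complex.I) +
      conj (matB T k j) * conj (matA T j l * Complex.I + conj (matB T j l) * conj Complex.I))) := by
    rw [Finset.mul_sum, ← Finset.sum_sub_distrib, Finset.mul_sum]
    refine Finset.sum_congr rfl fun j _ => ?_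
    simp only [map_add, map_mul, map_neg, Complex.conj_conj, Complex.conj_I, map_one]
    linear_combination (1 / 2 : ℂ) * (matA T k j * (matA T j l - conj (matB T j l)) +
      conj (matB T k j) * (matB T j l - conj (matA T j l))) * Complex.I_sq
  rw [key, h1, hI]
  linear_combination (1 / 2 : ℂ) * (1 : Matrix (Fin n) (Fin n) ℂ) k l * Complex.I_sq

lemma apply_eq_zeta (z v : Cn n) (k : Fin n) : J z v k = Complex.I * v k +
    zeta (fun z => matA (J z)) (fun z => matB (J z)) k z v := by
  have h : ∀ l, matA (J z) k l * v l = Complex.I * ((1 : Matrix (Fin n) (Fin n) ℂ) k l * v l) +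
      devA (fun z => matA (J z)) k l z * v l := fun l => by rw [devA]; ring
  have h1 : ∑ l, (1 : Matrix (Fin n) (Fin n) ℂ) k l * v l = v k := by simp [Matrix.one_apply]
  rw [apply_eq_matA_matB, zeta, evDev, evB]
  simp only [h, Finset.sum_add_distrib, ← Finset.mul_sum, h1, map_sum, map_mul]
  ring

/-- The derivative of the structure in terms of the matrices. -/
lemma fderiv_endo_apply (hJ : ContDiffOn ℝ ∞ J U) {z : Cn n} (hz : z ∈ U) (w v : Cn n)
    (s : Fin n) : fderiv ℝ J z w v s = ∑ k, ∑ l,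
      (w k * (wirt k (devA (fun z => matA (J z)) s l) z * v l +
        conj (wirtBar k (fun z => matB (J z) s l) z) * conj (v l)) +
      conj (w k) * (wirtBar k (devA (fun z => matA (J z)) s l) z * v l +
        conj (wirt k (fun z => matB (J z) s l) z) * conj (v l))) := by
  have hd : DifferentiableAt ℝ J z :=
    (hJ.contDiffAt (U.isOpen.mem_nhds hz)).differentiableAt (by simp)
  have h1 : fderiv ℝ J z w v s = fderiv ℝ (fun z => J z v s) z w := by
    have h2 := fderiv_xiVar (contDiffOn_endo_apply hJ (contDiffOn_const (c := v))) (.inl s) hz w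
    have h3 : fderiv ℝ (fun z => J z v) z w = fderiv ℝ J z w v := by
      rw [fderiv_clm_apply hd (differentiableAt_const v)]
      simp
    rw [h3] at h2
    exact h2.symm
  have hA := contDiffOn_matA hJ
  have hB := contDiffOn_matB hJ
  have hs : ∀ l ∈ (Finset.univ : Finset (Fin n)), ContDiffOn ℝ ∞ (fun z => v l * matA (J z) s l +
      conj (v l) * conj (matB (J z) s l)) U := fun l _ =>
    (contDiffOn_const.mul (hA s l)).add (contDiffOn_const.mul (contDiffOn_conj (hB s l)))
  have hdev : ∀ c l, wd c (devA (fun z => matA (J z)) s l) z = wd c (fun z => matA (J z) s l) z :=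
    fun c l => by
      have : devA (fun z => matA (J z)) s l = fun z => matA (J z) s l -
        Complex.I * (1 : Matrix (Fin n) (Fin n) ℂ) s l := rfl
      rw [this, wd_sub (hA s l) contDiffOn_const c hz]
      simp
  have h4 : (fun z => J z v s) = fun z => ∑ l, (v l * matA (J z) s l +
      conj (v l) * conj (matB (J z) s l)) := by
    ext z
    rw [apply_eq_matA_matB]
    exact Finset.sum_congr rfl fun l _ => by ring
  have h5 : ∀ c, wd c (fun z => J z v s) z = ∑ l, (wd c (devA (fun z => matA (J z)) s l) z * v l +
      conj (wd c.swap (fun z => matB (J z) s l) z) * conj (v l)) := fun c => by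
    rw [h4, wd_sum _ hs c hz]
    refine Finset.sum_congr rfl fun l _ => ?_
    rw [wd_add (contDiffOn_const.mul (hA s l)) (contDiffOn_const.mul (contDiffOn_conj (hB s l)))
      c hz, wd_const_mul _ (hA s l) c hz, wd_const_mul _ (contDiffOn_conj (hB s l)) c hz,
      wd_conj (hB s l) c hz, hdev]
    ring
  rw [h1, fderiv_eq_sum_wd, Fintype.sum_sum_type]
  simp only [h5, Finset.mul_sum, ← Finset.sum_add_distrib, xiVar, Sum.elim_inl, Sum.elim_inr,
    Sum.swap_inl, Sum.swap_inr, wd_inl, wd_inr]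

/-- Inserting Jv = iv + ζ cancels the terms in v_k v_l and v̄_k v̄_l without ζ; the surviving
leading terms are the mixed ones, with -2i at ∂A/∂z̄ and 2i at the conjugate of ∂B/∂z̄. -/
lemma firstOrderField_apply (hJ : ContDiffOn ℝ ∞ J U) {z : Cn n} (hz : z ∈ U) (v : Cn n)
    (s : Fin n) : firstOrderField J z v s =
      (1 / 2 : ℂ) * firstOrderSum (fun z => matA (J z)) (fun z => matB (J z)) s z v := by
  have h : firstOrderField J z v s =
      (1 / 2 : ℂ) * (fderiv ℝ J z (J z v) v s - fderiv ℝ J z v (J z v) s) := by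
    simp [firstOrderField]
  rw [h, fderiv_endo_apply hJ hz, fderiv_endo_apply hJ hz, ← Finset.sum_sub_distrib, firstOrderSum]
  congr 1
  refine Finset.sum_congr rfl fun k _ => ?_
  rw [← Finset.sum_sub_distrib]
  refine Finset.sum_congr rfl fun l _ => ?_
  simp only [apply_eq_zeta, map_add, map_mul, Complex.conj_I]
  ring

/-- The matrices of an almost complex structure are in normal form if their jets at `0` are. -/
lemma normalForm_of_jets (h0 : 0 ∈ U) (hJ : ContDiffOn ℝ ∞ J U)
    (hJ2 : ∀ z ∈ U, ∀ v, J z (J z v) = -v)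
    (hA : matA (J 0) = Complex.I • (1 : Matrix (Fin n) (Fin n) ℂ))
    (hB : ∀ ss : List (Fin n), ss.length ≤ 3 → ∀ k l,
      iterWirt [] ss (fun z => matB (J z) k l) 0 = 0) :
    NormalForm U (fun z => matA (J z)) (fun z => matB (J z)) where
  mem := h0
  smoothA := contDiffOn_matA hJ
  smoothB := contDiffOn_matB hJ
  sq := fun z hz k l => sum_matA_matB (J z) (hJ2 z hz) k l
  matA_zero := fun k l => by simp [hA]
  matB_zero := fun k l => hB [] (by simp) k l
  wirtBar_zero := fun k l s => hB [s] (by simp) k l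
  wirtBar₂_zero := fun k l s t => hB [s, t] (by simp) k l
  wirtBar₃_zero := fun k l s t r => hB [s, t, r] (by simp) k l

lemma NormalForm.mono {A B : Cn n → Matrix (Fin n) (Fin n) ℂ} (H : NormalForm U A B)
    {V : TopologicalSpace.Opens (Cn n)} (h0 : 0 ∈ V) (hVU : V ≤ U) : NormalForm V A B where
  mem := h0
  smoothA := fun k l => (H.smoothA k l).mono hVU
  smoothB := fun k l => (H.smoothB k l).mono hVU
  sq := fun z hz => H.sq z (hVU hz)
  matA_zero := H.matA_zero
  matB_zero := H.matB_zero
  wirtBar_zero := H.wirtBar_zero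
  wirtBar₂_zero := H.wirtBar₂_zero
  wirtBar₃_zero := H.wirtBar₃_zero

end Matrices

/-! ### The second order coefficients -/

section SecondOrderCoefficients

variable {n : ℕ} {U : TopologicalSpace.Opens (Cn n)} (B : Cn n → Matrix (Fin n) (Fin n) ℂ)

/-- `(jet₂ B) v`. -/
noncomputable def evJet (k : Fin n) (z v : Cn n) : ℂ := ∑ t, jet₂ (fun w => B w k t) z * v t

/-- Here `evJet` keeps the full `jet₂` of B, as in the definition of Q, while the quadratic
corrections use only its linear part. -/
lemma Qmixed_eq (k l : Fin n) (z v : Cn n) : Qmixed B k l z v =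
    2 * Complex.I * (v k * evJet B l z v) +
      ((∑ s, conj (linB B k s z) * evLin B s z v) * conj (v l) +
        conj (evLin B k z v) * evLin B l z v) := by
  have h1 : ∀ s t, ∑ r, ∑ h, conj (B₁ B h k s) *
      (B₁ B r s t * v t * conj (v l) + B₁ B r l t * v t * conj (v s)) * z r * conj (z h) =
      conj (linB B k s z) * (linB B s t z * v t) * conj (v l) +
        (conj (linB B k s z) * conj (v s)) * (linB B l t z * v t) := fun s t => by
    have e : ∀ a : Fin n → ℂ, conj (linB B k s z) * ∑ r, a r * z r =
        ∑ r, ∑ h, conj (B₁ B h k s) * a r * z r * conj (z h) := fun a => by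
      rw [conj_linB, Finset.sum_mul_sum, Finset.sum_comm]
      exact Finset.sum_congr rfl fun r _ => Finset.sum_congr rfl fun h _ => by ring
    have e1 := e fun r => B₁ B r s t * v t * conj (v l) + B₁ B r l t * v t * conj (v s)
    rw [← e1]
    have : ∑ r, (B₁ B r s t * v t * conj (v l) + B₁ B r l t * v t * conj (v s)) * z r =
        linB B s t z * (v t * conj (v l)) + linB B l t z * (v t * conj (v s)) := by
      rw [linB_eq, linB_eq, Finset.sum_mul, Finset.sum_mul, ← Finset.sum_add_distrib]
      exact Finset.sum_congr rfl fun r _ => by ring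
    rw [this]
    ring
  rw [Qmixed]
  simp only [h1, Finset.sum_add_distrib]
  rw [evJet, conj_evLin, evLin, Finset.sum_mul_sum, Finset.sum_mul, Finset.mul_sum, Finset.mul_sum,
    Finset.mul_sum]
  simp only [evLin, Finset.mul_sum, Finset.sum_mul]
  congr 1
  exact Finset.sum_congr rfl fun t _ => by ring

lemma Qholo_eq (k l : Fin n) (z v : Cn n) : Qholo B k l z v =
    Complex.I * (conj (evJet B k z v) * v l + conj (evJet B l z v) * v k) -
      (1 / 2 : ℂ) * ((∑ s, conj (linB B k s z) * evLin B s z v) * v l +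
        (∑ s, conj (linB B l s z) * evLin B s z v) * v k) +
      conj (evLin B k z v) * conj (evLin B l z v) := by
  have h1 : ∀ s t, ∑ r, ∑ h,
      ((1 / 2 : ℂ) * (conj (B₁ B h k s) * v l * v t + conj (B₁ B h l s) * v k * v t) *
          B₁ B r s t * z r * conj (z h) -
        conj (B₁ B r k s) * conj (B₁ B h l t) * conj (z r) * conj (z h) *
          conj (v s) * conj (v t)) =
      (1 / 2 : ℂ) * (conj (linB B k s z) * (linB B s t z * v t) * v l +
        conj (linB B l s z) * (linB B s t z * v t) * v k) -
      (conj (linB B k s z) * conj (v s)) * (conj (linB B l t z) * conj (v t)) := fun s t => by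
    have e : ∀ k, conj (linB B k s z) * linB B s t z =
        ∑ r, ∑ h, conj (B₁ B h k s) * B₁ B r s t * z r * conj (z h) := fun k => by
      rw [conj_linB, linB_eq, Finset.sum_mul_sum, Finset.sum_comm]
      exact Finset.sum_congr rfl fun r _ => Finset.sum_congr rfl fun h _ => by ring
    have e' : conj (linB B k s z) * conj (linB B l t z) =
        ∑ r, ∑ h, conj (B₁ B r k s) * conj (B₁ B h l t) * conj (z r) * conj (z h) := by
      rw [conj_linB, conj_linB, Finset.sum_mul_sum]
      exact Finset.sum_congr rfl fun r _ => Finset.sum_congr rfl fun h _ => by ring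
    have : (1 / 2 : ℂ) * (conj (linB B k s z) * (linB B s t z * v t) * v l +
        conj (linB B l s z) * (linB B s t z * v t) * v k) -
      (conj (linB B k s z) * conj (v s)) * (conj (linB B l t z) * conj (v t)) =
      (1 / 2 : ℂ) * v t * v l * (conj (linB B k s z) * linB B s t z) +
      (1 / 2 : ℂ) * v t * v k * (conj (linB B l s z) * linB B s t z) -
      conj (v s) * conj (v t) * (conj (linB B k s z) * conj (linB B l t z)) := by ring
    rw [this, e, e, e']
    simp only [Finset.mul_sum, ← Finset.sum_add_distrib, ← Finset.sum_sub_distrib]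
    exact Finset.sum_congr rfl fun r _ => Finset.sum_congr rfl fun h _ => by ring
  have h2 : ∑ s, ∑ t, ((1 / 2 : ℂ) * (conj (linB B k s z) * (linB B s t z * v t) * v l +
        conj (linB B l s z) * (linB B s t z * v t) * v k) -
      (conj (linB B k s z) * conj (v s)) * (conj (linB B l t z) * conj (v t))) =
      (1 / 2 : ℂ) * ((∑ s, conj (linB B k s z) * evLin B s z v) * v l +
        (∑ s, conj (linB B l s z) * evLin B s z v) * v k) -
      conj (evLin B k z v) * conj (evLin B l z v) := by
    rw [conj_evLin, conj_evLin, Finset.sum_mul_sum]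
    simp only [evLin, Finset.mul_sum, Finset.sum_mul, Finset.sum_sub_distrib,
      Finset.sum_add_distrib, mul_add]
  have h3 : ∑ t, (conj (jet₂ (fun w => B w k t) z) * v l * conj (v t) +
      conj (jet₂ (fun w => B w l t) z) * v k * conj (v t)) =
      conj (evJet B k z v) * v l + conj (evJet B l z v) * v k := by
    simp only [evJet, map_sum, map_mul, Finset.sum_mul, ← Finset.sum_add_distrib]
    exact Finset.sum_congr rfl fun t _ => by ring
  rw [Qholo]
  simp only [h1, h2, h3]
  ring

variable {B} {A : Cn n → Matrix (Fin n) (Fin n) ℂ}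

namespace NormalForm

variable (H : NormalForm U A B)
include H

lemma evB_eqv_evJet (k : Fin n) : Eqv U 1 3 (evB B k) (evJet B k) :=
  Eqv.sum H.mem _ fun l _ => Eqv.smul_right H.mem (IsForm.var_apply l)
    (ord_sub_jet₂ H.mem (H.smoothB k l)) le_rfl

lemma zeta_eqv_evJet (k : Fin n) : Eqv U 1 3 (zeta A B k) (fun z v =>
    Complex.I / 2 * ∑ j, conj (linB B k j z) * evLin B j z v + conj (evJet B k z v)) :=
  (H.evDev_eqv k).add H.mem ((H.evB_eqv_evJet k).conj H.mem)

/-- In v_k v_l + (Jv)_k (Jv)_l the leading terms cancel, leaving i(v_k ζ_l + ζ_k v_l) + ζ_k ζ_l. The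
linear terms need ζ to order three, the product only to order two. -/
lemma eqv_Qholo (k l : Fin n) : Eqv U 2 3 (fun z v => v k * v l +
    (Complex.I * v k + zeta A B k z v) * (Complex.I * v l + zeta A B l z v))
    (Qholo B k l) := by
  have h1 := ((H.zeta_eqv_evJet l).var_mul H.mem k).const_mul H.mem Complex.I
  have h2 := ((H.zeta_eqv_evJet k).mul_var H.mem l).const_mul H.mem Complex.I
  have h3 := Eqv.mul_linear (k := 3) H.mem (H.isForm_zeta k) (H.isForm_conj_evLin l)
    (H.zeta_eqv k) (H.zeta_eqv l) le_rfl le_rfl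
  refine IsForm.congr ((h1.add H.mem h2).add H.mem h3) fun z _ v => ?_
  rw [Qholo_eq]
  linear_combination -(v k * v l + (1 / 2 : ℂ) *
    ((∑ s, conj (linB B k s z) * evLin B s z v) * v l +
        (∑ s, conj (linB B l s z) * evLin B s z v) * v k)) * Complex.I_sq

/-- Now the leading terms add up to the Levi term. Only the Hermitian symmetrization of Q can be
recovered, since a real part combined with D_k D̄_l = D̄_l D_k sees nothing else. -/
lemma eqv_Qmixed (k l : Fin n) : Eqv U 2 3 (fun z v => v k * conj (v l) +
    (Complex.I * v k + zeta A B k z v) * conj (Complex.I * v l + zeta A B l z v))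
    (fun z v => 2 * (v k * conj (v l)) +
      (1 / 2 : ℂ) * (Qmixed B k l z v + conj (Qmixed B l k z v))) := by
  have h1 := (((H.zeta_eqv_evJet l).conj H.mem).var_mul H.mem k).const_mul H.mem Complex.I
  have h2 := ((H.zeta_eqv_evJet k).mul_conj_var H.mem l).const_mul H.mem (-Complex.I)
  have h3 := Eqv.mul_linear (k := 3) H.mem (H.isForm_zeta k) (H.isForm_evLin l)
    (H.zeta_eqv k) (H.conj_zeta_eqv l) le_rfl le_rfl
  refine IsForm.congr ((h1.add H.mem h2).add H.mem h3) fun z _ v => ?_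
  simp only [Qmixed_eq, map_add, map_mul, map_sum, Complex.conj_conj, Complex.conj_I, map_ofNat,
    map_div₀]
  ring_nf
  simp only [Complex.I_sq]
  ring

end NormalForm

end SecondOrderCoefficients

/-! ### The parts of the expansion as differential operators -/

section Parts

lemma sum_rotate {ι α : Type*} [Fintype ι] [AddCommMonoid α] (T : ι → ι → ι → α) :
    ∑ a, ∑ b, ∑ c, T a b c = ∑ c, ∑ a, ∑ b, T a b c := by
  have : ∀ a, ∑ b, ∑ c, T a b c = ∑ c, ∑ b, T a b c := fun a => Finset.sum_comm
  simp only [this]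
  exact Finset.sum_comm

variable {n : ℕ} {U : TopologicalSpace.Opens (Cn n)} {u : 𝓓'(U, ℂ)} {ξ : Cn n → Cn n}
  (B : Cn n → Matrix (Fin n) (Fin n) ℂ)

/-- The coefficients of `leviPart`. -/
noncomputable def leviCoeff : (c d : Fin n ⊕ Fin n) → Cn n → ℂ
  | .inl k, .inr l, v => 2 * (v k * conj (v l))
  | .inl _, .inl _, _ => 0
  | .inr _, _, _ => 0

/-- The coefficients of `QPart`. -/
noncomputable def QCoeff : (c d : Fin n ⊕ Fin n) → Cn n → Cn n → ℂ
  | .inl k, .inl l, z, v => (1 / 2 : ℂ) * Qholo B k l z v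
  | .inl k, .inr l, z, v => (1 / 2 : ℂ) * Qmixed B k l z v
  | .inr k, .inl l, z, v => (1 / 2 : ℂ) * conj (Qmixed B k l z v)
  | .inr k, .inr l, z, v => (1 / 2 : ℂ) * conj (Qholo B k l z v)

/-- The coefficients of `RPart`. -/
noncomputable def RCoeff : (c : Fin n ⊕ Fin n) → Cn n → Cn n → ℂ
  | .inl s, z, v => (1 / 2 : ℂ) * firstOrderJet B s z v
  | .inr s, z, v => (1 / 2 : ℂ) * conj (firstOrderJet B s z v)

lemma contDiffOn_conj_apply (hξ : ContDiffOn ℝ ∞ ξ U) (k : Fin n) :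
    ContDiffOn ℝ ∞ (fun z => conj (ξ z k)) U := contDiffOn_conj (contDiffOn_apply hξ k)

lemma contDiffOn_leviCoeff (hξ : ContDiffOn ℝ ∞ ξ U) (c d : Fin n ⊕ Fin n) :
    ContDiffOn ℝ ∞ (fun z => leviCoeff c d (ξ z)) U := by
  cases c <;> cases d <;> simp only [leviCoeff]
  · exact contDiffOn_const
  · exact contDiffOn_const.mul ((contDiffOn_apply hξ _).mul (contDiffOn_conj_apply hξ _))
  · exact contDiffOn_const
  · exact contDiffOn_const

lemma contDiffOn_QCoeff (h : ∀ k l, ContDiffOn ℝ ∞ (fun z => Qholo B k l z (ξ z)) U)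
    (h' : ∀ k l, ContDiffOn ℝ ∞ (fun z => Qmixed B k l z (ξ z)) U) (c d : Fin n ⊕ Fin n) :
    ContDiffOn ℝ ∞ (fun z => QCoeff B c d z (ξ z)) U := by
  cases c <;> cases d <;> simp only [QCoeff]
  · exact contDiffOn_const.mul (h _ _)
  · exact contDiffOn_const.mul (h' _ _)
  · exact contDiffOn_const.mul (contDiffOn_conj (h' _ _))
  · exact contDiffOn_const.mul (contDiffOn_conj (h _ _))

lemma leviPart_eq_op2 (hξ : ContDiffOn ℝ ∞ ξ U) (u : 𝓓'(U, ℂ)) :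
    leviPart u ξ = op2 (fun c d z => leviCoeff c d (ξ z)) (fun _ _ => 0) u := by
  have h : ∀ k l, ContDiffOn ℝ ∞ (fun z => ξ z k * conj (ξ z l)) U := fun k l =>
    (contDiffOn_apply hξ k).mul (contDiffOn_conj_apply hξ l)
  simp only [leviPart, op2, Fintype.sum_sum_type, leviCoeff, zero_mulDist, Finset.sum_const_zero,
    add_zero, zero_add, const_mul_mulDist _ (h _ _), Finset.smul_sum, derivation, Sum.elim_inl,
    Sum.elim_inr]

/-- Reality of u is used here: the conjugate of D_c D_d u is again a derivative of u, with barred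
indices. -/
lemma reDist_mulDist_derivation₂ (hu : conjDist u = u) {f : Cn n → ℂ} (hf : ContDiffOn ℝ ∞ f U)
    (c d : Fin n ⊕ Fin n) : reDist (mulDist f (derivation c (derivation d u))) =
      mulDist (fun z => (1 / 2 : ℂ) * f z) (derivation c (derivation d u)) +
      mulDist (fun z => (1 / 2 : ℂ) * conj (f z)) (derivation c.swap (derivation d.swap u)) := by
  rw [reDist_eq, conjDist_mulDist hf, conjDist_derivation, conjDist_derivation, hu,
    const_mul_mulDist _ hf, const_mul_mulDist _ (contDiffOn_conj hf)]
  module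

lemma reDist_mulDist_derivation (hu : conjDist u = u) {f : Cn n → ℂ} (hf : ContDiffOn ℝ ∞ f U)
    (c : Fin n ⊕ Fin n) : reDist (mulDist f (derivation c u)) =
      mulDist (fun z => (1 / 2 : ℂ) * f z) (derivation c u) +
      mulDist (fun z => (1 / 2 : ℂ) * conj (f z)) (derivation c.swap u) := by
  rw [reDist_eq, conjDist_mulDist hf, conjDist_derivation, hu,
    const_mul_mulDist _ hf, const_mul_mulDist _ (contDiffOn_conj hf)]
  module

lemma reDist_add (S T : 𝓓'(U, ℂ)) : reDist (S + T) = reDist S + reDist T := map_add _ _ _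

lemma reDist_sum {ι : Type*} (s : Finset ι) (T : ι → 𝓓'(U, ℂ)) :
    reDist (∑ i ∈ s, T i) = ∑ i ∈ s, reDist (T i) := map_sum _ _ _

lemma QPart_eq_op2 (hu : conjDist u = u)
    (h : ∀ k l, ContDiffOn ℝ ∞ (fun z => Qholo B k l z (ξ z)) U)
    (h' : ∀ k l, ContDiffOn ℝ ∞ (fun z => Qmixed B k l z (ξ z)) U) :
    QPart B u ξ = op2 (fun c d z => QCoeff B c d z (ξ z)) (fun _ _ => 0) u := by
  have e1 : ∀ k l, reDist (mulDist (fun z => Qmixed B k l z (ξ z)) (dz k (dzbar l u))) =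
      mulDist (fun z => (1 / 2 : ℂ) * Qmixed B k l z (ξ z)) (dz k (dzbar l u)) +
      mulDist (fun z => (1 / 2 : ℂ) * conj (Qmixed B k l z (ξ z))) (dzbar k (dz l u)) :=
    fun k l => reDist_mulDist_derivation₂ hu (h' k l) (.inl k) (.inr l)
  have e2 : ∀ k l, reDist (mulDist (fun z => Qholo B k l z (ξ z)) (dz k (dz l u))) =
      mulDist (fun z => (1 / 2 : ℂ) * Qholo B k l z (ξ z)) (dz k (dz l u)) +
      mulDist (fun z => (1 / 2 : ℂ) * conj (Qholo B k l z (ξ z))) (dzbar k (dzbar l u)) :=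
    fun k l => reDist_mulDist_derivation₂ hu (h k l) (.inl k) (.inl l)
  simp only [QPart, op2, Fintype.sum_sum_type, QCoeff, zero_mulDist, Finset.sum_const_zero,
    add_zero, derivation, Sum.elim_inl, Sum.elim_inr, reDist_add, e1, e2, Finset.sum_add_distrib]
  abel

lemma contDiffOn_Rkl (k l s : Fin n) : ContDiffOn ℝ ∞ (Rkl B k l s) U :=
  ContDiffOn.sum fun r _ => ContDiffOn.sum fun h _ =>
    ((contDiffOn_const.mul (contDiffOn_coord (.inl r))).mul (contDiffOn_coord (.inl h))).add
      ((contDiffOn_const.mul (contDiffOn_coord (.inl r))).mul (contDiffOn_coord (.inr h)))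

lemma contDiffOn_Rklbar (k l s : Fin n) : ContDiffOn ℝ ∞ (Rklbar B k l s) U :=
  (ContDiffOn.sum fun r _ => (ContDiffOn.sum fun _ _ =>
      contDiffOn_const.mul (contDiffOn_coord (.inl r))).add
    (contDiffOn_const.mul (contDiffOn_coord (.inr r)))).add
  (ContDiffOn.sum fun r _ => ContDiffOn.sum fun h _ =>
    (((contDiffOn_const.mul (contDiffOn_coord (.inl r))).mul (contDiffOn_coord (.inl h))).add
      ((contDiffOn_const.mul (contDiffOn_coord (.inl r))).mul (contDiffOn_coord (.inr h)))).add
      ((contDiffOn_const.mul (contDiffOn_coord (.inr r))).mul (contDiffOn_coord (.inr h))))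

lemma contDiffOn_Rkbarlbar (k l s : Fin n) : ContDiffOn ℝ ∞ (Rkbarlbar B k l s) U :=
  ContDiffOn.sum fun r _ => ContDiffOn.sum fun h _ =>
    ((contDiffOn_const.mul (contDiffOn_coord (.inl r))).mul (contDiffOn_coord (.inr h))).add
      ((contDiffOn_const.mul (contDiffOn_coord (.inr r))).mul (contDiffOn_coord (.inr h)))

lemma contDiffOn_RTerm (hξ : ContDiffOn ℝ ∞ ξ U) (k l s : Fin n) :
    ContDiffOn ℝ ∞ (fun z => Rkl B k l s z * ξ z k * ξ z l +
      Rklbar B k l s z * ξ z k * conj (ξ z l) +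
      Rkbarlbar B k l s z * conj (ξ z k) * conj (ξ z l)) U :=
  ((((contDiffOn_Rkl B k l s).mul (contDiffOn_apply hξ k)).mul (contDiffOn_apply hξ l)).add
    (((contDiffOn_Rklbar B k l s).mul (contDiffOn_apply hξ k)).mul
      (contDiffOn_conj_apply hξ l))).add
    (((contDiffOn_Rkbarlbar B k l s).mul (contDiffOn_conj_apply hξ k)).mul
      (contDiffOn_conj_apply hξ l))

lemma contDiffOn_firstOrderJet (hξ : ContDiffOn ℝ ∞ ξ U) (s : Fin n) :
    ContDiffOn ℝ ∞ (fun z => firstOrderJet B s z (ξ z)) U := by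
  simp only [firstOrderJet_eq]
  exact ContDiffOn.sum fun k _ => ContDiffOn.sum fun l _ => contDiffOn_RTerm B hξ k l s

lemma contDiffOn_RCoeff (hξ : ContDiffOn ℝ ∞ ξ U) (c : Fin n ⊕ Fin n) :
    ContDiffOn ℝ ∞ (fun z => RCoeff B c z (ξ z)) U := by
  cases c <;> simp only [RCoeff]
  · exact contDiffOn_const.mul (contDiffOn_firstOrderJet B hξ _)
  · exact contDiffOn_const.mul (contDiffOn_conj (contDiffOn_firstOrderJet B hξ _))

/-- By `firstOrderJet_eq` the double sum over k, l in front of ∂u/∂z_s is the truncated first order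
coefficient. -/
lemma RPart_eq_op2 (hu : conjDist u = u) (hξ : ContDiffOn ℝ ∞ ξ U) :
    RPart B u ξ = op2 (fun _ _ _ => 0) (fun c z => RCoeff B c z (ξ z)) u := by
  have e : ∀ s, ∑ k, ∑ l, reDist (mulDist (fun z => Rkl B k l s z * ξ z k * ξ z l +
      Rklbar B k l s z * ξ z k * conj (ξ z l) +
      Rkbarlbar B k l s z * conj (ξ z k) * conj (ξ z l)) (dz s u)) =
      mulDist (fun z => (1 / 2 : ℂ) * firstOrderJet B s z (ξ z)) (dz s u) +
      mulDist (fun z => (1 / 2 : ℂ) * conj (firstOrderJet B s z (ξ z))) (dzbar s u) := fun s => by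
    have h1 := reDist_mulDist_derivation hu (contDiffOn_firstOrderJet B hξ s) (.inl s)
    refine Eq.trans ?_ h1
    simp only [firstOrderJet_eq]
    rw [sum_mulDist _ (fun k _ => ContDiffOn.sum fun l _ => contDiffOn_RTerm B hξ k l s),
      reDist_sum]
    refine Finset.sum_congr rfl fun k _ => ?_
    rw [sum_mulDist _ (fun l _ => contDiffOn_RTerm B hξ k l s), reDist_sum]
    rfl
  have e' : RPart B u ξ = ∑ s, ∑ k, ∑ l, reDist (mulDist (fun z => Rkl B k l s z * ξ z k * ξ z l +
      Rklbar B k l s z * ξ z k * conj (ξ z l) +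
      Rkbarlbar B k l s z * conj (ξ z k) * conj (ξ z l)) (dz s u)) := by
    exact sum_rotate _
  rw [e']
  simp only [e, op2, Fintype.sum_sum_type, RCoeff, zero_mulDist, Finset.sum_const_zero,
    zero_add, derivation, Sum.elim_inl, Sum.elim_inr, Finset.sum_add_distrib]

lemma quadraticTerm_eq_op2 (hξ : ContDiffOn ℝ ∞ ξ U)
    {F : (a b c d : Fin n ⊕ Fin n) → Cn n → ℂ} {G : (a b c : Fin n ⊕ Fin n) → Cn n → ℂ}
    (hF : ∀ a b c d, ContDiffOn ℝ ∞ (F a b c d) U) (hG : ∀ a b c, ContDiffOn ℝ ∞ (G a b c) U)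
    (u : 𝓓'(U, ℂ)) : quadraticTerm F G u ξ =
      op2 (fun c d z => ∑ a, ∑ b, F a b c d z * (xiVar (ξ z) a * xiVar (ξ z) b))
        (fun c z => ∑ a, ∑ b, G a b c z * (xiVar (ξ z) a * xiVar (ξ z) b)) u := by
  have hx : ∀ a b, ContDiffOn ℝ ∞ (fun z => xiVar (ξ z) a * xiVar (ξ z) b) U := fun a b =>
    (contDiffOn_xiVar hξ a).mul (contDiffOn_xiVar hξ b)
  have key : ∀ (f : (a b : Fin n ⊕ Fin n) → Cn n → ℂ) (_ : ∀ a b, ContDiffOn ℝ ∞ (f a b) U)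
      (T : 𝓓'(U, ℂ)), mulDist (fun z => ∑ a, ∑ b, f a b z * (xiVar (ξ z) a * xiVar (ξ z) b)) T =
      ∑ a, ∑ b, mulDist (fun z => xiVar (ξ z) a * xiVar (ξ z) b) (mulDist (f a b) T) := by
    intro f hf T
    rw [sum_mulDist _ (fun a _ => ContDiffOn.sum fun b _ => (hf a b).mul (hx a b))]
    refine Finset.sum_congr rfl fun a _ => ?_
    rw [sum_mulDist _ (fun b _ => (hf a b).mul (hx a b))]
    refine Finset.sum_congr rfl fun b _ => ?_
    rw [← mul_mulDist (hx a b) (hf a b)]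
    simp only [mul_comm]
  simp only [quadraticTerm, op2, key _ (fun a b => hF a b _ _), key _ (fun a b => hG a b _),
    mulDist_add (hx _ _), mulDist_sum (hx _ _), Finset.sum_add_distrib]
  congr 1
  · rw [sum_rotate]
    exact Finset.sum_congr rfl fun c _ => sum_rotate _
  · exact sum_rotate _

end Parts

/-! ### The expansion of the Hessian -/

section Expansion

variable {n : ℕ} {U : TopologicalSpace.Opens (Cn n)}

lemma IsForm.contDiffOn {d k : ℕ} {φ : Cn n → Cn n → ℂ} (hφ : IsForm U d k φ) {ξ : Cn n → Cn n}
    (hξ : ContDiffOn ℝ ∞ ξ U) : ContDiffOn ℝ ∞ (fun z => φ z (ξ z)) U := by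
  obtain ⟨a, ha, h⟩ := hφ
  refine ContDiffOn.congr ?_ fun z hz => h z hz (ξ z)
  exact ContDiffOn.sum fun i _ => (ha i).contDiffOn.mul
    (contDiffOn_prod fun j _ => contDiffOn_xiVar hξ (i j))

namespace NormalForm

variable {A B : Cn n → Matrix (Fin n) (Fin n) ℂ} (H : NormalForm U A B)
include H

/-- Obtained from the congruence with Bv rather than from the polynomial itself; order zero
suffices, as only smoothness of the coefficients of Q is wanted. -/
lemma isForm_evJet (k : Fin n) : IsForm U 1 0 (evJet B k) :=
  Eqv.isForm H.mem (((H.evB_eqv_evJet k).symm H.mem).mono (by norm_num))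
    ((H.isForm_evB k).mono (by norm_num))

lemma isForm_sum_linB (k : Fin n) :
    IsForm U 1 0 (fun z v => ∑ s, conj (linB B k s z) * evLin B s z v) :=
  IsForm.sum H.mem _ fun s _ =>
    (IsForm.smul H.mem ((ord_linB H.mem k s).conj H.mem) (H.isForm_evLin s)).mono (by norm_num)

lemma isForm_Qmixed (k l : Fin n) : IsForm U 2 0 (Qmixed B k l) :=
  (IsForm.add H.mem (IsForm.const_mul H.mem (2 * Complex.I)
      ((IsForm.var_apply k).linear_mul H.mem (H.isForm_evJet l)))
    (IsForm.add H.mem ((H.isForm_sum_linB k).linear_mul H.mem (IsForm.var_conj l))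
      (((H.isForm_conj_evLin k).mul_linear H.mem (H.isForm_evLin l)).mono (by norm_num)))).congr
    fun z _ v => (Qmixed_eq B k l z v).symm

lemma isForm_Qholo (k l : Fin n) : IsForm U 2 0 (Qholo B k l) := by
  have h : ∀ k l, IsForm U 2 0 (fun z v => conj (evJet B k z v) * v l) := fun k l =>
    ((H.isForm_evJet k).conj H.mem).linear_mul H.mem (IsForm.var_apply l)
  have h' : ∀ k l, IsForm U 2 0
      (fun z v => (∑ s, conj (linB B k s z) * evLin B s z v) * v l) := fun k l =>
    (H.isForm_sum_linB k).linear_mul H.mem (IsForm.var_apply l)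
  exact (IsForm.add H.mem (IsForm.sub H.mem
    (IsForm.const_mul H.mem Complex.I ((h k l).add H.mem (h l k)))
    (IsForm.const_mul H.mem (1 / 2) ((h' k l).add H.mem (h' l k))))
    (((H.isForm_conj_evLin k).mul_linear H.mem (H.isForm_conj_evLin l)).mono (by norm_num))).congr
    fun z _ v => (Qholo_eq B k l z v).symm

end NormalForm

variable {V : TopologicalSpace.Opens (Cn n)} (J : Cn n → Cn n →L[ℝ] Cn n)

/-- The symmetrized coefficients of second order of the remainder. -/
noncomputable def remSecond (c d : Fin n ⊕ Fin n) (z v : Cn n) : ℂ :=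
  (1 / 2 : ℂ) * ((hessSecond J c d z v + hessSecond J d c z v) -
    ((leviCoeff c d v + leviCoeff d c v) +
      (QCoeff (fun z => matB (J z)) c d z v + QCoeff (fun z => matB (J z)) d c z v)))

/-- The coefficients of first order of the remainder. -/
noncomputable def remFirst (c : Fin n ⊕ Fin n) (z v : Cn n) : ℂ :=
  xiVar (firstOrderField J z v) c - RCoeff (fun z => matB (J z)) c z v

variable {J}

lemma remSecond_comm (c d : Fin n ⊕ Fin n) (z v : Cn n) :
    remSecond J c d z v = remSecond J d c z v := by
  simp only [remSecond]; ring

lemma conj_leviCoeff_add (c d : Fin n ⊕ Fin n) (v : Cn n) :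
    conj (leviCoeff c.swap d.swap v + leviCoeff d.swap c.swap v) =
      leviCoeff c d v + leviCoeff d c v := by
  cases c <;> cases d <;> simp [leviCoeff, map_ofNat] <;> ring

lemma conj_QCoeff (B : Cn n → Matrix (Fin n) (Fin n) ℂ) (c d : Fin n ⊕ Fin n) (z v : Cn n) :
    conj (QCoeff B c.swap d.swap z v) = QCoeff B c d z v := by
  cases c <;> cases d <;> simp [QCoeff, map_ofNat]

lemma conj_hessSecond (c d : Fin n ⊕ Fin n) (z v : Cn n) :
    conj (hessSecond J c.swap d.swap z v) = hessSecond J c d z v := by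
  simp [hessSecond, xiVar_swap, map_ofNat]

/-- Reality of the remainder is exact, not merely modulo higher order. It relies on the
symmetrization in `remSecond`, since `leviCoeff` alone is not invariant. -/
lemma conj_remSecond (c d : Fin n ⊕ Fin n) (z v : Cn n) :
    conj (remSecond J c.swap d.swap z v) = remSecond J c d z v := by
  rw [remSecond, remSecond, ← conj_leviCoeff_add c d, ← conj_QCoeff _ c d, ← conj_QCoeff _ d c,
    ← conj_hessSecond c d, ← conj_hessSecond d c]
  simp [map_ofNat]

lemma conj_remFirst (c : Fin n ⊕ Fin n) (z v : Cn n) :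
    conj (remFirst J c.swap z v) = remFirst J c z v := by
  rw [remFirst, xiVar_swap]
  cases c <;> simp [remFirst, RCoeff, map_ofNat]

lemma isForm_remSecond (H : NormalForm V (fun z => matA (J z)) fun z => matB (J z))
    (c d : Fin n ⊕ Fin n) : IsForm V 2 3 (remSecond J c d) := by
  have holo : ∀ k l, IsForm V 2 3 (remSecond J (.inl k) (.inl l)) := fun k l => by
    refine (IsForm.const_mul H.mem (1 / 4)
      (IsForm.add H.mem (H.eqv_Qholo k l) (H.eqv_Qholo l k))).congr fun z _ v => ?_
    simp only [remSecond, hessSecond, xiVar, Sum.elim_inl, leviCoeff, QCoeff, apply_eq_zeta]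
    ring
  have mixed : ∀ k l, IsForm V 2 3 (remSecond J (.inl k) (.inr l)) := fun k l => by
    refine (IsForm.const_mul H.mem (1 / 2) (H.eqv_Qmixed k l)).congr fun z _ v => ?_
    simp only [remSecond, hessSecond, xiVar, Sum.elim_inl, Sum.elim_inr, leviCoeff, QCoeff,
      apply_eq_zeta]
    ring
  rcases c with k | k <;> rcases d with l | l
  · exact holo k l
  · exact mixed k l
  · exact (mixed l k).congr fun z _ v => remSecond_comm _ _ z v
  · exact ((holo k l).conj H.mem).congr fun z _ v => conj_remSecond (.inr k) (.inr l) z v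

lemma isForm_remFirst (hJ : ContDiffOn ℝ ∞ J V)
    (H : NormalForm V (fun z => matA (J z)) fun z => matB (J z)) (c : Fin n ⊕ Fin n) :
    IsForm V 2 3 (remFirst J c) := by
  have holo : ∀ s, IsForm V 2 3 (remFirst J (.inl s)) := fun s => by
    refine (IsForm.const_mul H.mem (1 / 2) (H.firstOrderSum_eqv s)).congr fun z hz v => ?_
    simp only [remFirst, xiVar, Sum.elim_inl, RCoeff, firstOrderField_apply hJ hz]
    ring
  rcases c with s | s
  · exact holo s
  · exact ((holo s).conj H.mem).congr fun z _ v => conj_remFirst (.inr s) z v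

/-- The expansion of the Hessian in coordinates in which the matrices of the structure are in normal
form. -/
theorem exists_expansion (hJ : ContDiffOn ℝ ∞ J V) (hJ2 : ∀ z ∈ V, ∀ v, J z (J z v) = -v)
    (H : NormalForm V (fun z => matA (J z)) fun z => matB (J z)) (h0 : 0 ∈ U)
    (hU : IsCompact (closure (U : Set (Cn n)))) (hUV : closure (U : Set (Cn n)) ⊆ V) :
    ∃ (F : (a b c d : Fin n ⊕ Fin n) → Cn n → ℂ) (G : (a b c : Fin n ⊕ Fin n) → Cn n → ℂ),
      (∀ a b c d, InMaximalIdealCube U (F a b c d)) ∧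
      (∀ a b c, InMaximalIdealCube U (G a b c)) ∧
      ∀ u : 𝓓'(U, ℂ), conjDist u = u → ∀ ξ : Cn n → Cn n, ContDiffOn ℝ ∞ ξ U →
        hessian J u ξ = leviPart u ξ + QPart (fun z => matB (J z)) u ξ +
          RPart (fun z => matB (J z)) u ξ + quadraticTerm F G u ξ ∧
        conjDist (quadraticTerm F G u ξ) = quadraticTerm F G u ξ := by
  have hle : U ≤ V := fun z hz => hUV (subset_closure hz)
  -- The coefficient functions come from forms on V, before u and ξ are introduced, so they depend
  -- on neither.
  choose F hF hF' using fun c d => (isForm_remSecond H c d).exists_quadratic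
  choose G hG hG' using fun c => (isForm_remFirst hJ H c).exists_quadratic
  refine ⟨fun a b c d => F c d a b, fun a b c => G c a b,
    fun a b c d => (hF c d a b).inMaximalIdealCube h0 hU hUV,
    fun a b c => (hG c a b).inMaximalIdealCube h0 hU hUV, fun u hu ξ hξ => ?_⟩
  have hJU : ContDiffOn ℝ ∞ J U := hJ.mono hle
  have HU := H.mono h0 hle
  have hFs : ∀ a b c d, ContDiffOn ℝ ∞ (F c d a b) U := fun a b c d =>
    (hF c d a b).contDiffOn.mono hle
  have hGs : ∀ a b c, ContDiffOn ℝ ∞ (G c a b) U := fun a b c => (hG c a b).contDiffOn.mono hle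
  have hQ := fun k l => (HU.isForm_Qholo k l).contDiffOn hξ
  have hQ' := fun k l => (HU.isForm_Qmixed k l).contDiffOn hξ
  have hf := contDiffOn_hessSecond hJU hξ
  have hl := contDiffOn_leviCoeff hξ
  have hq := contDiffOn_QCoeff _ hQ hQ'
  have hr := contDiffOn_RCoeff (fun z => matB (J z)) hξ
  have hg : ∀ c : Fin n ⊕ Fin n, ContDiffOn ℝ ∞ (fun z => xiVar (firstOrderField J z (ξ z)) c) U :=
    contDiffOn_xiVar (contDiffOn_firstOrderField hJU hξ)
  have hS : ∀ c d, ContDiffOn ℝ ∞ (fun z => remSecond J c d z (ξ z)) U := fun c d =>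
    contDiffOn_const.mul (((hf c d).add (hf d c)).sub
      (((hl c d).add (hl d c)).add ((hq c d).add (hq d c))))
  have hT : ∀ c, ContDiffOn ℝ ∞ (fun z => remFirst J c z (ξ z)) U := fun c => (hg c).sub (hr c)
  have hx := fun c => contDiffOn_xiVar hξ c
  have hquad : quadraticTerm (fun a b c d => F c d a b) (fun a b c => G c a b) u ξ =
      op2 (fun c d z => remSecond J c d z (ξ z)) (fun c z => remFirst J c z (ξ z)) u := by
    rw [quadraticTerm_eq_op2 hξ hFs hGs]
    symm
    refine op2_congr hS (fun c d => ContDiffOn.sum fun a _ => ContDiffOn.sum fun b _ =>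
      (hFs a b c d).mul ((hx a).mul (hx b))) hT ?_ ?_ u
    · intro c d z hz
      rw [hF' c d z (hle hz), hF' d c z (hle hz)]
    · intro c z hz
      rw [hG' c z (hle hz)]
  constructor
  · rw [hquad, hessian_eq_op2 hJU (fun z hz => hJ2 z (hle hz)) hξ, leviPart_eq_op2 hξ,
      QPart_eq_op2 _ hu hQ hQ', RPart_eq_op2 _ hu hξ,
      op2_add hl hq (fun _ => contDiffOn_const) (fun _ => contDiffOn_const),
      op2_add (fun c d => (hl c d).add (hq c d)) (fun _ _ => contDiffOn_const)
        (fun _ => contDiffOn_const.add contDiffOn_const) hr,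
      op2_add (fun c d => ((hl c d).add (hq c d)).add contDiffOn_const) hS
        (fun c => (contDiffOn_const.add contDiffOn_const).add (hr c)) hT]
    -- The remainder was defined as the symmetrized difference, so the identity holds exactly; the
    -- order of vanishing plays no role at this point.
    refine op2_congr hf (fun c d => (((hl c d).add (hq c d)).add contDiffOn_const).add (hS c d))
      hg ?_ ?_ u
    · intro c d z _
      simp only [remSecond]; ring
    · intro c z _
      simp only [remFirst]; ring
  · rw [hquad, conjDist_op2 hS hT, hu]
    simp only [conj_remSecond, conj_remFirst]

end Expansion

/-! ### The torsion and the matrix `B` -/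

section Torsion

variable {n : ℕ} {U : TopologicalSpace.Opens (Cn n)} {J : Cn n → Cn n →L[ℝ] Cn n}

/-- The Nijenhuis tensor `[Jv, Jw] - J ([v, Jw] + [Jv, w])` on constant fields `v`, `w`. -/
noncomputable def nijenhuis (J : Cn n → Cn n →L[ℝ] Cn n) (v w z : Cn n) : Cn n :=
  fderiv ℝ J z (J z v) w - fderiv ℝ J z (J z w) v - J z (fderiv ℝ J z v w - fderiv ℝ J z w v)

lemma contDiffOn_nijenhuis (hJ : ContDiffOn ℝ ∞ J U) (v w : Cn n) :
    ContDiffOn ℝ ∞ (nijenhuis J v w) U := by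
  have hJ' := hJ.fderiv_of_isOpen (m := ∞) U.isOpen (by simp)
  have h : ∀ v w : Cn n, ContDiffOn ℝ ∞ (fun z => fderiv ℝ J z v w) U := fun v w =>
    (hJ'.clm_apply contDiffOn_const).clm_apply contDiffOn_const
  have h' : ∀ v w : Cn n, ContDiffOn ℝ ∞ (fun z => fderiv ℝ J z (J z v) w) U := fun v w =>
    (hJ'.clm_apply (contDiffOn_endo_apply hJ contDiffOn_const)).clm_apply contDiffOn_const
  exact ((h' v w).sub (h' w v)).sub (contDiffOn_endo_apply hJ ((h v w).sub (h w v)))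

/-- For constant fields [v, w] = 0. The constant is ½ from the (0,1)-projection times ¼ from the two
(1,0)-projections, with the sign of i² in front of [Jv, Jw]. -/
lemma torsion_re_eq (hJ : ContDiffOn ℝ ∞ J U) (v w : Cn n) {z : Cn n} (hz : z ∈ U) :
    (torsion J (.ofReal fun _ => v) (.ofReal fun _ => w)).re z =
      (-(1 / 8) : ℝ) • nijenhuis J v w z := by
  have hd : DifferentiableAt ℝ J z :=
    (hJ.contDiffAt (U.isOpen.mem_nhds hz)).differentiableAt (by simp)
  have hc : ∀ v : Cn n, ContDiffOn ℝ ∞ (fun _ : Cn n => v) U := fun v => contDiffOn_const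
  have hJc : ∀ v : Cn n, ContDiffOn ℝ ∞ (fun z => J z v) U := fun v =>
    contDiffOn_endo_apply hJ (hc v)
  have hD : ∀ v w : Cn n, fderiv ℝ (fun z => J z v) z w = fderiv ℝ J z w v := fun v w => by
    rw [fderiv_clm_apply hd (differentiableAt_const v)]
    simp
  have hre : ∀ v : Cn n, ∀ z ∈ U,
      ((ComplexField.ofReal fun _ => v).part10 J).re z = (1 / 2 : ℝ) • v := fun v z _ => by
    simp [ComplexField.part10, ComplexField.ofReal]
  have him : ∀ v : Cn n, ∀ z ∈ U,
      ((ComplexField.ofReal fun _ => v).part10 J).im z = (-(1 / 2) : ℝ) • J z v := fun v z _ => by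
    simp only [ComplexField.part10, ComplexField.ofReal]; module
  simp only [torsion, ComplexField.part01, ComplexField.bracket]
  rw [lieBracket_of_eqOn_smul (hc v) (hc w) _ _ (hre v) (hre w) hz,
    lieBracket_of_eqOn_smul (hJc v) (hJc w) _ _ (him v) (him w) hz,
    lieBracket_of_eqOn_smul (hc v) (hJc w) _ _ (hre v) (him w) hz,
    lieBracket_of_eqOn_smul (hJc v) (hc w) _ _ (him v) (hre w) hz]
  simp only [VectorField.lieBracket_eq, hD, fderiv_fun_const, Pi.zero_apply, _root_.zero_apply,
    nijenhuis, map_add, map_sub, map_smul, map_zero]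
  module

lemma ord_nijenhuis (h0 : 0 ∈ U) (hJ : ContDiffOn ℝ ∞ J U) (hτ : TorsionOneJetVanishes J)
    (v w : Cn n) (s : Fin n) : Ord U 2 (fun z => nijenhuis J v w z s) := by
  -- The real part of the torsion already determines the Nijenhuis tensor.
  obtain ⟨h1, -, h2, -⟩ := hτ v w
  have hN := contDiffOn_nijenhuis hJ v w
  have hN' : ∀ z ∈ U, nijenhuis J v w z =
      (-8 : ℝ) • (torsion J (.ofReal fun _ => v) (.ofReal fun _ => w)).re z := fun z hz => by
    rw [torsion_re_eq hJ v w hz]; module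
  have hs : ContDiffOn ℝ ∞ (fun z => nijenhuis J v w z s) U := contDiffOn_apply hN s
  have hd : fderiv ℝ (fun z => nijenhuis J v w z s) 0 = 0 := by
    ext x
    have := fderiv_xiVar hN (.inl s) h0 x
    have h3 : fderiv ℝ (nijenhuis J v w) 0 = 0 := by
      rw [fderiv_congr_of_mem hN' h0]
      have h4 := congrFun (fderiv_const_smul_field (-8 : ℝ)
        (f := (torsion J (.ofReal fun _ => v) (.ofReal fun _ => w)).re) (𝕜 := ℝ)) 0
      rw [Pi.smul_apply, h2, smul_zero] at h4
      exact h4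
    rw [h3] at this
    simpa [xiVar] using this
  refine ⟨hs, ?_, fun c => ⟨contDiffOn_wd hs c, ?_, fun d => contDiffOn_wd (contDiffOn_wd hs c) d⟩⟩
  · beta_reduce
    rw [hN' 0 h0, h1]; simp
  · rw [wd_apply, hd]; simp

lemma fderiv_endo_single (hJ : ContDiffOn ℝ ∞ J U) {z : Cn n} (hz : z ∈ U) (w : Cn n)
    (l s : Fin n) : fderiv ℝ J z w (Pi.single l 1) s = ∑ k,
      (w k * (wirt k (devA (fun z => matA (J z)) s l) z +
        conj (wirtBar k (fun z => matB (J z) s l) z)) +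
      conj (w k) * (wirtBar k (devA (fun z => matA (J z)) s l) z +
        conj (wirt k (fun z => matB (J z) s l) z))) := by
  rw [fderiv_endo_apply hJ hz]
  refine Finset.sum_congr rfl fun k _ => ?_
  rw [Finset.sum_eq_single l]
  · simp
  · intro b _ hb; simp [hb]
  · simp

variable (H : NormalForm U (fun z => matA (J z)) fun z => matB (J z))
include H

/-- If `B` vanishes to order `p + 1`, the torsion determines the antisymmetric part of the
derivatives `∂B_{sl}/∂z_r` to order `p + 1`. -/
lemma ord_nijenhuis_add (hJ : ContDiffOn ℝ ∞ J U) {p : ℕ}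
    (hA : ∀ k l, Ord U (p + 2) (devA (fun z => matA (J z)) k l))
    (hB : ∀ k l, Ord U (p + 1) (fun z => matB (J z) k l)) (r l s : Fin n) :
    Ord U (p + 1) (fun z => nijenhuis J (Pi.single r 1) (Pi.single l 1) z s +
      2 * Complex.I * (conj (wirt r (fun z => matB (J z) s l) z) -
        conj (wirt l (fun z => matB (J z) s r) z))) := by
  have h0 := H.mem
  set a := devA fun z => matA (J z) with ha
  set b : Fin n → Fin n → Cn n → ℂ := fun k l z => matB (J z) k l with hb
  have hAw : ∀ c k l, Ord U (p + 1) (wd c (a k l)) := fun c k l => (hA k l).wd c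
  have hBw : ∀ c k l, Ord U p (fun z => conj (wd c (b k l) z)) := fun c k l =>
    ((hB k l).wd c).conj h0
  have hX : ∀ k s l, Ord U p (fun z => wirt k (a s l) z + conj (wirtBar k (b s l) z)) :=
    fun k s l => (hAw (.inl k) s l).of_succ.add h0 (hBw (.inr k) s l)
  have hY : ∀ k s l, Ord U p (fun z => wirtBar k (a s l) z + conj (wirt k (b s l) z)) :=
    fun k s l => (hAw (.inr k) s l).of_succ.add h0 (hBw (.inl k) s l)
  have hd : ∀ k r, Ord U (p + 1) (fun z => a k r z + conj (b k r z)) := fun k r =>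
    (hA k r).of_succ.add h0 ((hB k r).conj h0)
  -- In the derivative along J e_r, the part coming from J - i has order p + 1 and is multiplied by
  -- a derivative of J of order p, so it is negligible.
  have herr : ∀ r l s, Ord U (p + 1) (fun z => ∑ k,
      ((a k r z + conj (b k r z)) * (wirt k (a s l) z + conj (wirtBar k (b s l) z)) +
      conj (a k r z + conj (b k r z)) * (wirtBar k (a s l) z + conj (wirt k (b s l) z)))) :=
    fun r l s => Ord.sum h0 _ fun k _ =>
      (((hd k r).mul h0 (hX k s l)).mono (by omega)).add h0
        ((((hd k r).conj h0).mul h0 (hY k s l)).mono (by omega))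
  have hDsingle : ∀ r l s, ∀ z ∈ U, fderiv ℝ J z (Pi.single r 1) (Pi.single l 1) s =
      (wirt r (a s l) z + conj (wirtBar r (b s l) z)) +
      (wirtBar r (a s l) z + conj (wirt r (b s l) z)) := fun r l s z hz => by
    rw [fderiv_endo_single hJ hz, Finset.sum_eq_single r]
    · simp [ha, hb]
    · intro k _ hk; simp [hk]
    · simp
  have hJsingle : ∀ r k z, J z (Pi.single r 1) k = Complex.I * (1 : Matrix (Fin n) (Fin n) ℂ) k r +
      (a k r z + conj (b k r z)) := fun r k z => by
    rw [apply_single, ha, hb, devA]; simp only [map_one, mul_one]; ring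
  have hDJ : ∀ r l s, ∀ z ∈ U, fderiv ℝ J z (J z (Pi.single r 1)) (Pi.single l 1) s =
      Complex.I * (wirt r (a s l) z + conj (wirtBar r (b s l) z)) -
      Complex.I * (wirtBar r (a s l) z + conj (wirt r (b s l) z)) + ∑ k,
      ((a k r z + conj (b k r z)) * (wirt k (a s l) z + conj (wirtBar k (b s l) z)) +
      conj (a k r z + conj (b k r z)) * (wirtBar k (a s l) z + conj (wirt k (b s l) z))) :=
    fun r l s z hz => by
    have h1 : ∀ k, conj ((1 : Matrix (Fin n) (Fin n) ℂ) k r) =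
        (1 : Matrix (Fin n) (Fin n) ℂ) k r := fun k => by
      rw [Matrix.one_apply]; split_ifs <;> simp
    have h2 : ∀ f : Fin n → ℂ, ∑ k, (1 : Matrix (Fin n) (Fin n) ℂ) k r * f k = f r := fun f => by
      simp [Matrix.one_apply]
    rw [fderiv_endo_single hJ hz, ← h2 fun r => wirt r (a s l) z + conj (wirtBar r (b s l) z),
      ← h2 fun r => wirtBar r (a s l) z + conj (wirt r (b s l) z), Finset.mul_sum, Finset.mul_sum,
      ← Finset.sum_sub_distrib, ← Finset.sum_add_distrib]
    refine Finset.sum_congr rfl fun k _ => ?_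
    rw [hJsingle, map_add conj (Complex.I * _), map_mul, Complex.conj_I, h1]
    simp only [ha, hb]
    ring
  have hDord : ∀ r l s, Ord U p (fun z => fderiv ℝ J z (Pi.single r 1) (Pi.single l 1) s) :=
    fun r l s => ((hX r s l).add h0 (hY r s l)).congr h0 fun z hz => (hDsingle r l s z hz).symm
  set E : Fin n → Cn n → ℂ := fun s z => fderiv ℝ J z (Pi.single r 1) (Pi.single l 1) s -
    fderiv ℝ J z (Pi.single l 1) (Pi.single r 1) s with hE
  have hEord : ∀ s, Ord U p (E s) := fun s => (hDord r l s).sub h0 (hDord l r s)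
  have hJE : Ord U (p + 1) (fun z => ∑ j, (a s j z * E j z + conj (b s j z) * conj (E j z))) :=
    Ord.sum h0 _ fun j _ => (((hA s j).mul h0 (hEord j)).mono (by omega)).add h0
      ((((hB s j).conj h0).mul h0 ((hEord j).conj h0)).mono (by omega))
  have hAr : ∀ r l, Ord U (p + 1) (fun z => -2 * Complex.I * wirtBar r (a s l) z) := fun r l =>
    (hAw (.inr r) s l).const_mul h0 _
  -- To leading order the derivative along J e_r is i∂_r - i∂̄_r. Combined with -i(∂_r + ∂̄_r) from
  -- the J-term, only -2i∂̄_r remains; acting on A + B̄ it gives a negligible ∂̄A and the conjugate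
  -- of ∂B.
  refine ((((herr r l s).sub h0 (herr l r s)).sub h0 hJE).add h0
    ((hAr r l).sub h0 (hAr l r))).congr h0 fun z hz => ?_
  have hJz : J z (fderiv ℝ J z (Pi.single r 1) (Pi.single l 1) -
      fderiv ℝ J z (Pi.single l 1) (Pi.single r 1)) s =
      Complex.I * E s z + ∑ j, (a s j z * E j z + conj (b s j z) * conj (E j z)) := by
    rw [apply_eq_zeta, zeta, evDev, evB, map_sum, ← Finset.sum_add_distrib]
    simp only [map_mul]
    rfl
  simp only [nijenhuis, Pi.sub_apply, hJz]
  rw [hDJ r l s z hz, hDJ l r s z hz]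
  simp only [hE]
  rw [hDsingle r l s z hz, hDsingle l r s z hz]
  ring

/-- The Nijenhuis tensor has order two, hence order p + 1 since p ≤ 1. Subtracting it, conjugating
and multiplying by i/2 isolates the antisymmetric part of the derivatives. -/
lemma ord_wirt_sub_wirt (hJ : ContDiffOn ℝ ∞ J U) (hτ : TorsionOneJetVanishes J) {p : ℕ}
    (hp : p + 1 ≤ 2) (hA : ∀ k l, Ord U (p + 2) (devA (fun z => matA (J z)) k l))
    (hB : ∀ k l, Ord U (p + 1) (fun z => matB (J z) k l)) (r l s : Fin n) :
    Ord U (p + 1) (fun z => wirt r (fun z => matB (J z) s l) z -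
      wirt l (fun z => matB (J z) s r) z) := by
  have h0 := H.mem
  have h := (ord_nijenhuis_add H hJ hA hB r l s).sub h0
    ((ord_nijenhuis h0 hJ hτ (Pi.single r 1) (Pi.single l 1) s).mono hp)
  refine ((h.conj h0).const_mul h0 (Complex.I / 2)).congr h0 fun z _ => ?_
  simp only [map_sub, map_add, map_mul, Complex.conj_conj, Complex.conj_I, map_ofNat]
  linear_combination -(wirt r (fun z => matB (J z) s l) z - wirt l (fun z => matB (J z) s r) z) *
    Complex.I_sq

/-- The `1`-jet of the torsion determines the `2`-jet of `B`, provided that the coefficients of the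
monomials whose holomorphic indices are at most `l` vanish in the entries `B_{k,l}`. -/
lemma jets_eq_zero (hJ : ContDiffOn ℝ ∞ J U) (hτ : TorsionOneJetVanishes J)
    (hB : ∀ rs ss : List (Fin n), rs.length + ss.length ≤ 3 → ∀ k l, (∀ r ∈ rs, r ≤ l) →
      iterWirt rs ss (fun z => matB (J z) k l) 0 = 0) :
    (∀ r k l, B₁ (fun z => matB (J z)) r k l = 0) ∧
    (∀ r t k l, B₂ (fun z => matB (J z)) r t k l = 0) ∧
    ∀ r t k l, B₁₁ (fun z => matB (J z)) r t k l = 0 := by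
  have h0 := H.mem
  have hB1 : ∀ r k l, wirt r (fun z => matB (J z) k l) 0 = 0 := fun r k l => by
    rcases le_total r l with h | h
    · exact hB [r] [] (by simp) k l (by simpa using h)
    -- If r > l, symmetry exchanges the derivative index with the column index, and the
    -- normalisation then applies.
    · have := (ord_wirt_sub_wirt H hJ hτ (p := 0) (by norm_num) H.ord_devA H.ord_B r l k).apply_zero
      rw [sub_eq_zero] at this
      rw [this]
      exact hB [l] [] (by simp) k r (by simpa using h)
  have hord : ∀ k l, Ord U 2 (fun z => matB (J z) k l) := fun k l => by
    refine ⟨H.smoothB k l, H.matB_zero k l, fun c => ⟨contDiffOn_wd (H.smoothB k l) c, ?_,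
      fun d => contDiffOn_wd (contDiffOn_wd (H.smoothB k l) c) d⟩⟩
    cases c with
    | inl r => exact hB1 r k l
    | inr r => exact H.wirtBar_zero k l r
  -- With B of order two, B̄B has order four, more than enough for the symmetry lemma with p = 1.
  have hA : ∀ k l, Ord U 3 (devA (fun z => matA (J z)) k l) := fun k l =>
    (((H.ord_devA_sub k l).add h0 ((H.ord_conj_mul hord k l).const_mul h0 (Complex.I / 2))).congr
      h0 fun z _ => by ring).of_succ
  have hsymm : ∀ c r l k, wd c (wirt r fun z => matB (J z) k l) 0 =
      wd c (wirt l fun z => matB (J z) k r) 0 := fun c r l k => by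
    have h := ((ord_wirt_sub_wirt H hJ hτ (p := 1) le_rfl hA hord r l k).wd c).apply_zero
    rwa [wd_sub (H.smooth_wirt r k l) (H.smooth_wirt l k r) c h0, sub_eq_zero] at h
  have hcomm : ∀ r t k l, wirt r (wirt t fun z => matB (J z) k l) 0 =
      wirt t (wirt r fun z => matB (J z) k l) 0 := fun r t k l =>
    wirt_comm (H.smoothB k l) h0 r t
  have hB2 : ∀ r t k l, r ≤ l → t ≤ l → wirt r (wirt t fun z => matB (J z) k l) 0 = 0 :=
    fun r t k l hr ht => hB [r, t] [] (by simp) k l (by simp [hr, ht])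
  refine ⟨fun r k l => hB1 r k l, fun r t k l => ?_, fun r t k l => ?_⟩
  -- The second derivatives are symmetric in all of r, t, l, so the largest of the three can be made
  -- the column index.
  · have : wirt r (wirt t fun z => matB (J z) k l) 0 = 0 := by
      have h1 := hsymm (.inl r) t l k
      have h2 := hsymm (.inl t) r l k
      simp only [wd_inl] at h1 h2
      rcases le_total r l with hr | hr
      · rcases le_total t l with ht | ht
        · exact hB2 r t k l hr ht
        · rw [h1]
          exact hB2 r l k t (hr.trans ht) ht
      · rcases le_total t r with ht | ht
        · rw [hcomm, h2]
          exact hB2 t l k r ht hr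
        · rw [h1]
          exact hB2 r l k t ht (hr.trans ht)
    simp [B₂, iterWirt, this]
  · change wirt r (wirtBar t fun z => matB (J z) k l) 0 = 0
    rcases le_total r l with h | h
    · exact hB [r] [t] (by simp) k l (by simpa using h)
    · rw [← wirtBar_wirt (H.smoothB k l) h0, show wirtBar t (wirt r fun z => matB (J z) k l) 0 =
        wirtBar t (wirt l fun z => matB (J z) k r) 0 from hsymm (.inr t) r l k,
        wirtBar_wirt (H.smoothB k r) h0]
      exact hB [l] [t] (by simp) k r (by simpa using h)

end Torsion

/-! ### The expansion when the 2-jet of B vanishes -/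

section Reduced

variable {n : ℕ} {U : TopologicalSpace.Opens (Cn n)} {A B : Cn n → Matrix (Fin n) (Fin n) ℂ}

lemma imDist_sum {ι : Type*} (s : Finset ι) (T : ι → 𝓓'(U, ℂ)) :
    imDist (∑ i ∈ s, T i) = ∑ i ∈ s, imDist (T i) := map_sum _ _ _

lemma linB_eq_zero (h1 : ∀ r k l, B₁ B r k l = 0) (k l : Fin n) (z : Cn n) :
    linB B k l z = 0 := by
  simp [linB_eq, h1]

lemma linDbarB_eq_zero (h3 : ∀ r t k l, B₁₁ B r t k l = 0) (t k l : Fin n) (z : Cn n) :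
    linDbarB B t k l z = 0 := by
  simp [linDbarB_eq, h3]

lemma evJet_eq_zero (H : NormalForm U A B) (h1 : ∀ r k l, B₁ B r k l = 0)
    (h2 : ∀ r t k l, B₂ B r t k l = 0) (h3 : ∀ r t k l, B₁₁ B r t k l = 0) (k : Fin n)
    (z v : Cn n) : evJet B k z v = 0 := by
  refine Finset.sum_eq_zero fun t _ => ?_
  have hwd : ∀ c, wd c (fun w => B w k t) 0 = 0 := fun c => by
    cases c with
    | inl r => exact h1 r k t
    | inr r => exact H.wirtBar_zero k t r
  have hwd2 : ∀ c d, wd c (wd d fun w => B w k t) 0 = 0 := fun c d => by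
    rcases c with r | r <;> rcases d with s | s <;> simp only [wd_inl, wd_inr]
    · simpa [B₂, iterWirt] using h2 r s k t
    · exact h3 r s k t
    · rw [wirtBar_wirt (H.smoothB k t) H.mem]
      exact h3 s r k t
    · exact H.wirtBar₂_zero k t r s
  rw [jet₂, fderiv_eq_sum_wd, fderiv_fderiv_eq_sum (H.smoothB k t) H.mem]
  simp [hwd, hwd2, H.matB_zero]

lemma QPart_eq_zero (H : NormalForm U A B) (h1 : ∀ r k l, B₁ B r k l = 0)
    (h2 : ∀ r t k l, B₂ B r t k l = 0) (h3 : ∀ r t k l, B₁₁ B r t k l = 0) (u : 𝓓'(U, ℂ))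
    (ξ : Cn n → Cn n) : QPart B u ξ = 0 := by
  have e1 : ∀ k l z v, Qmixed B k l z v = 0 := fun k l z v => by
    simp [Qmixed_eq, evJet_eq_zero H h1 h2 h3, linB_eq_zero h1, evLin]
  have e2 : ∀ k l z v, Qholo B k l z v = 0 := fun k l z v => by
    simp [Qholo_eq, evJet_eq_zero H h1 h2 h3, linB_eq_zero h1, evLin]
  refine Finset.sum_eq_zero fun k _ => Finset.sum_eq_zero fun l _ => ?_
  simp only [e1, e2, zero_mulDist, add_zero]
  exact map_zero _

/-- Every quadratic expression in the first and second order coefficients of B contains a factor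
that vanishes; only the quadratic part of ∂B/∂z̄, made of third order coefficients, is left. -/
lemma RPart_eq_reducedPart (h1 : ∀ r k l, B₁ B r k l = 0)
    (h3 : ∀ r t k l, B₁₁ B r t k l = 0) (u : 𝓓'(U, ℂ)) {ξ : Cn n → Cn n}
    (hξ : ContDiffOn ℝ ∞ ξ U) : RPart B u ξ = -((2 : ℂ) • reducedPart B u ξ) := by
  have e1 : ∀ k l s z, Rkl B k l s z = 0 := fun k l s z => by
    simp [Rkl_eq, h1, linB_eq_zero h1]
  have e2 : ∀ k l s z, Rkbarlbar B k l s z = 0 := fun k l s z => by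
    simp [Rkbarlbar_eq, linB_eq_zero h1]
  have e3 : ∀ k l s z, Rklbar B k l s z = 2 * Complex.I * conj (quadDbarB B k s l z) :=
    fun k l s z => by
    simp [Rklbar_eq, linB_eq_zero h1, linDbarB_eq_zero h3, h1]
  have hs : ∀ k l s r h, ContDiffOn ℝ ∞ (fun z => (2 * conj (B₁₂ B h r k s l) * z r * conj (z h) +
      conj (B₂₁ B r h k s l) * conj (z r) * conj (z h)) * ξ z k * conj (ξ z l)) U :=
    fun k l s r h => ((((contDiffOn_const.mul (contDiffOn_coord (.inl r))).mul
      (contDiffOn_coord (.inr h))).add ((contDiffOn_const.mul (contDiffOn_coord (.inr r))).mul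
      (contDiffOn_coord (.inr h)))).mul (contDiffOn_apply hξ k)).mul (contDiffOn_conj_apply hξ l)
  simp only [RPart, reducedPart, Finset.smul_sum, ← Finset.sum_neg_distrib]
  refine Finset.sum_congr rfl fun k _ => Finset.sum_congr rfl fun l _ =>
    Finset.sum_congr rfl fun s _ => ?_
  have e4 : (fun z => Rkl B k l s z * ξ z k * ξ z l + Rklbar B k l s z * ξ z k * conj (ξ z l) +
      Rkbarlbar B k l s z * conj (ξ z k) * conj (ξ z l)) = fun z => (2 * Complex.I) *
      ∑ r, ∑ h, (2 * conj (B₁₂ B h r k s l) * z r * conj (z h) +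
        conj (B₂₁ B r h k s l) * conj (z r) * conj (z h)) * ξ z k * conj (ξ z l) := by
    ext z
    rw [e1, e2, e3, conj_quadDbarB]
    simp only [← Finset.sum_mul]
    simp only [add_comm (2 * conj (B₁₂ B _ _ _ _ _) * _ * _)]
    ring
  -- Re(2iT) = -2 Im T, which turns the real part of R into the imaginary part of the reduced
  -- formula.
  have e5 : ∀ T : 𝓓'(U, ℂ), reDist ((2 * Complex.I) • T) = -((2 : ℂ) • imDist T) := fun T => by
    rw [reDist_eq, imDist_eq, conjDist_smul]
    simp only [map_mul, map_ofNat, Complex.conj_I]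
    module
  rw [e4, const_mul_mulDist _ (ContDiffOn.sum fun r _ => ContDiffOn.sum fun h _ => hs k l s r h),
    e5, sum_mulDist _ (fun r _ => ContDiffOn.sum fun h _ => hs k l s r h), imDist_sum,
    Finset.smul_sum, ← Finset.sum_neg_distrib]
  refine Finset.sum_congr rfl fun r _ => ?_
  rw [sum_mulDist _ (fun h _ => hs k l s r h), imDist_sum, Finset.smul_sum,
    ← Finset.sum_neg_distrib]

end Reduced

/-! ### Coordinates on the manifold -/

section Charts

variable {n : ℕ} {X : Type*} [TopologicalSpace X] [ChartedSpace (Cn n) X]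
  {e : OpenPartialHomeomorph X (Cn n)}

lemma mdifferentiable_of_mem_maximalAtlas [IsManifold 𝓘(ℝ, Cn n) ∞ X]
    (he : e ∈ IsManifold.maximalAtlas 𝓘(ℝ, Cn n) ∞ X) :
    e.MDifferentiable 𝓘(ℝ, Cn n) 𝓘(ℝ, Cn n) :=
  ⟨(contMDiffOn_of_mem_maximalAtlas he).mdifferentiableOn (by simp),
    (contMDiffOn_symm_of_mem_maximalAtlas he).mdifferentiableOn (by simp)⟩

/-- The inner differentials of e and its inverse cancel, so J² = -1 is transported from X to the
image of the chart. -/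
lemma AlmostComplexStructure.inChart_inChart [IsManifold 𝓘(ℝ, Cn n) ∞ X]
    (J : AlmostComplexStructure n X) (he : e ∈ IsManifold.maximalAtlas 𝓘(ℝ, Cn n) ∞ X) {z : Cn n}
    (hz : z ∈ e.target) (v : Cn n) : J.inChart e z (J.inChart e z v) = -v := by
  have hd := mdifferentiable_of_mem_maximalAtlas he
  have h1 := hd.symm_comp_deriv (e.map_target hz)
  rw [e.right_inv hz] at h1
  have h2 := hd.comp_symm_deriv hz
  have h1' : ∀ w, mfderiv 𝓘(ℝ, Cn n) 𝓘(ℝ, Cn n) e.symm z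
      (mfderiv 𝓘(ℝ, Cn n) 𝓘(ℝ, Cn n) e (e.symm z) w) = w := fun w => congrArg (fun L => L w) h1
  have h2' : mfderiv 𝓘(ℝ, Cn n) 𝓘(ℝ, Cn n) e (e.symm z)
      (mfderiv 𝓘(ℝ, Cn n) 𝓘(ℝ, Cn n) e.symm z v) = v := congrArg (fun L => L v) h2
  change mfderiv 𝓘(ℝ, Cn n) 𝓘(ℝ, Cn n) e (e.symm z) (J.toFun (e.symm z)
    (mfderiv 𝓘(ℝ, Cn n) 𝓘(ℝ, Cn n) e.symm z (mfderiv 𝓘(ℝ, Cn n) 𝓘(ℝ, Cn n) e (e.symm z)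
      (J.toFun (e.symm z) (mfderiv 𝓘(ℝ, Cn n) 𝓘(ℝ, Cn n) e.symm z v))))) = -v
  rw [h1', J.sq, map_neg, h2']
  rfl

lemma AlmostComplexStructure.contDiffOn_inChart (J : AlmostComplexStructure n X)
    (he : e ∈ IsManifold.maximalAtlas 𝓘(ℝ, Cn n) ∞ X) :
    ContDiffOn ℝ ∞ (J.inChart e) (chartImage e) := J.smooth e he

lemma exists_relatively_compact {V : TopologicalSpace.Opens (Cn n)} (h0 : 0 ∈ V) :
    ∃ U : TopologicalSpace.Opens (Cn n), 0 ∈ U ∧ IsCompact (closure (U : Set (Cn n))) ∧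
      closure (U : Set (Cn n)) ⊆ V := by
  obtain ⟨W, hW, h0W, hWV, hWc⟩ := exists_open_between_and_isCompact_closure
    (isCompact_singleton (x := (0 : Cn n))) V.isOpen (Set.singleton_subset_iff.2 h0)
  exact ⟨⟨W, hW⟩, h0W (Set.mem_singleton _), hWc, hWV⟩

variable {J : AlmostComplexStructure n X} {x : X} {N : ℕ}

lemma IsAlmostComplexCoordinates.zero_mem (he : IsAlmostComplexCoordinates J x N e) :
    (0 : Cn n) ∈ chartImage e := by
  have := e.map_source he.mem_source
  rwa [he.centred] at this

/-- Only the case of no holomorphic index is used: the ordering condition on r_1, …, r_p matters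
solely when the torsion hypothesis is exploited. -/
lemma IsAlmostComplexCoordinates.normalForm [IsManifold 𝓘(ℝ, Cn n) ∞ X]
    (he : IsAlmostComplexCoordinates J x N e) (hN : 3 ≤ N) :
    NormalForm (chartImage e) (fun z => matA (J.inChart e z)) fun z => matB (J.inChart e z) :=
  normalForm_of_jets he.zero_mem (J.contDiffOn_inChart he.mem_atlas)
    (fun _ hz v => J.inChart_inChart he.mem_atlas hz v) he.matA_zero
    fun ss hss k l => he.taylor_matB [] ss (by simpa using hss.trans hN) k l (by simp)

/-- The Hessian in complex coordinates. -/
theorem hessian_eq_leviPart {U : TopologicalSpace.Opens (Cn n)} {J : Cn n → Cn n →L[ℝ] Cn n}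
    (hJ : ∀ z ∈ U, ∀ v, J z v = Complex.I • v) (u : 𝓓'(U, ℂ)) {ξ : Cn n → Cn n}
    (hξ : ContDiffOn ℝ ∞ ξ U) : hessian J u ξ = leviPart u ξ := by
  obtain ⟨T, hT⟩ : ∃ T : Cn n →L[ℝ] Cn n, ∀ v, T v = Complex.I • v :=
    ⟨Complex.I • ContinuousLinearMap.id ℝ (Cn n), fun v => rfl⟩
  have hJT : ∀ z ∈ U, J z = T := fun z hz => ContinuousLinearMap.ext fun v => by
    rw [hJ z hz, hT]
  have hJs : ContDiffOn ℝ ∞ J U := (contDiffOn_const (c := T)).congr hJT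
  have hJ2 : ∀ z ∈ U, ∀ v, J z (J z v) = -v := fun z hz v => by
    rw [hJ z hz, hJ z hz, smul_smul, Complex.I_mul_I, neg_one_smul]
  rw [hessian_eq_op2 hJs hJ2 hξ, leviPart_eq_op2 hξ]
  refine op2_congr (contDiffOn_hessSecond hJs hξ) (contDiffOn_leviCoeff hξ)
    (contDiffOn_xiVar (contDiffOn_firstOrderField hJs hξ)) ?_ ?_ u
  · intro c d z hz
    rcases c with k | k <;> rcases d with l | l <;>
      simp only [hessSecond, leviCoeff, xiVar, Sum.elim_inl, Sum.elim_inr, hJ z hz, Pi.smul_apply,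
        smul_eq_mul, map_mul, Complex.conj_I] <;> ring_nf <;> simp only [Complex.I_sq] <;> ring
  -- J is constant near z, so the first order field vanishes identically.
  · intro c z hz
    have h0 : fderiv ℝ J z = 0 := by
      rw [fderiv_congr_of_mem hJT hz, fderiv_fun_const]
      rfl
    cases c <;> simp [firstOrderField, h0, xiVar]

end Charts

end AlmostComplex

/-! ### Assembly of the three expansions -/

theorem mainTheorem8 {n : ℕ} {X : Type*} [TopologicalSpace X] [ChartedSpace (AlmostComplex.Cn n) X]
    [IsManifold 𝓘(ℝ, AlmostComplex.Cn n) ∞ X] (J : AlmostComplex.AlmostComplexStructure n X)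
    (x : X) :
    -- the expansion in almost complex coordinates of order at least three
    (∀ N : ℕ, 3 ≤ N → ∀ e : OpenPartialHomeomorph X (AlmostComplex.Cn n),
      AlmostComplex.IsAlmostComplexCoordinates J x N e →
      (∃ (U : TopologicalSpace.Opens (AlmostComplex.Cn n)) (hU : U ≤ AlmostComplex.chartImage e)
        (F : (a b c d : Fin n ⊕ Fin n) → AlmostComplex.Cn n → ℂ)
        (G : (a b c : Fin n ⊕ Fin n) → AlmostComplex.Cn n → ℂ),
        0 ∈ U ∧
        (∀ a b c d, AlmostComplex.InMaximalIdealCube U (F a b c d)) ∧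
        (∀ a b c, AlmostComplex.InMaximalIdealCube U (G a b c)) ∧
        ∀ (u : AlmostComplex.RealDistribution n X)
          (ξ : AlmostComplex.Cn n → AlmostComplex.Cn n), ContDiffOn ℝ ∞ ξ U →
          let v := AlmostComplex.restrictComplex hU (u.inChart e)
          let B := fun z => AlmostComplex.matB (J.inChart e z)
          AlmostComplex.hessian (J.inChart e) v ξ =
            AlmostComplex.leviPart v ξ + AlmostComplex.QPart B v ξ + AlmostComplex.RPart B v ξ +
              AlmostComplex.quadraticTerm F G v ξ ∧
          AlmostComplex.conjDist (AlmostComplex.quadraticTerm F G v ξ) =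
            AlmostComplex.quadraticTerm F G v ξ) ∧
      -- the reduced expansion when the 1-jet of the torsion vanishes
      (AlmostComplex.TorsionOneJetVanishes (J.inChart e) →
        ∃ (U : TopologicalSpace.Opens (AlmostComplex.Cn n)) (hU : U ≤ AlmostComplex.chartImage e)
          (F : (a b c d : Fin n ⊕ Fin n) → AlmostComplex.Cn n → ℂ)
          (G : (a b c : Fin n ⊕ Fin n) → AlmostComplex.Cn n → ℂ),
          0 ∈ U ∧
          (∀ a b c d, AlmostComplex.InMaximalIdealCube U (F a b c d)) ∧
          (∀ a b c, AlmostComplex.InMaximalIdealCube U (G a b c)) ∧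
          ∀ (u : AlmostComplex.RealDistribution n X)
            (ξ : AlmostComplex.Cn n → AlmostComplex.Cn n), ContDiffOn ℝ ∞ ξ U →
            let v := AlmostComplex.restrictComplex hU (u.inChart e)
            let B := fun z => AlmostComplex.matB (J.inChart e z)
            AlmostComplex.hessian (J.inChart e) v ξ =
              AlmostComplex.leviPart v ξ - (2 : ℂ) • AlmostComplex.reducedPart B v ξ +
                AlmostComplex.quadraticTerm F G v ξ ∧
            AlmostComplex.conjDist (AlmostComplex.quadraticTerm F G v ξ) =
              AlmostComplex.quadraticTerm F G v ξ)) ∧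
    -- the exact expression in complex coordinates, in the integrable case
    (∀ e : OpenPartialHomeomorph X (AlmostComplex.Cn n),
      AlmostComplex.IsComplexCoordinates J x e →
      ∀ (u : AlmostComplex.RealDistribution n X)
        (ξ : AlmostComplex.Cn n → AlmostComplex.Cn n), ContDiffOn ℝ ∞ ξ e.target →
        let v := AlmostComplex.restrictComplex (le_refl (AlmostComplex.chartImage e)) (u.inChart e)
        AlmostComplex.hessian (J.inChart e) v ξ = AlmostComplex.leviPart v ξ) := by
  refine ⟨fun N hN e he => ?_, fun e he u ξ hξ =>
    AlmostComplex.hessian_eq_leviPart he.standard _ hξ⟩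
  have hJ := J.contDiffOn_inChart he.mem_atlas
  have H := he.normalForm hN
  obtain ⟨U, h0, hc, hUV⟩ := AlmostComplex.exists_relatively_compact he.zero_mem
  have hU : U ≤ AlmostComplex.chartImage e := fun z hz => hUV (subset_closure hz)
  obtain ⟨F, G, hF, hG, h⟩ := AlmostComplex.exists_expansion hJ
    (fun z hz v => J.inChart_inChart he.mem_atlas hz v) H h0 hc hUV
  refine ⟨⟨U, hU, F, G, h0, hF, hG, fun u ξ hξ =>
    h _ (AlmostComplex.conjDist_restrictComplex hU _) ξ hξ⟩,
    fun hτ => ⟨U, hU, F, G, h0, hF, hG, fun u ξ hξ => ?_⟩⟩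
  -- The reduced expansion keeps the same neighbourhood and the same remainder; only Q and R are
  -- simplified.
  obtain ⟨h1, h2, h3⟩ := AlmostComplex.jets_eq_zero H hJ hτ
    fun rs ss hl => he.taylor_matB rs ss (hl.trans hN)
  obtain ⟨e1, e2⟩ := h _ (AlmostComplex.conjDist_restrictComplex hU (u.inChart e)) ξ hξ
  refine ⟨?_, e2⟩
  rw [AlmostComplex.QPart_eq_zero (H.mono h0 hU) h1 h2 h3,
    AlmostComplex.RPart_eq_reducedPart h1 h3 _ hξ] at e1
  rw [add_zero, ← sub_eq_add_neg] at e1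
  exact e1
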